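/- **Notation.** Let $k\ge 3$ be an integer and $e(x)=e^{2\pi i x}$. For $|x|<1$ put $$\theta_\infty(x)=\tfrac{i}{2\pi}\left\{(x+\sqrt{x^2-1})^{k-1}-(x-\sqrt{x^2-1})^{k-1}\right\},\qquad \sqrt{x^2-1}=i\sqrt{1-x^2},$$ and $\theta_\infty(x)=0$ for $|x|\ge1$. For real $x\ge 0$ and $y>0$ let $$F(x)=\frac{1}{2K_0(2)}\int_x^\infty e^{-t-1/t}\,\frac{dt}{t},\qquad H(y)=\frac{\sqrt\pi}{2\pi i}\int_{(1)}\frac{\Gamma\left(\frac{1+u}{2}\right)}{\Gamma\left(\frac{2-u}{2}\right)}(\pi y)^{-u}\tilde F(u)\,du,$$ where $K_0(z)=\int_0^\infty e^{-z\cosh t}\,dt$ and $\tilde F(u)=\int_0^\infty F(x)x^{u-1}\,dx$. For positive integers $l,f,n$ and $\xi\in\mathbb Z$ let $$I_{l,f}(\xi,n)=\int_{-1}^1\theta_\infty(x)\left\{F(y_x)+y_xH(y_x)\right\}e\left(\frac{-x\xi\sqrt n}{2lf^2}\right)dx,\qquad y_x=\frac{lf^2(4n)^{-1/2}}{\sqrt{1-x^2}},$$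 $$Kl_{l,f}(\xi,n)=\sum_{\substack{a \bmod 4lf^2\\ f^2\mid a^2-4n\\ (a^2-4n)/f^2\equiv 0,1 \bmod 4}}\left(\frac{(a^2-4n)/f^2}{l}\right)e\left(\frac{a\xi}{4lf^2}\right),$$ with the Kronecker symbol. For real $\kappa,\alpha>0$ and constants $c_1,c_2>0$ (the implied constants of the ranges $lf^2\ll n^{1/4-\kappa}$ and $0<\xi\ll n^{1/6+\kappa+\alpha}$) let $$S_2(n,\kappa,\alpha)=\sum_{\substack{l,f\ge1\\ lf^2\le c_1n^{1/4-\kappa}}}\ \sum_{0<\xi\le c_2n^{1/6+\kappa+\alpha}}\frac{Kl_{l,f}(\xi,n)}{\sqrt l}\,\frac{I_{l,f}(\xi,n)}{(lf^2)^{3/2}},$$ where $l$, $f$ and $\xi$ are integers. **Theorem.** Let $k\ge3$ be an integer, $\kappa>0$, $0<\alpha\le\frac1{12}$ and $c_1,c_2>0$. 1. There is a constant $C$, depending only on $k,\kappa,\alpha$ (and on $c_1,c_2$), such that for all integers $n\ge2$ $$|S_2(n,\kappa,\alpha)|\le C\,\log^2(n)\,n^{-\frac12-\kappa}.$$ 2.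 If moreover $\kappa\le1$, there is a constant $C$, depending only on $k,\kappa,\alpha$ (and on $c_1,c_2$), such that for all real $X\ge2$ $$\left|\sum_{1\le n<X}\sqrt n\,S_2(n,\kappa,\alpha)\right|\le C\,\log^2(X)\,X^{1-\kappa}.$$ -/

import Mathlib

open scoped BigOperators

noncomputable section

namespace BeyondEndoscopy

/-- `e(x) = exp(2πix)`. -/
def e (x : ℝ) : ℂ := Complex.exp (2 * Real.pi * Complex.I * x)

/-- The Kronecker symbol `(D / l)` for an integer `D` and a positive integer `l`: completely
multiplicative in `l`, equal to the Legendre symbol at odd primes, and at `2` equal to `0` for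
even `D`, `1` for `D ≡ ±1 mod 8` and `-1` for `D ≡ ±3 mod 8`. -/
def kronecker (D : ℤ) (l : ℕ) : ℤ :=
  (l.primeFactorsList.map fun p => if p = 2 then ZMod.χ₈ (D : ZMod 8) else jacobiSym D p).prod

/-- The function `θ_∞` attached to the weight `k`. For `|x| < 1` the square root `√(x² - 1)` is
`i √(1 - x²)`. -/
def thetaInf (k : ℕ) (x : ℝ) : ℂ :=
  if |x| < 1 then
    Complex.I / (2 * Real.pi) *
      (((x : ℂ) + Complex.I * (Real.sqrt (1 - x ^ 2) : ℂ)) ^ (k - 1)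
        - ((x : ℂ) - Complex.I * (Real.sqrt (1 - x ^ 2) : ℂ)) ^ (k - 1))
  else 0

/-- The modified Bessel function of the second kind `K_0`, at `z > 0`. -/
def besselK0 (z : ℝ) : ℝ := ∫ t in Set.Ioi (0 : ℝ), Real.exp (-z * Real.cosh t)

/-- The cutoff function `F` of the approximate functional equation. -/
def F (x : ℝ) : ℝ :=
  1 / (2 * besselK0 2) * ∫ y in Set.Ioi x, Real.exp (-y - 1 / y) / y

/-- The cutoff function `H` of the approximate functional equation:
`H(y) = √π/(2πi) ∫_{(1)} Γ((1+u)/2) / Γ((2-u)/2) (πy)^{-u} F̃(u) du` for `y > 0`.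
Here `mellinInv 1 G z = 1/(2πi) ∫_{(1)} z^{-u} G(u) du`. -/
def H (y : ℝ) : ℂ :=
  (Real.sqrt Real.pi : ℂ) *
    mellinInv 1
      (fun u : ℂ => Complex.Gamma ((1 + u) / 2) / Complex.Gamma ((2 - u) / 2)
        * mellin (fun x : ℝ => (F x : ℂ)) u)
      (Real.pi * y)

/-- The Fourier transform `I_{l,f}(ξ,n)`; the auxiliary quantity is
`y = l f² (4n)^{-1/2} / √(1 - x²)`. -/
def fourierI (k l f : ℕ) (ξ : ℤ) (n : ℕ) : ℂ :=
  ∫ x in (-1 : ℝ)..1,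
    let y : ℝ := ((l : ℝ) * (f : ℝ) ^ 2 / Real.sqrt (4 * (n : ℝ))) / Real.sqrt (1 - x ^ 2)
    thetaInf k x * ((F y : ℂ) + (y : ℂ) * H y)
      * e (-(x * (ξ : ℝ) * Real.sqrt (n : ℝ)) / (2 * ((l : ℝ) * (f : ℝ) ^ 2)))

/-- The character sum `Kl_{l,f}(ξ,n)`: the sum of `(((a² - 4n)/f²) / l) e(aξ / (4lf²))` over the
residues `a` modulo `4lf²` such that `f² ∣ a² - 4n` and `(a² - 4n)/f² ≡ 0, 1 mod 4`. -/
def Kl (l f : ℕ) (ξ : ℤ) (n : ℕ) : ℂ :=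
  ∑ a ∈ (Finset.range (4 * l * f ^ 2)).filter (fun a : ℕ =>
      (f : ℤ) ^ 2 ∣ (a : ℤ) ^ 2 - 4 * (n : ℤ) ∧
        (((a : ℤ) ^ 2 - 4 * (n : ℤ)) / (f : ℤ) ^ 2 ≡ 0 [ZMOD 4] ∨
          ((a : ℤ) ^ 2 - 4 * (n : ℤ)) / (f : ℤ) ^ 2 ≡ 1 [ZMOD 4])),
    (kronecker (((a : ℤ) ^ 2 - 4 * (n : ℤ)) / (f : ℤ) ^ 2) l : ℂ)
      * e ((a : ℝ) * (ξ : ℝ) / (4 * ((l : ℝ) * (f : ℝ) ^ 2)))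

/-- The pairs `(l, f)` of positive integers with `l f² ≤ Y`. -/
def pairs (Y : ℝ) : Finset (ℕ × ℕ) :=
  (Finset.Icc 1 ⌊Y⌋₊ ×ˢ Finset.Icc 1 ⌊Y⌋₊).filter
    (fun q => (q.1 : ℝ) * (q.2 : ℝ) ^ 2 ≤ Y)

theorem mem_pairs (Y : ℝ) (l f : ℕ) :
    (l, f) ∈ pairs Y ↔ 1 ≤ l ∧ 1 ≤ f ∧ (l : ℝ) * (f : ℝ) ^ 2 ≤ Y := by
  simp only [pairs, Finset.mem_filter, Finset.mem_product, Finset.mem_Icc]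
  constructor
  · rintro ⟨⟨⟨h1, -⟩, h2, -⟩, h⟩
    exact ⟨h1, h2, h⟩
  · rintro ⟨h1, h2, h⟩
    have h1' : (1 : ℝ) ≤ l := by exact_mod_cast h1
    have h2' : (1 : ℝ) ≤ f := by exact_mod_cast h2
    refine ⟨⟨⟨h1, Nat.le_floor ?_⟩, h2, Nat.le_floor ?_⟩, h⟩ <;> nlinarith [mul_nonneg
      (sub_nonneg.2 h1') (sq_nonneg (f : ℝ)), mul_nonneg (sub_nonneg.2 h2') (sub_nonneg.2 h2')]

/-- The sum `S₂(n,κ,α)`, over positive integers `l`, `f` with `l f² ≤ c₁ n^{1/4-κ}` and integers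
`ξ` with `0 < ξ ≤ c₂ n^{1/6+κ+α}`. -/
def S₂ (k : ℕ) (c₁ c₂ κ α : ℝ) (n : ℕ) : ℂ :=
  ∑ q ∈ pairs (c₁ * (n : ℝ) ^ (1 / 4 - κ)),
    ∑ ξ ∈ Finset.Ioc (0 : ℤ) ⌊c₂ * (n : ℝ) ^ (1 / 6 + κ + α)⌋,
      Kl q.1 q.2 ξ n / (Real.sqrt (q.1 : ℝ) : ℂ)
        * (fourierI k q.1 q.2 ξ n
            / ((((q.1 : ℝ) * (q.2 : ℝ) ^ 2) ^ (3 / 2 : ℝ) : ℝ) : ℂ))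

end BeyondEndoscopy

end

noncomputable section

namespace BeyondEndoscopy

section

/-! ### Stepanov's method for `v² = f(y)` -/

/-! The theorem comes from a bound for each term of `S₂`, with square-root cancellation in the
arithmetic factor and oscillation in the analytic one. `norm_Kl_le` gives |Kl| ≤ 16 d(l) f √l
√gcd(l, ξ), and `exists_norm_fourierI_le` gives I ≪ (l f² / (ξ √n))^{3/2}. After division by √l and
(l f²)^{3/2} a term is ≪ n^{-3/4} d(l) f √gcd(l, ξ) ξ^{-3/2}. The ξ-sum converges and is ≪ ∑_{d ∣ l}
1/d; the sum over l f² ≤ Y = c₁ n^{1/4-κ} is ≪ Y (1 + log Y)², one logarithm coming from d(l) and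
one from ∑ 1/f. This is part 1. Part 2 sums part 1 over n when κ ≤ 1/4; for larger κ the range of
(l, f) is eventually empty, so only boundedly many n contribute.

Bound for Kl. The sum factors over primes by the Chinese remainder theorem. At an odd p with p^k ∥ l
and p^j ∥ f the coefficient has period p^{2j+1} if k > 0, so the sum vanishes unless p^{k-1} ∣ ξ.
What remains is a linear Gauss sum over F_p when j > 0, and the sum of χ(a² - 4n)^k ψ(a) when j = 0.
The prime 2 is estimated trivially.

For k odd and p ∤ n the last sum is a Kloosterman sum, and its Weil bound (`norm_kloosterman_le`) is
proved from scratch. Over a quadratic extension the normalised sum s = -Kl/√q becomes s² - 2, so |s|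
> 2 would force growth without bound up the tower of fields with p^{2^j} elements. By
Artin–Schreier, the sum over all nontrivial ψ of these Kloosterman sums is, up to 1, a character sum
of (y^p - y)² - 4n, and Stepanov's method bounds that below by a constant times √q. Every s is real,
so s² - 2 ≥ -2 and no single one can be large.

Bound for I. `thetaInf` is a polynomial times √(1 - x²). The phase has frequency w = π ξ √n / (l
f²), and an amplitude that vanishes like √(1 - x²) at the endpoints gives w^{-3/2}
(`norm_oscillatory_integral_le`). For the F-part the derivative bounds are uniform in the scale of
y. The H-part is a superposition of powers (1 - x²)^{(1+it)/2} with rapidly decaying weight, by the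
Mellin inversion that defines H. -/

open Polynomial in
-- Infinite descent: `f` divides `r` and then `s`, since a squarefree element is radical, and
-- removing both factors reproduces the equation in lower degree. Comparing parities of degrees
-- would not do, because `f` has even degree in the application.
theorem eq_zero_of_sq_mul_squarefree {K : Type*} [Field K] {f : K[X]} (hf : Squarefree f)
    (hd : 0 < f.natDegree) {c : K} (hc : c ≠ 0) :
    ∀ (N : ℕ) (s r : K[X]), s.natDegree ≤ N → s ^ 2 * f = C c * r ^ 2 → s = 0 := by
  intro N
  induction N using Nat.strong_induction_on with
  | _ N ih =>
    intro s r hs h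
    by_contra hs0
    have hf0 : f ≠ 0 := fun h => by simp [h] at hd
    have hCu : IsUnit (C c : K[X]) := isUnit_C.2 hc.isUnit
    have hfr : f ∣ r := by
      refine (hf.isRadical) 2 r ?_
      have : f ∣ C c * r ^ 2 := ⟨s ^ 2, by rw [← h]; ring⟩
      exact (hCu.dvd_mul_left).1 this
    obtain ⟨r', rfl⟩ := hfr
    have h2 : s ^ 2 = C c * f * r' ^ 2 := by
      apply mul_right_cancel₀ hf0
      rw [h]; ring
    have hfs : f ∣ s := by
      refine (hf.isRadical) 2 s ⟨C c * r' ^ 2, by rw [h2]; ring⟩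
    obtain ⟨s', rfl⟩ := hfs
    have h3 : s' ^ 2 * f = C c * r' ^ 2 := by
      apply mul_right_cancel₀ hf0
      calc _ = (f * s') ^ 2 := by ring
        _ = _ := by rw [h2]; ring
    have hs' : s' ≠ 0 := fun h => hs0 (by simp [h])
    have hdeg := natDegree_mul hf0 hs'
    exact hs' (ih s'.natDegree (by omega) s' r' le_rfl h3)

open Polynomial in
-- This is what makes Stepanov's auxiliary polynomial nonzero. Modulo X^Q only the terms j = 0
-- survive and f^Q becomes the constant f(0)^Q. The degree condition turns the congruence into an
-- equality, which forces both terms to vanish; then X^{2Q} is cancelled.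
theorem coeffs_eq_zero_of_sq_mul_eq {K : Type*} [Field K] {f : K[X]} (hf : Squarefree f)
    (hd : 0 < f.natDegree) (h0 : f.eval 0 ≠ 0) {p a L : ℕ} [CharP K p]
    [Fact p.Prime] {Q : ℕ} (hQp : Q = p ^ a) (hL : 2 * L + f.natDegree < Q) :
    ∀ (J : ℕ) (s r : ℕ → K[X]), (∀ j < J, (s j).natDegree ≤ L) → (∀ j < J, (r j).natDegree ≤ L) →
      (∑ j ∈ Finset.range J, s j * X ^ (j * Q)) ^ 2 * f
        = (∑ j ∈ Finset.range J, r j * X ^ (j * Q)) ^ 2 * f ^ Q →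
      ∀ j < J, s j = 0 ∧ r j = 0 := by
  have hQ : 0 < Q := by omega
  intro J
  induction J with
  | zero => intro s r _ _ _ j hj; omega
  | succ J ih =>
    intro s r hs hr h
    set S := ∑ j ∈ Finset.range J, s (j + 1) * X ^ (j * Q) with hS
    set R := ∑ j ∈ Finset.range J, r (j + 1) * X ^ (j * Q) with hR
    have e : ∀ t : ℕ → K[X], ∑ j ∈ Finset.range (J + 1), t j * X ^ (j * Q)
        = t 0 + X ^ Q * ∑ j ∈ Finset.range J, t (j + 1) * X ^ (j * Q) := by
      intro t
      rw [Finset.sum_range_succ', Finset.mul_sum, add_comm]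
      congr 1
      · simp
      · refine Finset.sum_congr rfl fun j _ => ?_
        ring
    rw [e s, e r, ← hS, ← hR] at h
    -- Frobenius: f^Q - f(0)^Q = (f - f(0))^Q, and X divides f - f(0).
    obtain ⟨u, hu⟩ : (X : K[X]) ^ Q ∣ f ^ Q - C (f.eval 0 ^ Q) := by
      rw [C_pow, hQp, ← sub_pow_char_pow]
      refine pow_dvd_pow_of_dvd ?_ _
      rw [X_dvd_iff, coeff_sub, coeff_zero_eq_eval_zero]
      simp
    have hc : f.eval 0 ^ Q ≠ 0 := pow_ne_zero _ h0
    set c := f.eval 0 ^ Q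
    have hfQ : f ^ Q = C c + X ^ Q * u := by rw [← hu]; ring
    have hdvd : (X : K[X]) ^ Q ∣ s 0 ^ 2 * f - C c * r 0 ^ 2 := by
      rw [hfQ] at h
      refine ⟨-(2 * s 0 * S + X ^ Q * S ^ 2) * f + (2 * r 0 * R + X ^ Q * R ^ 2) * (C c + X ^ Q * u)
        + r 0 ^ 2 * u, ?_⟩
      linear_combination h
    have hz : s 0 ^ 2 * f - C c * r 0 ^ 2 = 0 := by
      refine eq_zero_of_dvd_of_natDegree_lt hdvd ?_
      rw [natDegree_X_pow]
      refine (natDegree_sub_le _ _).trans_lt (max_lt ?_ ?_)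
      · refine (natDegree_mul_le.trans (Nat.add_le_add_right natDegree_pow_le _)).trans_lt ?_
        have := hs 0 (by omega)
        omega
      · refine (natDegree_C_mul_le _ _).trans_lt (natDegree_pow_le.trans_lt ?_)
        have := hr 0 (by omega)
        omega
    have hs0 : s 0 = 0 := eq_zero_of_sq_mul_squarefree hf hd hc _ (s 0) (r 0) le_rfl
      (sub_eq_zero.1 hz)
    have hr0 : r 0 = 0 := by
      rw [hs0] at hz
      simpa [hc] using hz
    rw [hs0, hr0, zero_add, zero_add, mul_pow, mul_pow, mul_assoc, mul_assoc] at h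
    have h' := mul_left_cancel₀ (pow_ne_zero _ (pow_ne_zero _ X_ne_zero)) h
    have hi := ih (fun j => s (j + 1)) (fun j => r (j + 1)) (fun j hj => hs _ (by omega))
      (fun j hj => hr _ (by omega)) h'
    intro j hj
    cases j with
    | zero => exact ⟨hs0, hr0⟩
    | succ j => exact hi j (by omega)

open Polynomial in
set_option maxHeartbeats 800000 in
/-- Stepanov's bound: a squarefree polynomial `f` of degree `2m` with `f(0) ≠ 0` over a field with
`Q²` elements takes at most `Q²/2 + (3m+1)Q` times a non-square value. -/
theorem card_nonsquare_values_le {K : Type*} [Field K] [Fintype K] [DecidableEq K] {p a : ℕ}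
    [CharP K p] [Fact p.Prime] (hp : p ≠ 2) {Q m : ℕ} (hQp : Q = p ^ a)
    (hK : Fintype.card K = Q ^ 2) (hm : 0 < m) (hQm : 4 * m + 6 ≤ Q) {f : K[X]}
    (hf : Squarefree f) (hd : f.natDegree = 2 * m) (h0 : f.eval 0 ≠ 0) :
    2 * (Finset.univ.filter fun y : K => f.eval y ^ ((Q ^ 2 - 1) / 2) = -1).card
      ≤ Q ^ 2 + (6 * m + 2) * Q := by
  have hodd : Odd Q := by
    rw [hQp]
    exact ((Fact.out : p.Prime).odd_of_ne_two hp).pow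
  obtain ⟨q, hq⟩ := hodd
  -- Parameters: 2JL unknowns must exceed the N coefficients of the polynomial `E c`, while the
  -- final degree, about JQ + deg g, should stay near Q²/2.
  set J := q + 1 + 2 * m with hJ
  set L := q - m with hL
  have hLq : L + m = q := by omega
  set g := f ^ q with hg
  set N := L * Q + J + m * Q with hN
  -- the linear system
  let E : (Fin J × Fin L → K) × (Fin J × Fin L → K) →ₗ[K] K[X] :=
    { toFun := fun c => ∑ i, (C (c.1 i) * (X ^ (i.2 * Q + i.1 : ℕ) * g)
        - C (c.2 i) * X ^ (i.2 * Q + i.1 : ℕ))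
      map_add' := by
        intro c d
        rw [← Finset.sum_add_distrib]
        refine Finset.sum_congr rfl fun i _ => ?_
        simp only [Prod.fst_add, Prod.snd_add, Pi.add_apply, C_add]
        ring
      map_smul' := by
        intro c d
        simp only [RingHom.id_apply, Finset.smul_sum]
        refine Finset.sum_congr rfl fun i _ => ?_
        simp only [Prod.smul_fst, Prod.smul_snd, Pi.smul_apply, smul_eq_mul, C_mul, smul_eq_C_mul]
        ring }
  have hgdeg : g.natDegree ≤ 2 * m * q := by
    rw [hg]
    refine natDegree_pow_le.trans ?_
    rw [hd, mul_comm]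
  have hEdeg : ∀ c, E c ∈ degreeLT K N := by
    intro c
    refine Submodule.sum_mem _ fun i _ => ?_
    have hi1 := i.1.2
    have hi2 : (i.2 * Q + Q : ℕ) ≤ L * Q := by
      have := Nat.mul_le_mul_right Q (Nat.succ_le_of_lt i.2.2)
      rwa [Nat.succ_mul] at this
    have hmq : 2 * m * q + m = m * Q := by rw [hq]; ring
    refine Submodule.sub_mem _ ?_ ?_
    · rw [mem_degreeLT]
      refine (degree_le_natDegree).trans_lt ?_
      rw [Nat.cast_lt]
      refine (natDegree_C_mul_le _ _).trans_lt (natDegree_mul_le.trans_lt ?_)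
      rw [natDegree_X_pow]
      omega
    · rw [mem_degreeLT]
      refine (degree_le_natDegree).trans_lt ?_
      rw [Nat.cast_lt]
      refine (natDegree_C_mul_le _ _).trans_lt ?_
      rw [natDegree_X_pow]
      omega
  obtain ⟨c, hcE, hc0⟩ : ∃ c, E c = 0 ∧ c ≠ 0 := by
    have hlt : Module.finrank K (degreeLT K N)
        < Module.finrank K ((Fin J × Fin L → K) × (Fin J × Fin L → K)) := by
      rw [(degreeLTEquiv K N).finrank_eq]
      simp only [Module.finrank_fintype_fun_eq_card, Module.finrank_prod, Fintype.card_fin,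
        Fintype.card_prod]
      rw [hN, hq, hJ, ← hLq]
      have : m + 3 ≤ L := by omega
      nlinarith
    have hb := LinearMap.ker_ne_bot_of_finrank_lt (f := E.codRestrict _ hEdeg) hlt
    obtain ⟨c, hc, hc0⟩ := (Submodule.ne_bot_iff _).1 hb
    refine ⟨c, ?_, hc0⟩
    rw [LinearMap.mem_ker] at hc
    simpa using congrArg Subtype.val hc
  -- the auxiliary polynomial
  let s : (Fin J × Fin L → K) → ℕ → K[X] := fun d j =>
    ∑ i : Fin L, C ((if hj : j < J then d (⟨j, hj⟩, i) else 0) ^ Q) * X ^ (i : ℕ)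
  have hsdeg : ∀ d j, (s d j).natDegree ≤ L - 1 := by
    intro d j
    refine natDegree_sum_le_of_forall_le _ _ fun i _ => ?_
    refine (natDegree_C_mul_le _ _).trans ?_
    rw [natDegree_X_pow]
    have := i.2
    omega
  have hs0 : ∀ d, (∀ j < J, s d j = 0) → d = 0 := by
    intro d hd
    funext ⟨j, i⟩
    have h1 := congrArg (fun P => P.coeff (i : ℕ)) (hd j j.2)
    have hQ0 : Q ≠ 0 := by omega
    simp only [s, finsetSum_coeff, coeff_C_mul, coeff_X_pow, Fin.val_inj, coeff_zero] at h1
    simpa [hQ0] using h1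
  set h : K[X] := ∑ j ∈ Finset.range J, (s c.1 j + s c.2 j * g) * X ^ (j * Q) with hh
  have hh0 : h ≠ 0 := by
    intro hzero
    have hsum : ∑ j ∈ Finset.range J, s c.1 j * X ^ (j * Q)
        = -((∑ j ∈ Finset.range J, s c.2 j * X ^ (j * Q)) * g) := by
      rw [eq_neg_iff_add_eq_zero, ← hzero, hh, Finset.sum_mul, ← Finset.sum_add_distrib]
      refine Finset.sum_congr rfl fun j _ => ?_
      ring
    -- Since Q = 2q + 1, g plays the role of √(f^Q / f), and squaring a linear relation between 1
    -- and g removes it.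
    have hgf : g ^ 2 * f = f ^ Q := by
      rw [hg, hq]; ring
    have := coeffs_eq_zero_of_sq_mul_eq hf (by omega) h0 hQp (L := L - 1) (by omega) J (s c.1)
      (s c.2) (fun j _ => hsdeg _ j) (fun j _ => hsdeg _ j) (by rw [hsum, ← hgf]; ring)
    exact hc0 (Prod.ext (hs0 _ fun j hj => (this j hj).1) (hs0 _ fun j hj => (this j hj).2))
  have hhdeg : h.natDegree ≤ q * Q + (3 * m + 1) * Q := by
    refine natDegree_sum_le_of_forall_le _ _ fun j hj => ?_
    have hj' : j * Q ≤ (q + 2 * m) * Q :=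
      Nat.mul_le_mul_right _ (by have := Finset.mem_range.1 hj; omega)
    have hmq : 2 * m * q + m = m * Q := by rw [hq]; ring
    have h1 : (s c.1 j + s c.2 j * g).natDegree ≤ L - 1 + 2 * m * q := by
      refine natDegree_add_le_of_degree_le ((hsdeg _ _).trans (by omega)) ?_
      exact natDegree_mul_le.trans (Nat.add_le_add (hsdeg _ _) hgdeg)
    have h2 : ((s c.1 j + s c.2 j * g) * X ^ (j * Q)).natDegree ≤ L - 1 + 2 * m * q + j * Q := by
      refine natDegree_mul_le.trans ?_
      rw [natDegree_X_pow]
      omega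
    have e1 : (q + 2 * m) * Q = q * Q + 2 * (m * Q) := by ring
    have e2 : (3 * m + 1) * Q = 3 * (m * Q) + Q := by ring
    omega
  have hroot : ∀ y : K, f.eval y ^ ((Q ^ 2 - 1) / 2) = -1 → h.IsRoot y := by
    intro y hy
    have hqq : (Q ^ 2 - 1) / 2 = q * (Q + 1) := by
      rw [hq]
      have : (2 * q + 1) ^ 2 - 1 = 2 * (q * (2 * q + 1 + 1)) := by
        rw [Nat.sub_eq_iff_eq_add (by nlinarith)]; ring
      rw [this]; simp
    have hgQ : g.eval y ^ Q * g.eval y = -1 := by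
      rw [← pow_succ, hg, eval_pow, ← pow_mul, ← hqq, hy]
    have hpowQ : ∀ z : K, (z ^ Q) ^ Q = z := by
      intro z
      rw [← pow_mul, ← sq, ← hK, FiniteField.pow_card]
    -- The coefficients of `s` were entered as Q-th powers: a further Q-th power restores them
    -- because z^{Q²} = z. Hence vanishing of h^Q g at y becomes the linear condition encoded in
    -- `E`.
    have hsev : ∀ (d) (j : Fin J), (s d j).eval y ^ Q = ∑ i : Fin L, d (j, i) * y ^ (i * Q : ℕ) := by
      intro d j
      simp only [s, eval_finsetSum]
      rw [hQp, sum_pow_char_pow, ← hQp]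
      refine Finset.sum_congr rfl fun i _ => ?_
      rw [eval_mul, eval_C, eval_pow, eval_X, mul_pow, hpowQ, ← pow_mul]
      simp
    have hE := congrArg (eval y) hcE
    -- At such y one has g^{Q+1} = -1, so h^Q g takes the value of `E c`, which is zero. Simple
    -- zeros suffice: no derivatives are taken.
    have hev : h.eval y ^ Q * g.eval y = 0 := by
      rw [eval_zero] at hE
      rw [← hE]
      simp only [hh, eval_finsetSum, E, LinearMap.coe_mk, AddHom.coe_mk]
      rw [hQp, sum_pow_char_pow, ← hQp, Finset.sum_range, Fintype.sum_prod_type, Finset.sum_mul]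
      refine Finset.sum_congr rfl fun j _ => ?_
      rw [eval_mul, eval_add, eval_mul, mul_pow, eval_pow (p := X), eval_X, pow_mul,
        hpowQ, hQp, add_pow_char_pow, ← hQp, mul_pow, hsev, hsev]
      simp only [eval_sub, eval_mul, eval_C, eval_pow, eval_X, pow_add, Finset.sum_sub_distrib]
      have e1 : ∑ i : Fin L, c.1 (j, i) * (y ^ (i * Q : ℕ) * y ^ (j : ℕ) * eval y g)
          = (∑ i : Fin L, c.1 (j, i) * y ^ (i * Q : ℕ)) * (y ^ (j : ℕ) * eval y g) := by
        rw [Finset.sum_mul]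
        exact Finset.sum_congr rfl fun i _ => by ring
      have e2 : ∑ i : Fin L, c.2 (j, i) * (y ^ (i * Q : ℕ) * y ^ (j : ℕ))
          = (∑ i : Fin L, c.2 (j, i) * y ^ (i * Q : ℕ)) * y ^ (j : ℕ) := by
        rw [Finset.sum_mul]
        exact Finset.sum_congr rfl fun i _ => by ring
      rw [e1, e2]
      linear_combination (∑ i : Fin L, c.2 (j, i) * y ^ (i * Q : ℕ)) * y ^ (j : ℕ) * hgQ
    have hgne : g.eval y ≠ 0 := by
      intro h0
      rw [h0, mul_zero] at hgQ
      exact one_ne_zero (neg_eq_zero.1 hgQ.symm)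
    rcases mul_eq_zero.1 hev with h1 | h1
    · exact pow_eq_zero_iff (by omega) |>.1 h1
    · exact absurd h1 hgne
  have hcard : (Finset.univ.filter fun y : K => f.eval y ^ ((Q ^ 2 - 1) / 2) = -1).card
      ≤ h.natDegree := by
    refine card_le_degree_of_subset_roots fun y hy => ?_
    rw [mem_roots hh0]
    exact hroot y (by simpa using hy)
  have e1 : Q ^ 2 = 2 * (q * Q) + Q := by rw [hq]; ring
  have e2 : (3 * m + 1) * Q = 3 * (m * Q) + Q := by ring
  have e3 : (6 * m + 2) * Q = 6 * (m * Q) + 2 * Q := by ring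
  omega

end

section

/-! ### Kloosterman sums over finite fields -/

section Kloosterman

variable {K : Type*} [Field K] [Fintype K] [DecidableEq K]

/-- The Kloosterman sum `∑_{x ≠ 0} ψ(x + n/x)`. -/
def kloosterman (ψ : AddChar K ℂ) (n : K) : ℂ :=
  ∑ x : K, if x = 0 then 0 else ψ (x + n * x⁻¹)

theorem sum_comp_sq (hK : ringChar K ≠ 2) (h : K → ℂ) :
    ∑ v : K, h (v ^ 2) = ∑ w : K, ((quadraticChar K w : ℂ) + 1) * h w := by
  rw [← Finset.sum_fiberwise Finset.univ (fun v : K => v ^ 2) (fun v => h (v ^ 2))]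
  refine Finset.sum_congr rfl fun w _ => ?_
  have h1 := quadraticChar_card_sqrts hK w
  have h2 : ((quadraticChar K w : ℂ) + 1)
      = ((Finset.univ.filter fun v : K => v ^ 2 = w).card : ℂ) := by
    have : Set.toFinset {x : K | x ^ 2 = w} = Finset.univ.filter fun v : K => v ^ 2 = w := by
      ext; simp
    rw [this] at h1
    exact_mod_cast h1.symm
  rw [h2, ← nsmul_eq_mul, ← Finset.sum_const]
  refine Finset.sum_congr rfl fun v hv => ?_
  rw [(Finset.mem_filter.1 hv).2]

/-- Parametrise the conic z² = a² - 4n by a = x + n/x, z = x - n/x; the factor χ + 1 counts the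
square roots z. -/
theorem kloosterman_eq_sum_quadraticChar (hK : ringChar K ≠ 2) (ψ : AddChar K ℂ) {n : K}
    (hn : n ≠ 0) :
    kloosterman ψ n = ∑ a : K, ((quadraticChar K (a ^ 2 - 4 * n) : ℂ) + 1) * ψ a := by
  have h2 := Ring.two_ne_zero hK
  have e1 : ∀ a : K, ((quadraticChar K (a ^ 2 - 4 * n) : ℂ) + 1) * ψ a
      = ∑ z : K, if z ^ 2 = a ^ 2 - 4 * n then ψ a else 0 := by
    intro a
    rw [sum_comp_sq hK (fun w => if w = a ^ 2 - 4 * n then ψ a else 0)]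
    simp
  rw [kloosterman, Finset.sum_congr rfl fun a _ => e1 a, ← Fintype.sum_prod_type',
    ← Finset.sum_filter, Finset.sum_ite, Finset.sum_const_zero, zero_add]
  refine Finset.sum_bij' (fun x _ => (x + n * x⁻¹, x - n * x⁻¹)) (fun y _ => (y.1 + y.2) / 2)
    ?_ ?_ ?_ ?_ ?_
  · intro x hx
    have hx : x ≠ 0 := by simpa using hx
    simp only [Finset.mem_filter, Finset.mem_univ, true_and]
    field_simp
    ring
  · intro y hy
    have hy : y.2 ^ 2 = y.1 ^ 2 - 4 * n := by simpa using hy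
    simp only [Finset.mem_filter, Finset.mem_univ, true_and]
    intro h0
    have h0 : y.1 + y.2 = 0 := by simpa [h2] using h0
    have : 2 * 2 * n = 0 := by linear_combination hy + (y.1 - y.2) * h0
    simp [h2, hn] at this
  · intro x hx
    have hx : x ≠ 0 := by simpa using hx
    field_simp
    ring
  · intro y hy
    have hy : y.2 ^ 2 = y.1 ^ 2 - 4 * n := by simpa using hy
    have h0 : y.1 + y.2 ≠ 0 := by
      intro h0
      have : 2 * 2 * n = 0 := by linear_combination hy + (y.1 - y.2) * h0
      simp [h2, hn] at this
    ext
    · simp only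
      field_simp
      linear_combination hy
    · simp only
      field_simp
      linear_combination -hy
  · intro x hx
    rfl

/-- The map `(u, M) ↦ ψ(2u(1 + n/M))`, extended by zero to `M = 0`. -/
def kloostermanKernel (ψ : AddChar K ℂ) (n u M : K) : ℂ :=
  if M = 0 then 0 else ψ (2 * u * (1 + n * M⁻¹))

/-- With u, v the half sum and half difference of the two variables, their product is u² - v² and
the total phase is 2u(1 + n/(u² - v²)). This has the form of a Kloosterman sum over a quadratic
algebra with norm u² - v². -/
theorem kloosterman_sq (hK : ringChar K ≠ 2) (ψ : AddChar K ℂ) (n : K) :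
    kloosterman ψ n ^ 2 = ∑ u : K, ∑ v : K, kloostermanKernel ψ n u (u ^ 2 - v ^ 2) := by
  have h2 := Ring.two_ne_zero hK
  rw [sq, kloosterman, Finset.sum_mul_sum, ← Fintype.sum_prod_type', ← Fintype.sum_prod_type']
  let φ : K × K ≃ K × K :=
    { toFun := fun x => ((x.1 + x.2) / 2, (x.1 - x.2) / 2)
      invFun := fun x => (x.1 + x.2, x.1 - x.2)
      left_inv := by intro x; ext <;> simp only <;> field_simp <;> ring
      right_inv := by intro x; ext <;> simp only <;> field_simp <;> ring }
  refine Fintype.sum_equiv φ _ _ fun x => ?_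
  have e : ((x.1 + x.2) / 2) ^ 2 - ((x.1 - x.2) / 2) ^ 2 = x.1 * x.2 := by field_simp; ring
  simp only [kloostermanKernel, φ, Equiv.coe_fn_mk, e]
  by_cases h1 : x.1 = 0
  · simp [h1]
  by_cases h3 : x.2 = 0
  · simp [h3]
  simp only [h1, h3, mul_eq_zero, or_self, if_false]
  rw [← AddChar.map_add_eq_mul]
  congr 1
  field_simp
  ring

/-- Summing over u first kills every nonzero M except M = -n, where the phase vanishes identically.
-/
theorem sum_kloostermanKernel (hK : ringChar K ≠ 2) {ψ : AddChar K ℂ} (hψ : ψ ≠ 0) {n : K}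
    (hn : n ≠ 0) : ∑ u : K, ∑ M : K, kloostermanKernel ψ n u M = Fintype.card K := by
  have h2 := Ring.two_ne_zero hK
  rw [Finset.sum_comm, Finset.sum_eq_single (-n)]
  · simp [kloostermanKernel, hn]
  · intro M _ hM
    by_cases hM0 : M = 0
    · simp [kloostermanKernel, hM0]
    · simp only [kloostermanKernel, hM0, if_false]
      have hc : 2 * (1 + n * M⁻¹) ≠ 0 := by
        refine mul_ne_zero h2 fun h => hM ?_
        field_simp at h
        linear_combination h
      have := Fintype.sum_equiv (Equiv.mulRight₀ _ hc)
        (fun u : K => ψ (2 * u * (1 + n * M⁻¹))) (fun u => ψ u) (fun u => by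
          congr 1; simp; ring)
      rw [this]
      exact AddChar.sum_eq_zero_iff_ne_zero.2 hψ
  · simp

/-- The split norm u² - v² and the nonsplit norm u² - d v² are complementary: as v varies, the
squares weight w by 1 + χ(w) and the multiples of d by 1 - χ(w). Adding the two sums removes χ and
leaves twice the complete sum of the kernel. The left side is the Kloosterman sum over the quadratic
extension. -/
theorem kloosterman_quadratic_extension (hK : ringChar K ≠ 2) {ψ : AddChar K ℂ} (hψ : ψ ≠ 0)
    {n d : K} (hn : n ≠ 0) (hd : ¬ IsSquare d) :
    (∑ u : K, ∑ v : K, kloostermanKernel ψ n u (u ^ 2 - d * v ^ 2))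
      = 2 * Fintype.card K - kloosterman ψ n ^ 2 := by
  have hd0 : d ≠ 0 := by rintro rfl; exact hd (by simp)
  have hχd : quadraticChar K d = -1 := quadraticChar_neg_one_iff_not_isSquare.2 hd
  rw [kloosterman_sq hK, eq_sub_iff_add_eq, ← Finset.sum_add_distrib,
    ← sum_kloostermanKernel hK hψ hn, Finset.mul_sum]
  refine Finset.sum_congr rfl fun u _ => ?_
  rw [sum_comp_sq hK (fun w => kloostermanKernel ψ n u (u ^ 2 - d * w)),
    sum_comp_sq hK (fun w => kloostermanKernel ψ n u (u ^ 2 - w))]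
  have e1 : ∑ w : K, ((quadraticChar K w : ℂ) + 1) * kloostermanKernel ψ n u (u ^ 2 - d * w)
      = ∑ w : K, (-(quadraticChar K w : ℂ) + 1) * kloostermanKernel ψ n u (u ^ 2 - w) := by
    refine Fintype.sum_equiv (Equiv.mulLeft₀ d hd0) _ _ fun w => ?_
    simp only [Equiv.mulLeft₀_apply, map_mul, hχd]
    push_cast
    ring
  rw [e1, ← Finset.sum_add_distrib, Finset.mul_sum]
  refine (Finset.sum_congr rfl fun w _ => ?_).trans
    (Fintype.sum_equiv (Equiv.subLeft (u ^ 2)) (fun w => 2 * kloostermanKernel ψ n u (u ^ 2 - w))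
      _ fun w => rfl)
  ring

end Kloosterman

/-- The fields `𝔽_{p^{2^j}}`, with a Frobenius-invariant trace to `𝔽_p`, and the recursion
satisfied by normalised Kloosterman sums along this tower. -/
theorem exists_quadratic_tower {p : ℕ} [Fact p.Prime] (hp : p ≠ 2) {n : ℤ}
    (hn : (n : ZMod p) ≠ 0) (j : ℕ) :
    ∃ (K : Type) (_ : Field K) (_ : Fintype K) (_ : DecidableEq K) (_ : CharP K p)
      (τ : K →+ ZMod p), Fintype.card K = p ^ 2 ^ j ∧ Function.Surjective τ ∧
      (∀ x, τ (x ^ p) = τ x) ∧ ∀ ψ : AddChar (ZMod p) ℂ, ψ ≠ 0 →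
        kloosterman (ψ.compAddMonoidHom τ) (n : K)
          = -((Real.sqrt p : ℂ) ^ 2 ^ j *
              (fun s : ℂ => s ^ 2 - 2)^[j] (-kloosterman ψ (n : ZMod p) / Real.sqrt p)) := by
  have hp0 : (Real.sqrt p : ℂ) ≠ 0 := by
    have := (Fact.out : p.Prime).pos
    simp; omega
  have hsq : (Real.sqrt p : ℂ) ^ 2 = p := by
    rw [← Complex.ofReal_pow, Real.sq_sqrt (Nat.cast_nonneg _)]; simp
  induction j with
  | zero =>
    refine ⟨ZMod p, inferInstance, inferInstance, inferInstance, inferInstance, AddMonoidHom.id _,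
      by simp, fun x => ⟨x, rfl⟩, fun x => by simp, fun ψ hψ => ?_⟩
    have : ψ.compAddMonoidHom (AddMonoidHom.id _) = ψ := by ext; simp
    rw [this]
    simp only [pow_zero, pow_one, Function.iterate_zero, id]
    field_simp
  | succ j ih =>
    obtain ⟨K, _, _, _, hchar, τ, hcard, hτ, hfrob, hrec⟩ := ih
    have hK : ringChar K ≠ 2 := by rwa [ringChar.eq K p]
    obtain ⟨d, hd⟩ := FiniteField.exists_nonsquare hK
    -- This instance makes `QuadraticAlgebra K d 0` a field.
    have : Fact (∀ r : K, r ^ 2 ≠ d + 0 * r) := ⟨fun r h => hd ⟨r, by rw [← sq, h]; ring⟩⟩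
    let e : QuadraticAlgebra K d 0 ≃ K × K := QuadraticAlgebra.equivProd d 0
    let _ : Fintype (QuadraticAlgebra K d 0) := Fintype.ofEquiv _ e.symm
    have : CharP (QuadraticAlgebra K d 0) p :=
      charP_of_injective_algebraMap (algebraMap K (QuadraticAlgebra K d 0)).injective p
    refine ⟨QuadraticAlgebra K d 0, inferInstance, inferInstance, inferInstance, inferInstance,
      τ.comp (QuadraticAlgebra.trace : QuadraticAlgebra K d 0 →ₗ[K] K).toAddMonoidHom, ?_, ?_, ?_,
      ?_⟩
    · rw [Fintype.card_congr e, Fintype.card_prod, hcard]; ring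
    · intro y
      obtain ⟨x, rfl⟩ := hτ y
      refine ⟨⟨x / 2, 0⟩, ?_⟩
      have h2 := Ring.two_ne_zero hK
      simp [QuadraticAlgebra.trace_def, mul_div_cancel₀ _ h2]
    · intro x
      -- The trace is x + star x, and `star` commutes with Frobenius.
      have : QuadraticAlgebra.trace (x ^ p) = (QuadraticAlgebra.trace x) ^ p := by
        apply (algebraMap K (QuadraticAlgebra K d 0)).injective
        rw [map_pow (algebraMap K (QuadraticAlgebra K d 0)),
          QuadraticAlgebra.algebraMap_trace_eq_add_star,
          QuadraticAlgebra.algebraMap_trace_eq_add_star, add_pow_char, star_pow]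
      simp [this, hfrob]
    · intro ψ hψ
      have hψτ : ψ.compAddMonoidHom τ ≠ 0 := by
        intro h
        refine hψ (DFunLike.ext _ _ fun x => ?_)
        obtain ⟨y, rfl⟩ := hτ x
        exact DFunLike.congr_fun h y
      have hnK : (n : K) ≠ 0 := by
        intro h
        exact hn ((CharP.intCast_eq_zero_iff (ZMod p) p n).2
          ((CharP.intCast_eq_zero_iff K p n).1 h))
      rw [Function.iterate_succ_apply']
      have key := kloosterman_quadratic_extension hK hψτ hnK hd
      rw [hrec ψ hψ] at key
      have hL : kloosterman (ψ.compAddMonoidHom (τ.comp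
          (QuadraticAlgebra.trace : QuadraticAlgebra K d 0 →ₗ[K] K).toAddMonoidHom))
          (n : QuadraticAlgebra K d 0) = ∑ u : K, ∑ v : K,
            kloostermanKernel (ψ.compAddMonoidHom τ) (n : K) u (u ^ 2 - d * v ^ 2) := by
        rw [← Fintype.sum_prod_type', kloosterman]
        refine Fintype.sum_equiv e _ _ fun x => ?_
        have hx : x.re ^ 2 - d * x.im ^ 2 = QuadraticAlgebra.norm x := by
          rw [QuadraticAlgebra.norm_def]; ring
        have hx' : (e x).1 ^ 2 - d * (e x).2 ^ 2 = QuadraticAlgebra.norm x := hx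
        rw [kloostermanKernel, hx']
        simp only [QuadraticAlgebra.norm_eq_zero_iff_eq_zero]
        split_ifs with h0
        · rfl
        · simp only [AddChar.coe_compAddMonoidHom, Function.comp_apply, AddMonoidHom.coe_comp]
          congr 2
          change QuadraticAlgebra.trace (x + (n : QuadraticAlgebra K d 0) * x⁻¹) = 2 * x.re * (1 + n * (QuadraticAlgebra.norm x)⁻¹)
          simp [QuadraticAlgebra.trace_def, QuadraticAlgebra.inv_def]
          ring
      rw [hL, key, hcard]
      have : ((Real.sqrt p : ℂ)) ^ 2 ^ (j + 1) = (p : ℂ) ^ 2 ^ j := by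
        rw [pow_succ, mul_comm, pow_mul, hsq]
      rw [this]
      push_cast
      have h3 : ((Real.sqrt p : ℂ) ^ 2 ^ j) ^ 2 = (p : ℂ) ^ 2 ^ j := by
        rw [← pow_mul, mul_comm, pow_mul, hsq]
      linear_combination -((fun s : ℂ => s ^ 2 - 2)^[j]
        (-kloosterman ψ (n : ZMod p) / Real.sqrt p)) ^ 2 * h3

end

section

/-! ### The Weil bound -/

/-- A count replaces the additive Hilbert 90. The kernel of y ↦ y^p - y has at most p elements and
its image lies in ker τ, which has index p; comparing both factorisations of |K| forces equality. -/
theorem card_fiber_artinSchreier {p : ℕ} [Fact p.Prime] {K : Type*} [Field K] [Fintype K]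
    [DecidableEq K] [CharP K p] {τ : K →+ ZMod p} (hτ : Function.Surjective τ)
    (hfrob : ∀ x, τ (x ^ p) = τ x) (a : K) :
    (Finset.univ.filter fun y : K => y ^ p - y = a).card = if τ a = 0 then p else 0 := by
  let φ : K →+ K :=
    { toFun := fun y => y ^ p - y
      map_zero' := by simp [(Fact.out : p.Prime).ne_zero]
      map_add' := by intro x y; rw [add_pow_char]; ring }
  have hφ : ∀ y, φ y = y ^ p - y := fun _ => rfl
  have hp := (Fact.out : p.Prime)
  set k := (Finset.univ.filter fun y : K => φ y = 0).card with hk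
  have hkp : k ≤ p := by
    open Polynomial in
    have h1 : ((X : K[X]) ^ p - X) ≠ 0 := FiniteField.X_pow_card_sub_X_ne_zero K hp.one_lt
    have h2 := card_le_degree_of_subset_roots (p := (X : K[X]) ^ p - X)
      (Z := Finset.univ.filter fun y : K => φ y = 0) (by
        intro y hy
        have hy : φ y = 0 := by simpa using hy
        rw [mem_roots h1]
        simpa [hφ] using hy)
    rwa [FiniteField.X_pow_card_sub_X_natDegree_eq K hp.one_lt] at h2
  set R := Finset.univ.image φ with hR
  set T := Finset.univ.filter fun a : K => τ a = 0 with hT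
  have hfib : ∀ b ∈ R, (Finset.univ.filter fun y : K => φ y = b).card = k := by
    intro b hb
    obtain ⟨y, -, hy⟩ := Finset.mem_image.1 hb
    exact AddMonoidHom.card_fiber_eq_of_mem_range φ ⟨y, hy⟩ ⟨0, map_zero φ⟩
  have hsub : R ⊆ T := by
    intro b hb
    obtain ⟨y, -, rfl⟩ := Finset.mem_image.1 hb
    simp [hT, hφ, hfrob]
  have hq1 : Fintype.card K = R.card * k := by
    rw [← Finset.card_univ, Finset.card_eq_sum_card_image φ, Finset.sum_congr rfl hfib,
      Finset.sum_const, smul_eq_mul]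
  have hq2 : Fintype.card K = p * T.card := by
    rw [← Finset.card_univ, Finset.card_eq_sum_card_fiberwise (f := τ) (t := Finset.univ)
      (fun _ _ => by simp), Finset.sum_congr rfl fun b _ =>
        AddMonoidHom.card_fiber_eq_of_mem_range τ (hτ b) (hτ 0), Finset.sum_const]
    simp [ZMod.card, hT]
  have hqpos : 0 < Fintype.card K := Fintype.card_pos
  have hle := Finset.card_le_card hsub
  have hTpos : 0 < T.card := Nat.pos_of_ne_zero fun h => by rw [h] at hq2; omega
  have hTR : T.card ≤ R.card := by
    by_contra! hlt
    have : R.card * k < p * T.card := by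
      calc R.card * k ≤ R.card * p := Nat.mul_le_mul_left _ hkp
        _ < T.card * p := Nat.mul_lt_mul_of_pos_right hlt hp.pos
        _ = p * T.card := mul_comm _ _
    omega
  have hRT : R = T := Finset.eq_of_subset_of_card_le hsub hTR
  have hkeq : k = p := by
    rw [hq2, hRT, mul_comm] at hq1
    exact (Nat.eq_of_mul_eq_mul_left hTpos hq1).symm
  by_cases ha : τ a = 0
  · rw [if_pos ha]
    exact (hfib a (by rw [hRT]; simpa [hT] using ha)).trans hkeq
  · rw [if_neg ha, Finset.card_eq_zero, Finset.filter_eq_empty_iff]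
    intro y _ hy
    apply ha
    have : φ y ∈ T := hsub (Finset.mem_image_of_mem φ (Finset.mem_univ y))
    rw [← hy]
    exact (Finset.mem_filter.1 this).2

/-- The fibres of y ↦ y^p - y have size p on ker τ, which is detected by summing all characters ψ(τ
a). Each nontrivial ψ gives a Kloosterman sum and the trivial one gives -1. -/
theorem sum_quadraticChar_artinSchreier {p : ℕ} [Fact p.Prime] (hp : p ≠ 2) {K : Type*} [Field K]
    [Fintype K] [DecidableEq K] [CharP K p] {τ : K →+ ZMod p} (hτ : Function.Surjective τ)
    (hfrob : ∀ x, τ (x ^ p) = τ x) {n : K} (hn : n ≠ 0) :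
    ((∑ y : K, quadraticChar K ((y ^ p - y) ^ 2 - 4 * n) : ℤ) : ℂ)
      = -1 + ∑ ψ ∈ Finset.univ.erase (0 : AddChar (ZMod p) ℂ),
          kloosterman (ψ.compAddMonoidHom τ) n := by
  have hK : ringChar K ≠ 2 := by rwa [ringChar.eq K p]
  have h1 : ((∑ y : K, quadraticChar K ((y ^ p - y) ^ 2 - 4 * n) : ℤ) : ℂ)
      = ∑ ψ : AddChar (ZMod p) ℂ, ∑ a : K, (quadraticChar K (a ^ 2 - 4 * n) : ℂ) * ψ (τ a) := by
    rw [Finset.sum_comm]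
    push_cast
    rw [← Finset.sum_fiberwise Finset.univ (fun y : K => y ^ p - y)]
    refine Finset.sum_congr rfl fun a _ => ?_
    rw [← Finset.mul_sum, AddChar.sum_apply_eq_ite, Finset.sum_congr rfl (g := fun _ =>
      ((quadraticChar K (a ^ 2 - 4 * n) : ℤ) : ℂ))
      (fun y hy => by rw [(Finset.mem_filter.1 hy).2]), Finset.sum_const,
      card_fiber_artinSchreier hτ hfrob]
    split_ifs <;> simp [ZMod.card, mul_comm]
  have h2 : ∀ ψ : AddChar (ZMod p) ℂ,
      ∑ a : K, (quadraticChar K (a ^ 2 - 4 * n) : ℂ) * ψ (τ a)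
        = kloosterman (ψ.compAddMonoidHom τ) n - ∑ a : K, ψ.compAddMonoidHom τ a := by
    intro ψ
    rw [kloosterman_eq_sum_quadraticChar hK _ hn, ← Finset.sum_sub_distrib]
    refine Finset.sum_congr rfl fun a _ => ?_
    simp only [AddChar.coe_compAddMonoidHom, Function.comp_apply]
    ring
  rw [h1, ← Finset.add_sum_erase _ _ (Finset.mem_univ (0 : AddChar (ZMod p) ℂ))]
  congr 1
  · rw [h2, kloosterman, ← Finset.sum_sub_distrib, Finset.sum_eq_single 0]
    · simp
    · intro x _ hx
      simp [hx]
    · simp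
  · refine Finset.sum_congr rfl fun ψ hψ => ?_
    have hψ0 : ψ ≠ 0 := (Finset.mem_erase.1 hψ).1
    have hψτ : ψ.compAddMonoidHom τ ≠ 0 := by
      intro h
      refine hψ0 (DFunLike.ext _ _ fun x => ?_)
      obtain ⟨y, rfl⟩ := hτ x
      exact DFunLike.congr_fun h y
    rw [h2, AddChar.sum_eq_zero_iff_ne_zero.2 hψτ, sub_zero]

open Polynomial in
-- Stepanov's bound with m = p. The polynomial (X^p - X)² - 4n is separable because X^p - X has
-- derivative -1, so its own derivative is -2(X^p - X), coprime to it.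
theorem le_sum_quadraticChar_artinSchreier {p : ℕ} [Fact p.Prime] (hp : p ≠ 2) {K : Type*} [Field K]
    [Fintype K] [DecidableEq K] [CharP K p] {n : K} (hn : n ≠ 0) {Q b : ℕ} (hQp : Q = p ^ b)
    (hK : Fintype.card K = Q ^ 2) (hQ : 4 * p + 6 ≤ Q) :
    -((6 * p + 3) * Q : ℤ) ≤ ∑ y : K, quadraticChar K ((y ^ p - y) ^ 2 - 4 * n) := by
  have hchar : ringChar K ≠ 2 := by rwa [ringChar.eq K p]
  have hp1 := (Fact.out : p.Prime).one_lt
  have h2 := Ring.two_ne_zero hchar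
  set D : K[X] := X ^ p - X with hD
  have hDdeg : D.natDegree = p := FiniteField.X_pow_card_sub_X_natDegree_eq K hp1
  have hD' : derivative D = -1 := by
    rw [hD, derivative_sub, derivative_X_pow, derivative_X]
    simp
  set f : K[X] := D ^ 2 - C (4 * n) with hf
  have h4n : 4 * n ≠ 0 := by
    have : (4 : K) = 2 * 2 := by norm_num
    rw [this]; exact mul_ne_zero (mul_ne_zero h2 h2) hn
  have hsep : f.Separable := by
    refine ⟨C (-(4 * n)⁻¹), C (-(2 * (4 * n))⁻¹) * D, ?_⟩
    have hfd : derivative f = C (-2) * D := by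
      rw [hf, derivative_sub, derivative_C, derivative_pow, hD']
      simp
    have e1 : C (-(4 * n)⁻¹) * C (4 * n) = (-1 : K[X]) := by
      rw [← C_mul, neg_mul, inv_mul_cancel₀ h4n]; simp
    have e2 : C (-(2 * (4 * n))⁻¹) * C (-2) = C ((4 * n)⁻¹) := by
      rw [← C_mul]; congr 1; field_simp
    rw [hfd, hf]
    have e3 : C (-(4 * n)⁻¹) = -C ((4 * n)⁻¹) := by simp
    linear_combination D ^ 2 * e2 - e1 + D ^ 2 * e3
  have hfdeg : f.natDegree = 2 * p := by
    rw [hf, natDegree_sub_C, natDegree_pow, hDdeg]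
  have hf0 : f.eval 0 ≠ 0 := by
    simp only [hf, hD, eval_sub, eval_pow, eval_X, eval_C]
    simpa [(Fact.out : p.Prime).ne_zero] using ⟨left_ne_zero_of_mul h4n, hn⟩
  have hfev : ∀ y : K, f.eval y = (y ^ p - y) ^ 2 - 4 * n := by
    intro y; simp [hf, hD]
  have key := card_nonsquare_values_le hp hQp hK (by omega) hQ hsep.squarefree hfdeg hf0
  have hQodd : Q % 2 = 1 := by
    rw [hQp]
    exact Nat.odd_iff.1 (((Fact.out : p.Prime).odd_of_ne_two hp).pow)
  have hhalf : Fintype.card K / 2 = (Q ^ 2 - 1) / 2 := by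
    rw [hK]
    have : Q ^ 2 % 2 = 1 := by rw [Nat.pow_mod, hQodd]
    omega
  set Z := Finset.univ.filter fun y : K => f.eval y = 0 with hZ
  have hZcard : Z.card ≤ 2 * p := by
    rw [← hfdeg]
    refine card_le_degree_of_subset_roots fun y hy => ?_
    rw [mem_roots hsep.squarefree.ne_zero]
    simpa [hZ] using hy
  set M := Finset.univ.filter fun y : K => f.eval y ^ ((Q ^ 2 - 1) / 2) = -1 with hM
  -- Only an upper bound on the number of nonsquare values is available, so the character is bounded
  -- from below by 1 minus twice the nonsquare indicator, with a correction at the zeros.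
  have hpt : ∀ y : K, (1 : ℤ) - 2 * (if y ∈ M then 1 else 0) - (if y ∈ Z then 1 else 0)
      ≤ quadraticChar K ((y ^ p - y) ^ 2 - 4 * n) := by
    intro y
    rw [← hfev]
    by_cases h0 : f.eval y = 0
    · have : y ∈ Z := by simpa [hZ] using h0
      rw [if_pos this, h0, quadraticChar_zero]
      split_ifs <;> norm_num
    · have h1 := quadraticChar_eq_pow_of_char_ne_two' hchar (f.eval y)
      rw [hhalf] at h1
      have hpos : (0 : ℤ) ≤ if y ∈ Z then 1 else 0 := by split_ifs <;> norm_num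
      rcases quadraticChar_dichotomy h0 with h | h
      · rw [h]
        have : (0 : ℤ) ≤ if y ∈ M then 1 else 0 := by split_ifs <;> norm_num
        linarith
      · rw [h] at h1 ⊢
        have : y ∈ M := by
          simp only [hM, Finset.mem_filter, Finset.mem_univ, true_and]
          rw [← h1]; simp
        rw [if_pos this]
        linarith
  have hsum := Finset.sum_le_sum fun y (_ : y ∈ (Finset.univ : Finset K)) => hpt y
  have hl : ∑ y : K, ((1 : ℤ) - 2 * (if y ∈ M then 1 else 0) - (if y ∈ Z then 1 else 0))
      = Q ^ 2 - 2 * M.card - Z.card := by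
    rw [Finset.sum_sub_distrib, Finset.sum_sub_distrib, ← Finset.mul_sum]
    simp [hK]
  rw [hl] at hsum
  refine le_trans ?_ hsum
  have key' : (2 * M.card : ℤ) ≤ Q ^ 2 + (6 * p + 2) * Q := by exact_mod_cast key
  have hZ' : (Z.card : ℤ) ≤ 2 * p := by exact_mod_cast hZcard
  have hQ' : (4 * p + 6 : ℤ) ≤ Q := by exact_mod_cast hQ
  linarith

/-- The excess over 2 at least quadruples at each step: (2 + ε)² - 2 = 2 + 4ε + ε². -/
theorem le_iterate_sq_sub_two {s ε : ℝ} (hε : 0 ≤ ε) (hs : 2 + ε ≤ s) (j : ℕ) :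
    2 + 4 ^ j * ε ≤ (fun s : ℝ => s ^ 2 - 2)^[j] s := by
  induction j with
  | zero => simpa using hs
  | succ j ih =>
    rw [Function.iterate_succ_apply']
    have : 0 ≤ 4 ^ j * ε := by positivity
    rw [pow_succ]
    nlinarith

/-- Complex conjugation amounts to x ↦ -x. Reality is what gives the lower bound -2 for every
iterate of s ↦ s² - 2. -/
theorem kloosterman_im {p : ℕ} [Fact p.Prime] (ψ : AddChar (ZMod p) ℂ) (n : ZMod p) :
    (kloosterman ψ n).im = 0 := by
  rw [← Complex.conj_eq_iff_im, kloosterman, map_sum]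
  refine Fintype.sum_equiv (Equiv.neg _) _ _ fun x => ?_
  simp only [Equiv.neg_apply, neg_eq_zero]
  split_ifs
  · exact map_zero _
  · rw [← AddChar.map_neg_eq_conj]
    congr 1
    rw [inv_neg]; ring

/-- The Weil bound for Kloosterman sums modulo an odd prime. -/
theorem norm_kloosterman_le {p : ℕ} [Fact p.Prime] (hp : p ≠ 2) {n : ℤ} (hn : (n : ZMod p) ≠ 0)
    {ψ : AddChar (ZMod p) ℂ} (hψ : ψ ≠ 0) :
    ‖kloosterman ψ (n : ZMod p)‖ ≤ 2 * Real.sqrt p := by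
  have hpp := (Fact.out : p.Prime)
  have hp0 : 0 < Real.sqrt p := Real.sqrt_pos.2 (by exact_mod_cast hpp.pos)
  let s : AddChar (ZMod p) ℂ → ℝ := fun ψ => -(kloosterman ψ (n : ZMod p)).re / Real.sqrt p
  have hk : ∀ ψ : AddChar (ZMod p) ℂ,
      kloosterman ψ (n : ZMod p) = ((kloosterman ψ (n : ZMod p)).re : ℂ) := by
    intro ψ
    apply Complex.ext <;> simp [kloosterman_im]
  have hs : ∀ ψ : AddChar (ZMod p) ℂ, -kloosterman ψ (n : ZMod p) / Real.sqrt p = (s ψ : ℂ) := by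
    intro ψ
    rw [hk ψ]; simp [s]
  by_contra! hlt
  -- One application of the recursion removes the sign of s, after which the iterates only grow.
  have hsψ : 2 < s ψ ^ 2 - 2 := by
    have h1 : 2 < |s ψ| := by
      simp only [s]
      rw [abs_div, abs_neg, abs_of_pos hp0, lt_div_iff₀ hp0]
      rw [hk ψ] at hlt
      simpa using hlt
    have h2 : |s ψ| ^ 2 = s ψ ^ 2 := sq_abs _
    nlinarith
  obtain ⟨ε, hε, hsε⟩ : ∃ ε > 0, 2 + ε ≤ s ψ ^ 2 - 2 := ⟨s ψ ^ 2 - 2 - 2, by linarith, by linarith⟩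
  -- The growth has to beat Stepanov's constant plus 2 for each of the other characters. The four
  -- extra levels j + 4 below ensure 4p + 6 ≤ Q.
  obtain ⟨j, hj⟩ : ∃ j : ℕ, (6 * p + 3) + 2 * Fintype.card (AddChar (ZMod p) ℂ) < 4 ^ j * ε := by
    obtain ⟨j, hj⟩ := pow_unbounded_of_one_lt
      (((6 * p + 3) + 2 * Fintype.card (AddChar (ZMod p) ℂ)) / ε) (by norm_num : (1 : ℝ) < 4)
    exact ⟨j, by rwa [div_lt_iff₀ hε] at hj⟩
  obtain ⟨K, _, _, _, _, τ, hcard, hτ, hfrob, hrec⟩ := exists_quadratic_tower hp hn (j + 4)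
  have hnK : (n : K) ≠ 0 := by
    intro h
    exact hn ((CharP.intCast_eq_zero_iff (ZMod p) p n).2 ((CharP.intCast_eq_zero_iff K p n).1 h))
  have hp3 : 3 ≤ p := by have := hpp.two_le; omega
  have hQ : 4 * p + 6 ≤ p ^ 2 ^ (j + 3) := by
    have h8 : p ^ 2 ≤ p ^ 2 ^ (j + 3) := by
      refine Nat.pow_le_pow_right hpp.pos ?_
      rw [pow_succ]
      have := Nat.one_le_two_pow (n := j + 2)
      omega
    have h9 : p ^ 4 ≤ p ^ 2 ^ (j + 3) := by
      refine Nat.pow_le_pow_right hpp.pos ?_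
      rw [pow_succ, pow_succ]
      have := Nat.one_le_two_pow (n := j + 1)
      omega
    have : 9 * p ≤ p ^ 4 := by
      calc 9 * p ≤ p ^ 3 * p := Nat.mul_le_mul_right _ (by nlinarith [sq_nonneg p])
        _ = p ^ 4 := by ring
    omega
  set Q := p ^ 2 ^ (j + 3) with hQdef
  have hcardQ : Fintype.card K = Q ^ 2 := by
    rw [hcard, hQdef, ← pow_mul]; rfl
  have hlow := le_sum_quadraticChar_artinSchreier hp hnK hQdef hcardQ hQ
  have hsum := sum_quadraticChar_artinSchreier hp hτ hfrob hnK
  have hsqQ : (Real.sqrt p : ℂ) ^ 2 ^ (j + 4) = ((Q : ℝ) : ℂ) := by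
    rw [pow_succ 2 (j + 3), mul_comm, pow_mul, ← Complex.ofReal_pow, Real.sq_sqrt (Nat.cast_nonneg _),
      hQdef]
    push_cast
    rfl
  set t : AddChar (ZMod p) ℂ → ℝ := fun ψ => (fun s : ℝ => s ^ 2 - 2)^[j + 4] (s ψ) with ht
  have hit : ∀ (i : ℕ) (x : ℝ), (fun s : ℂ => s ^ 2 - 2)^[i] (x : ℂ)
      = (((fun s : ℝ => s ^ 2 - 2)^[i] x : ℝ) : ℂ) := by
    intro i x
    induction i with
    | zero => rfl
    | succ i ih => rw [Function.iterate_succ_apply', ih, Function.iterate_succ_apply']; push_cast; rfl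
  have hsum' : ((∑ y : K, quadraticChar K ((y ^ p - y) ^ 2 - 4 * n) : ℤ) : ℝ)
      = -1 + ∑ ψ ∈ Finset.univ.erase (0 : AddChar (ZMod p) ℂ), -(Q * t ψ) := by
    have e : ∀ ψ ∈ Finset.univ.erase (0 : AddChar (ZMod p) ℂ),
        kloosterman (ψ.compAddMonoidHom τ) (n : K) = ((-(Q * t ψ) : ℝ) : ℂ) := by
      intro ψ hψ
      rw [hrec ψ (Finset.mem_erase.1 hψ).1, hs, hit, hsqQ]
      push_cast
      rfl
    rw [Finset.sum_congr rfl e] at hsum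
    apply Complex.ofReal_injective
    push_cast at hsum ⊢
    exact hsum
  -- The remaining characters cannot cancel the large one, since each iterate is a real square minus
  -- 2.
  have htge : ∀ ψ, -2 ≤ t ψ := by
    intro ψ
    simp only [ht]
    rw [Function.iterate_succ_apply']
    nlinarith [sq_nonneg ((fun s : ℝ => s ^ 2 - 2)^[j + 3] (s ψ))]
  have htψ : 4 ^ j * ε ≤ t ψ := by
    simp only [ht]
    rw [Function.iterate_succ_apply]
    have := le_iterate_sq_sub_two hε.le hsε (j + 3)
    have h4 : (4 : ℝ) ^ j * ε ≤ 4 ^ (j + 3) * ε := by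
      gcongr
      · norm_num
      · omega
    linarith
  have hsum_ge : t ψ - 2 * Fintype.card (AddChar (ZMod p) ℂ)
      ≤ ∑ ψ ∈ Finset.univ.erase (0 : AddChar (ZMod p) ℂ), t ψ := by
    rw [← Finset.add_sum_erase _ _ (Finset.mem_erase.2 ⟨hψ, Finset.mem_univ ψ⟩)]
    have h1 := Finset.card_nsmul_le_sum ((Finset.univ.erase (0 : AddChar (ZMod p) ℂ)).erase ψ) t (-2)
      (fun ψ _ => htge ψ)
    have h2 : (((Finset.univ.erase (0 : AddChar (ZMod p) ℂ)).erase ψ).card : ℝ)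
        ≤ Fintype.card (AddChar (ZMod p) ℂ) := by
      exact_mod_cast Finset.card_le_univ _
    rw [nsmul_eq_mul] at h1
    linarith
  have hQpos : (0 : ℝ) < Q := by
    have : 0 < Q := by omega
    exact_mod_cast this
  have hlow' : -((6 * p + 3) * Q : ℝ)
      ≤ ((∑ y : K, quadraticChar K ((y ^ p - y) ^ 2 - 4 * n) : ℤ) : ℝ) := by
    exact_mod_cast hlow
  rw [hsum', Finset.sum_neg_distrib, ← Finset.mul_sum] at hlow'
  have h3 : (Q : ℝ) * (6 * p + 3)
      < Q * ∑ ψ ∈ Finset.univ.erase (0 : AddChar (ZMod p) ℂ), t ψ := by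
    refine mul_lt_mul_of_pos_left ?_ hQpos
    linarith
  linarith

theorem norm_sum_quadraticChar_mul_addChar_le {p : ℕ} [Fact p.Prime] (hp : p ≠ 2) {n : ℤ}
    (hn : (n : ZMod p) ≠ 0) {ψ : AddChar (ZMod p) ℂ} (hψ : ψ ≠ 0) :
    ‖∑ a : ZMod p, (quadraticChar (ZMod p) (a ^ 2 - 4 * n) : ℂ) * ψ a‖ ≤ 2 * Real.sqrt p := by
  have h := norm_kloosterman_le hp hn hψ
  rw [kloosterman_eq_sum_quadraticChar (by rwa [ringChar.eq (ZMod p) p]) ψ hn] at h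
  simp only [add_mul, one_mul, Finset.sum_add_distrib] at h
  rwa [AddChar.sum_eq_zero_iff_ne_zero.2 hψ, add_zero] at h

end

section

/-! ### Exponential sums with periodic coefficients -/

theorem e_add (x y : ℝ) : e (x + y) = e x * e y := by
  rw [e, e, e, ← Complex.exp_add]; push_cast; ring_nf

theorem e_intCast (m : ℤ) : e m = 1 := by
  rw [e, Complex.exp_eq_one_iff]; exact ⟨m, by push_cast; ring⟩

theorem norm_e (x : ℝ) : ‖e x‖ = 1 := by
  rw [e, Complex.norm_exp]; simp

theorem e_nat_mul (x : ℝ) (n : ℕ) : e (n * x) = e x ^ n := by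
  rw [e, e, ← Complex.exp_nat_mul]; push_cast; ring_nf

theorem e_eq_of_modEq {m : ℕ} (hm : 0 < m) {a b : ℤ} (h : a ≡ b [ZMOD m]) (ξ : ℤ) :
    e ((a : ℝ) * ξ / m) = e ((b : ℝ) * ξ / m) := by
  obtain ⟨c, hc⟩ := h.dvd
  have hm' : (m : ℝ) ≠ 0 := by positivity
  have : (b : ℝ) * ξ / m = (a : ℝ) * ξ / m + ((c * ξ : ℤ) : ℝ) := by
    have : (b : ℝ) = a + m * c := by exact_mod_cast (by linarith : b = a + m * c)
    rw [this]; push_cast; field_simp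
  rw [this, e_add, e_intCast, mul_one]

/-- The exponential sum `∑_{a mod m} g(a) e(aξ/m)`. -/
def expSum (m : ℕ) (g : ℤ → ℂ) (ξ : ℤ) : ℂ :=
  ∑ a ∈ Finset.range m, g a * e ((a : ℝ) * ξ / m)

theorem sum_range_mul_eq {M : Type*} [AddCommMonoid M] (c P : ℕ) (F : ℕ → M) :
    ∑ a ∈ Finset.range (c * P), F a
      = ∑ i ∈ Finset.range c, ∑ b ∈ Finset.range P, F (P * i + b) := by
  induction c with
  | zero => simp
  | succ c ih =>
    rw [Nat.succ_mul, Finset.sum_range_add, ih, Finset.sum_range_succ, mul_comm c P]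

theorem sum_e_range {c : ℕ} (hc : 0 < c) (ξ : ℤ) :
    ∑ i ∈ Finset.range c, e ((i : ℝ) * ξ / c) = if (c : ℤ) ∣ ξ then (c : ℂ) else 0 := by
  have hc' : (c : ℝ) ≠ 0 := by positivity
  split_ifs with h
  · obtain ⟨d, rfl⟩ := h
    rw [Finset.sum_congr rfl (g := fun _ => (1 : ℂ))]
    · simp
    · intro i _
      have : (i : ℝ) * ((c * d : ℤ) : ℝ) / c = ((i * d : ℤ) : ℝ) := by push_cast; field_simp
      rw [this, e_intCast]
  · have h1 : e ((ξ : ℝ) / c) ≠ 1 := by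
      intro h1
      rw [e, Complex.exp_eq_one_iff] at h1
      obtain ⟨m, hm⟩ := h1
      apply h
      refine ⟨m, ?_⟩
      have h2 : (ξ : ℂ) / c = m := by
        have h3 : (2 * Real.pi * Complex.I : ℂ) ≠ 0 := Complex.two_pi_I_ne_zero
        apply mul_left_cancel₀ h3
        rw [mul_comm _ (m : ℂ), ← hm]; push_cast; ring
      have hcc : (c : ℂ) ≠ 0 := by exact_mod_cast hc.ne'
      rw [div_eq_iff hcc] at h2
      have : ((ξ : ℤ) : ℂ) = ((c * m : ℤ) : ℂ) := by rw [h2]; push_cast; ring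
      exact_mod_cast this
    have h2 : ∀ i ∈ Finset.range c, e ((i : ℝ) * ξ / c) = e ((ξ : ℝ) / c) ^ i := by
      intro i _
      rw [← e_nat_mul]; congr 1; ring
    rw [Finset.sum_congr rfl h2, geom_sum_eq h1, ← e_nat_mul]
    have : (c : ℝ) * ((ξ : ℝ) / c) = (ξ : ℤ) := by field_simp
    rw [this, e_intCast]; simp

/-- If `g` is periodic modulo `P`, its exponential sum modulo `cP` collapses. -/
theorem expSum_mul_of_periodic {c P : ℕ} (hc : 0 < c) (hP : 0 < P) {g : ℤ → ℂ}
    (hg : ∀ a b : ℤ, a ≡ b [ZMOD P] → g a = g b) (ξ : ℤ) :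
    expSum (c * P) g ξ = if (c : ℤ) ∣ ξ then c * expSum P g (ξ / c) else 0 := by
  have hc' : (c : ℝ) ≠ 0 := by positivity
  have hP' : (P : ℝ) ≠ 0 := by positivity
  have h1 : expSum (c * P) g ξ = (∑ i ∈ Finset.range c, e ((i : ℝ) * ξ / c))
      * ∑ b ∈ Finset.range P, g b * e ((b : ℝ) * ξ / (c * P : ℕ)) := by
    rw [expSum, sum_range_mul_eq, Finset.sum_mul]
    refine Finset.sum_congr rfl fun i _ => ?_
    rw [Finset.mul_sum]
    refine Finset.sum_congr rfl fun b _ => ?_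
    have e1 : g ((P * i + b : ℕ) : ℤ) = g b := by
      apply hg
      push_cast
      exact (Int.modEq_iff_dvd.2 ⟨-i, by ring⟩)
    have e2 : (((P * i + b : ℕ) : ℝ) * ξ / (c * P : ℕ))
        = (i : ℝ) * ξ / c + (b : ℝ) * ξ / (c * P : ℕ) := by
      push_cast; field_simp
    rw [e1, e2, e_add]; ring
  rw [h1, sum_e_range hc]
  split_ifs with h
  · obtain ⟨d, rfl⟩ := h
    rw [Int.mul_ediv_cancel_left _ (by exact_mod_cast hc.ne')]
    congr 1
    refine Finset.sum_congr rfl fun b _ => ?_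
    congr 2
    push_cast; field_simp
  · simp

theorem sum_range_mul_coprime {m₁ m₂ : ℕ} (hm₁ : 0 < m₁) (hm₂ : 0 < m₂) (h : m₁.Coprime m₂)
    {h₁ h₂ : ℕ → ℂ} (H₁ : ∀ a, h₁ (a % m₁) = h₁ a) (H₂ : ∀ a, h₂ (a % m₂) = h₂ a) :
    ∑ a ∈ Finset.range (m₁ * m₂), h₁ a * h₂ a
      = (∑ a ∈ Finset.range m₁, h₁ a) * ∑ a ∈ Finset.range m₂, h₂ a := by
  rw [Finset.sum_mul_sum, ← Finset.sum_product']
  refine Finset.sum_bij' (fun a _ => (a % m₁, a % m₂))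
    (fun x _ => (Nat.chineseRemainder h x.1 x.2 : ℕ)) ?_ ?_ ?_ ?_ ?_
  · intro a _
    simp [Nat.mod_lt _ hm₁, Nat.mod_lt _ hm₂]
  · intro x _
    exact Finset.mem_range.2 (Nat.chineseRemainder_lt_mul h _ _ hm₁.ne' hm₂.ne')
  · intro a ha
    have h1 := (Nat.chineseRemainder h (a % m₁) (a % m₂)).2
    have h2 : ((Nat.chineseRemainder h (a % m₁) (a % m₂) : ℕ)) ≡ a [MOD m₁ * m₂] :=
      (Nat.modEq_and_modEq_iff_modEq_mul h).1
        ⟨h1.1.trans (Nat.mod_modEq _ _), h1.2.trans (Nat.mod_modEq _ _)⟩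
    exact h2.eq_of_lt_of_lt (Nat.chineseRemainder_lt_mul h _ _ hm₁.ne' hm₂.ne')
      (Finset.mem_range.1 ha)
  · intro x hx
    have hx := Finset.mem_product.1 hx
    have h1 := (Nat.chineseRemainder h x.1 x.2).2
    ext
    · have h2 : _ % _ = _ % _ := h1.1
      simp only [h2, Nat.mod_eq_of_lt (Finset.mem_range.1 hx.1)]
    · have h2 : _ % _ = _ % _ := h1.2
      simp only [h2, Nat.mod_eq_of_lt (Finset.mem_range.1 hx.2)]
  · intro a _
    simp only [H₁, H₂]

/-- From u₁m₁ + u₂m₂ = 1 the phase aξ/(m₁m₂) splits as a u₂ξ/m₁ + a u₁ξ/m₂. The multipliers are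
units for the relevant moduli, so greatest common divisors with ξ are unchanged. -/
theorem expSum_mul_of_coprime {m₁ m₂ : ℕ} (hm₁ : 0 < m₁) (hm₂ : 0 < m₂) (h : m₁.Coprime m₂)
    {g₁ g₂ : ℤ → ℂ} (hg₁ : ∀ a b : ℤ, a ≡ b [ZMOD m₁] → g₁ a = g₁ b)
    (hg₂ : ∀ a b : ℤ, a ≡ b [ZMOD m₂] → g₂ a = g₂ b) (ξ : ℤ) :
    ∃ u₁ u₂ : ℤ, IsCoprime u₁ m₂ ∧ IsCoprime u₂ m₁ ∧
      expSum (m₁ * m₂) (fun a => g₁ a * g₂ a) ξ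
        = expSum m₁ g₁ (u₂ * ξ) * expSum m₂ g₂ (u₁ * ξ) := by
  have hm₁' : (m₁ : ℝ) ≠ 0 := by positivity
  have hm₂' : (m₂ : ℝ) ≠ 0 := by positivity
  obtain ⟨u₁, u₂, hu⟩ := Nat.isCoprime_iff_coprime.2 h
  refine ⟨u₁, u₂, ⟨m₁, u₂, by linarith⟩, ⟨m₂, u₁, by linarith⟩, ?_⟩
  have hu' : (u₁ : ℝ) * m₁ + u₂ * m₂ = 1 := by exact_mod_cast hu
  rw [expSum, expSum, expSum, ← sum_range_mul_coprime hm₁ hm₂ h]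
  · refine Finset.sum_congr rfl fun a _ => ?_
    have : (a : ℝ) * ξ / (m₁ * m₂ : ℕ)
        = (a : ℝ) * (u₂ * ξ : ℤ) / m₁ + (a : ℝ) * (u₁ * ξ : ℤ) / m₂ := by
      push_cast
      field_simp
      linear_combination (-(a * ξ : ℝ)) * hu'
    rw [this, e_add]; ring
  · intro a
    have h1 : ((a % m₁ : ℕ) : ℤ) ≡ a [ZMOD m₁] := by
      push_cast; exact Int.mod_modEq _ _
    rw [hg₁ _ _ h1]
    have := e_eq_of_modEq hm₁ h1 (u₂ * ξ)
    simp only [Int.cast_natCast] at this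
    rw [this]
  · intro a
    have h1 : ((a % m₂ : ℕ) : ℤ) ≡ a [ZMOD m₂] := by
      push_cast; exact Int.mod_modEq _ _
    rw [hg₂ _ _ h1]
    have := e_eq_of_modEq hm₂ h1 (u₁ * ξ)
    simp only [Int.cast_natCast] at this
    rw [this]

/-! ### The Kronecker symbol -/

/-- The local factor of the Kronecker symbol at a prime. -/
def kroneckerPrime (D : ℤ) (p : ℕ) : ℤ :=
  if p = 2 then ZMod.χ₈ (D : ZMod 8) else jacobiSym D p

theorem kronecker_mul (D : ℤ) {l₁ l₂ : ℕ} (h₁ : l₁ ≠ 0) (h₂ : l₂ ≠ 0) :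
    kronecker D (l₁ * l₂) = kronecker D l₁ * kronecker D l₂ := by
  rw [kronecker, ((Nat.perm_primeFactorsList_mul h₁ h₂).map _).prod_eq, List.map_append,
    List.prod_append]
  rfl

theorem kronecker_prime_pow (D : ℤ) {p : ℕ} (hp : p.Prime) (k : ℕ) :
    kronecker D (p ^ k) = kroneckerPrime D p ^ k := by
  rw [kronecker, hp.primeFactorsList_pow, List.map_replicate, List.prod_replicate]
  rfl

theorem kronecker_congr {D D' : ℤ} {l : ℕ}
    (h : ∀ p : ℕ, p.Prime → p ∣ l → kroneckerPrime D p = kroneckerPrime D' p) :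
    kronecker D l = kronecker D' l := by
  rw [kronecker, kronecker]
  congr 1
  refine List.map_congr_left fun p hp => ?_
  exact h p (Nat.prime_of_mem_primeFactorsList hp) (Nat.dvd_of_mem_primeFactorsList hp)

theorem kroneckerPrime_two_congr {D D' : ℤ} (h : D ≡ D' [ZMOD 8]) :
    kroneckerPrime D 2 = kroneckerPrime D' 2 := by
  have : (D : ZMod 8) = (D' : ZMod 8) := (ZMod.intCast_eq_intCast_iff _ _ 8).2 h
  simp [kroneckerPrime, this]

theorem kroneckerPrime_odd_congr {p : ℕ} (hp2 : p ≠ 2) {D D' : ℤ} (h : D ≡ D' [ZMOD p]) :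
    kroneckerPrime D p = kroneckerPrime D' p := by
  simp only [kroneckerPrime, if_neg hp2]
  rw [jacobiSym.mod_left, jacobiSym.mod_left D', h]

theorem abs_kroneckerPrime_le (D : ℤ) (p : ℕ) : |kroneckerPrime D p| ≤ 1 := by
  unfold kroneckerPrime
  split_ifs
  · have : ∀ x : ZMod 8, |ZMod.χ₈ x| ≤ 1 := by decide
    exact this _
  · rcases jacobiSym.trichotomy D p with h | h | h <;> simp [h]

theorem kroneckerPrime_mul_sq {p : ℕ} (hp : p.Prime) (D s : ℤ) (hs : ¬ (p : ℤ) ∣ s) :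
    kroneckerPrime (D * s ^ 2) p = kroneckerPrime D p := by
  by_cases h2 : p = 2
  · subst h2
    apply kroneckerPrime_two_congr
    have : s ^ 2 ≡ 1 [ZMOD 8] := by
      have h1 : s % 2 = 1 := by omega
      have h2 : s % 8 = 1 ∨ s % 8 = 3 ∨ s % 8 = 5 ∨ s % 8 = 7 := by omega
      have h3 := (Int.mod_modEq s 8).symm.pow 2
      rcases h2 with h | h | h | h <;> rw [h] at h3 <;> exact h3
    simpa using (Int.ModEq.refl D).mul this
  · have : Fact p.Prime := ⟨hp⟩
    simp only [kroneckerPrime, if_neg h2]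
    rw [jacobiSym.mul_left, jacobiSym.sq_one', mul_one]
    rw [Int.gcd_comm, ← Int.isCoprime_iff_gcd_eq_one]
    exact (Prime.coprime_iff_not_dvd (Nat.prime_iff_prime_int.1 hp)).2 hs

/-! ### Square roots of an integer modulo prime powers -/

theorem pow_dvd_or_pow_dvd_of_pow_dvd_mul {p : ℤ} (hp : Prime p) {x y : ℤ} {r s : ℕ}
    (h : p ^ (r + s + 1) ∣ x * y) : p ^ (r + 1) ∣ x ∨ p ^ (s + 1) ∣ y := by
  by_contra! hc
  have h1 := emultiplicity_lt_iff_not_dvd.2 hc.1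
  have h2 := emultiplicity_lt_iff_not_dvd.2 hc.2
  have h3 := le_emultiplicity_of_pow_dvd h
  rw [emultiplicity_mul hp] at h3
  have h1' : emultiplicity p x ≤ r := Order.le_of_lt_add_one (by exact_mod_cast h1)
  have h2' : emultiplicity p y ≤ s := Order.le_of_lt_add_one (by exact_mod_cast h2)
  have h4 := h3.trans (add_le_add h1' h2')
  have h5 : r + s + 1 ≤ r + s := by exact_mod_cast h4
  omega

theorem card_filter_modEq_le {P r : ℕ} (b : ℤ) :
    ((Finset.range (P * r)).filter fun a : ℕ => (P : ℤ) ∣ a - b).card ≤ r := by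
  conv_rhs => rw [← Finset.card_range r]
  refine Finset.card_le_card_of_injOn (fun a => a / P) ?_ ?_
  · intro a ha
    have := (Finset.mem_filter.1 ha).1
    rw [Finset.mem_range] at this
    exact Finset.mem_coe.2 (Finset.mem_range.2 (Nat.div_lt_of_lt_mul this))
  · intro a ha a' ha' h
    have h1 := (Finset.mem_filter.1 ha).2
    have h2 := (Finset.mem_filter.1 ha').2
    have h3 : (P : ℤ) ∣ a - a' := by
      have := dvd_sub h1 h2
      rwa [sub_sub_sub_cancel_right] at this
    have h4 : a % P = a' % P := by
      have : (a' : ℤ) ≡ a [ZMOD P] := Int.modEq_iff_dvd.2 h3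
      exact ((Int.natCast_modEq_iff.1 this).symm)
    have h5 : a / P = a' / P := h
    rw [← Nat.div_add_mod a P, ← Nat.div_add_mod a' P, h4, h5]

/-- Any two solutions satisfy p^{2j} ∣ (a - a₀)(a + a₀), so a lies in one of two classes modulo p^j,
each with p^j members in the range. This crude form is used at p = 2. -/
theorem card_sqrt_le_two_mul {p : ℕ} (hp : p.Prime) (c : ℤ) (j : ℕ) :
    ((Finset.range (p ^ j * p ^ j)).filter fun a : ℕ => ((p ^ j : ℕ) : ℤ) ^ 2 ∣ (a : ℤ) ^ 2 - c).card
      ≤ 2 * p ^ j := by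
  set A := (Finset.range (p ^ j * p ^ j)).filter fun a : ℕ =>
    ((p ^ j : ℕ) : ℤ) ^ 2 ∣ (a : ℤ) ^ 2 - c with hA
  rcases A.eq_empty_or_nonempty with h | ⟨a₀, ha₀⟩
  · rw [h]; simp
  have hsub : A ⊆ ((Finset.range (p ^ j * p ^ j)).filter fun a : ℕ => ((p ^ j : ℕ) : ℤ) ∣ a - (a₀ : ℤ))
      ∪ ((Finset.range (p ^ j * p ^ j)).filter fun a : ℕ => ((p ^ j : ℕ) : ℤ) ∣ a - (-a₀ : ℤ)) := by
    intro a ha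
    obtain ⟨har, had⟩ := Finset.mem_filter.1 ha
    have h1 : ((p ^ j : ℕ) : ℤ) ^ 2 ∣ ((a : ℤ) - a₀) * (a + a₀) := by
      have := dvd_sub had (Finset.mem_filter.1 ha₀).2
      rwa [show (a : ℤ) ^ 2 - c - (a₀ ^ 2 - c) = (a - a₀) * (a + a₀) by ring] at this
    have h2 : ((p ^ j : ℕ) : ℤ) ∣ (a : ℤ) - a₀ ∨ ((p ^ j : ℕ) : ℤ) ∣ (a : ℤ) + a₀ := by
      cases j with
      | zero => simp
      | succ j =>
        push_cast at h1 ⊢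
        refine pow_dvd_or_pow_dvd_of_pow_dvd_mul (Nat.prime_iff_prime_int.1 hp)
          ((pow_dvd_pow _ ?_).trans (by rwa [← pow_mul] at h1))
        omega
    rw [Finset.mem_union, Finset.mem_filter, Finset.mem_filter, sub_neg_eq_add]
    tauto
  refine (Finset.card_le_card hsub).trans ((Finset.card_union_le _ _).trans ?_)
  have h1 := card_filter_modEq_le (P := p ^ j) (r := p ^ j) (a₀ : ℤ)
  have h2 := card_filter_modEq_le (P := p ^ j) (r := p ^ j) (-a₀ : ℤ)
  omega

/-- The constant 1 matters: primes dividing f but not l have no divisor function d(l) to absorb a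
factor 2, which would cost 2^{ω(f)} in `norm_Kl_le`. -/
theorem card_sqrt_le {p : ℕ} (hp : p.Prime) (hp2 : p ≠ 2) (c : ℤ) (j : ℕ) :
    ((Finset.range (p ^ j * p ^ j)).filter fun a : ℕ => ((p ^ j : ℕ) : ℤ) ^ 2 ∣ (a : ℤ) ^ 2 - c).card
      ≤ p ^ j := by
  set A := (Finset.range (p ^ j * p ^ j)).filter fun a : ℕ =>
    ((p ^ j : ℕ) : ℤ) ^ 2 ∣ (a : ℤ) ^ 2 - c with hA
  have hpi := Nat.prime_iff_prime_int.1 hp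
  rcases A.eq_empty_or_nonempty with h | ⟨a₀, ha₀⟩
  · rw [h]; simp
  cases j with
  | zero =>
    refine (Finset.card_filter_le _ _).trans ?_
    simp
  | succ j =>
  have hmul : ∀ a ∈ A, (p : ℤ) ^ (j + (j + 1) + 1) ∣ ((a : ℤ) - a₀) * (a + a₀) := by
    intro a ha
    have := dvd_sub (Finset.mem_filter.1 ha).2 (Finset.mem_filter.1 ha₀).2
    push_cast at this
    rwa [← pow_mul, show (a : ℤ) ^ 2 - c - (a₀ ^ 2 - c) = (a - a₀) * (a + a₀) by ring,
      show (j + 1) * 2 = j + (j + 1) + 1 by ring] at this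
  by_cases h0 : (p : ℤ) ^ (j + 1) ∣ a₀
  · have hsub : A ⊆ (Finset.range (p ^ (j + 1) * p ^ (j + 1))).filter fun a : ℕ =>
        ((p ^ (j + 1) : ℕ) : ℤ) ∣ a - (0 : ℤ) := by
      intro a ha
      refine Finset.mem_filter.2 ⟨(Finset.mem_filter.1 ha).1, ?_⟩
      push_cast
      rw [sub_zero]
      rcases pow_dvd_or_pow_dvd_of_pow_dvd_mul hpi (hmul a ha) with h | h
      · simpa using dvd_add h h0
      · have := dvd_sub ((pow_dvd_pow _ (by omega)).trans h) h0
        simpa using this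
    exact (Finset.card_le_card hsub).trans (card_filter_modEq_le _)
  · have hr : p ^ (j + 1) * p ^ (j + 1) = p ^ (j + 2) * p ^ j := by ring
    have hsub : A ⊆ ((Finset.range (p ^ (j + 2) * p ^ j)).filter fun a : ℕ =>
          ((p ^ (j + 2) : ℕ) : ℤ) ∣ a - (a₀ : ℤ))
        ∪ ((Finset.range (p ^ (j + 2) * p ^ j)).filter fun a : ℕ =>
          ((p ^ (j + 2) : ℕ) : ℤ) ∣ a - (-a₀ : ℤ)) := by
      intro a ha
      rw [Finset.mem_union, Finset.mem_filter, Finset.mem_filter, sub_neg_eq_add, ← hr]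
      have har := (Finset.mem_filter.1 ha).1
      have h1 := pow_dvd_or_pow_dvd_of_pow_dvd_mul hpi (hmul a ha)
      have h2 := pow_dvd_or_pow_dvd_of_pow_dvd_mul (r := j + 1) (s := j) hpi
        (by have := hmul a ha; rwa [add_comm j (j + 1)] at this)
      -- For odd p both factors could be divisible by p^{j+1} only if a₀ were. Hence one factor is
      -- divisible by p^{j+2}: two classes with p^j members each, and 2p^j ≤ p^{j+1}.
      have h3 : ¬ ((p : ℤ) ^ (j + 1) ∣ (a : ℤ) - a₀ ∧ (p : ℤ) ^ (j + 1) ∣ (a : ℤ) + a₀) := by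
        rintro ⟨h4, h5⟩
        apply h0
        have h6 : (p : ℤ) ^ (j + 1) ∣ 2 * a₀ := by
          have := dvd_sub h5 h4
          rwa [show (a : ℤ) + a₀ - (a - a₀) = 2 * a₀ by ring] at this
        refine IsCoprime.dvd_of_dvd_mul_left (IsCoprime.pow_left ?_) h6
        refine (Prime.coprime_iff_not_dvd hpi).2 fun h7 => hp2 ?_
        exact (Nat.prime_dvd_prime_iff_eq hp Nat.prime_two).1 (by exact_mod_cast h7)
      push_cast
      tauto
    refine (Finset.card_le_card hsub).trans ((Finset.card_union_le _ _).trans ?_)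
    have h1 := card_filter_modEq_le (P := p ^ (j + 2)) (r := p ^ j) (a₀ : ℤ)
    have h2 := card_filter_modEq_le (P := p ^ (j + 2)) (r := p ^ j) (-a₀ : ℤ)
    have h3 : 2 * p ^ j ≤ p ^ (j + 1) := by
      rw [pow_succ, mul_comm]; exact Nat.mul_le_mul_left _ hp.two_le
    omega

end

section

/-! ### Local bounds at odd primes -/

section Local

variable {p : ℕ} [Fact p.Prime]

theorem sum_range_eq_sum_zmod (F : ZMod p → ℂ) :
    ∑ a ∈ Finset.range p, F (a : ZMod p) = ∑ x : ZMod p, F x := by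
  refine Finset.sum_bij' (fun a _ => (a : ZMod p)) (fun x _ => x.val) ?_ ?_ ?_ ?_ ?_
  · simp
  · intro x _; exact Finset.mem_range.2 (ZMod.val_lt x)
  · intro a ha; exact ZMod.val_cast_of_lt (Finset.mem_range.1 ha)
  · intro x _; simp
  · simp

theorem pow_eq_self_of_odd {z : ℤ} (hz : z = 0 ∨ z = 1 ∨ z = -1) {k : ℕ} (hk : Odd k) :
    z ^ k = z := by
  rcases hz with rfl | rfl | rfl
  · exact zero_pow hk.pos.ne'
  · simp
  · exact hk.neg_one_pow

theorem pow_eq_sq_of_even {z : ℤ} (hz : z = 0 ∨ z = 1 ∨ z = -1) {k : ℕ} (hk : Even k)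
    (hk0 : k ≠ 0) : z ^ k = z ^ 2 := by
  rcases hz with rfl | rfl | rfl
  · rw [zero_pow hk0]; rfl
  · simp
  · rw [hk.neg_one_pow]; norm_num

theorem quadraticChar_trichotomy (x : ZMod p) :
    quadraticChar (ZMod p) x = 0 ∨ quadraticChar (ZMod p) x = 1 ∨ quadraticChar (ZMod p) x = -1 := by
  by_cases h : x = 0
  · left; rw [h]; simp
  · right; exact quadraticChar_dichotomy h

theorem quadraticChar_pow_of_odd (x : ZMod p) {k : ℕ} (hk : Odd k) :
    (quadraticChar (ZMod p) x : ℂ) ^ k = (quadraticChar (ZMod p) x : ℂ) := by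
  exact_mod_cast pow_eq_self_of_odd (quadraticChar_trichotomy x) hk

theorem quadraticChar_pow_of_even (x : ZMod p) {k : ℕ} (hk : Even k) (hk0 : k ≠ 0) :
    (quadraticChar (ZMod p) x : ℂ) ^ k = (quadraticChar (ZMod p) x : ℂ) ^ 2 := by
  exact_mod_cast pow_eq_sq_of_even (quadraticChar_trichotomy x) hk hk0

theorem norm_sum_quadraticChar_mul_le (hp : p ≠ 2) {ψ : AddChar (ZMod p) ℂ} (hψ : ψ ≠ 0) :
    ‖∑ x : ZMod p, (quadraticChar (ZMod p) x : ℂ) * ψ x‖ = Real.sqrt p := by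
  have hchar : ringChar (ZMod p) ≠ 2 := by rwa [ringChar.eq (ZMod p) p]
  have hprim : ψ.IsPrimitive := AddChar.IsPrimitive.of_ne_one hψ
  have hχ1 : (quadraticChar (ZMod p)).ringHomComp (Int.castRingHom ℂ) ≠ 1 := by
    exact (MulChar.ringHomComp_ne_one_iff (RingHom.injective_int (Int.castRingHom ℂ))).2
      (quadraticChar_ne_one hchar)
  have hχ2 : ((quadraticChar (ZMod p)).ringHomComp (Int.castRingHom ℂ)).IsQuadratic :=
    (quadraticChar_isQuadratic (ZMod p)).comp _
  have h := gaussSum_sq hχ1 hχ2 hprim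
  have h2 : ‖gaussSum ((quadraticChar (ZMod p)).ringHomComp (Int.castRingHom ℂ)) ψ‖ ^ 2 = p := by
    rw [← norm_pow, h, norm_mul]
    have : ‖((quadraticChar (ZMod p)).ringHomComp (Int.castRingHom ℂ)) (-1)‖ = 1 := by
      have h1 : ((quadraticChar (ZMod p)).ringHomComp (Int.castRingHom ℂ)) (-1)
          * ((quadraticChar (ZMod p)).ringHomComp (Int.castRingHom ℂ)) (-1) = 1 := by
        rw [← map_mul]; simp
      have h2 := congrArg norm h1
      rw [norm_mul, norm_one] at h2
      nlinarith [norm_nonneg (((quadraticChar (ZMod p)).ringHomComp (Int.castRingHom ℂ)) (-1))]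
    rw [this]; simp [ZMod.card]
  have h3 : ∑ x : ZMod p, (quadraticChar (ZMod p) x : ℂ) * ψ x
      = gaussSum ((quadraticChar (ZMod p)).ringHomComp (Int.castRingHom ℂ)) ψ := rfl
  rw [h3, ← h2, Real.sqrt_sq (norm_nonneg _)]

/-- Sums of additive characters over the complement of a small set. -/
theorem norm_sum_quadraticChar_sq_mul_le {ψ : AddChar (ZMod p) ℂ} (hψ : ψ ≠ 0)
    (q : ZMod p → ZMod p) {N : ℕ} (hN : (Finset.univ.filter fun x => q x = 0).card ≤ N) :
    ‖∑ x : ZMod p, (quadraticChar (ZMod p) (q x) : ℂ) ^ 2 * ψ x‖ ≤ N := by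
  have h1 : ∑ x : ZMod p, (quadraticChar (ZMod p) (q x) : ℂ) ^ 2 * ψ x
      = -∑ x ∈ Finset.univ.filter fun x => q x = 0, ψ x := by
    rw [eq_neg_iff_add_eq_zero, Finset.sum_filter, ← Finset.sum_add_distrib]
    refine Eq.trans ?_ (AddChar.sum_eq_zero_iff_ne_zero.2 hψ)
    refine Finset.sum_congr rfl fun x _ => ?_
    split_ifs with h
    · rw [h]; simp
    · have : (quadraticChar (ZMod p) (q x) : ℂ) ^ 2 = 1 := by
        exact_mod_cast quadraticChar_sq_one h
      rw [this]; ring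
  rw [h1, norm_neg]
  refine (norm_sum_le _ _).trans ?_
  rw [Finset.sum_congr rfl fun x _ => AddChar.norm_apply ψ x]
  simpa using hN

/-- For odd k this is a shifted Gauss sum. For even k the coefficient is the indicator of a nonzero
value, leaving at most one exceptional point; for β = 0 it is constant and ψ sums to zero. -/
theorem norm_sum_affine_le (hp : p ≠ 2) {ψ : AddChar (ZMod p) ℂ} (hψ : ψ ≠ 0) (α β : ZMod p)
    {k : ℕ} (hk : k ≠ 0) :
    ‖∑ x : ZMod p, (quadraticChar (ZMod p) (α + β * x) : ℂ) ^ k * ψ x‖ ≤ Real.sqrt p := by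
  have hp1 : 1 ≤ Real.sqrt p := by
    rw [Real.one_le_sqrt]; exact_mod_cast (Fact.out : p.Prime).one_lt.le
  by_cases hβ : β = 0
  · simp only [hβ, zero_mul, add_zero]
    rw [← Finset.mul_sum, AddChar.sum_eq_zero_iff_ne_zero.2 hψ, mul_zero, norm_zero]
    positivity
  rcases Nat.even_or_odd k with hk' | hk'
  · simp only [quadraticChar_pow_of_even _ hk' hk]
    refine (norm_sum_quadraticChar_sq_mul_le hψ (fun x => α + β * x) (N := 1) ?_).trans
      (by simpa using hp1)
    rw [Finset.card_le_one]
    intro x hx y hy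
    simp only [Finset.mem_filter, Finset.mem_univ, true_and] at hx hy
    exact mul_left_cancel₀ hβ (by linear_combination hx - hy)
  · simp only [quadraticChar_pow_of_odd _ hk']
    have hψ' : ψ.mulShift β⁻¹ ≠ 0 := (AddChar.IsPrimitive.of_ne_one hψ) (inv_ne_zero hβ)
    have h1 : ∑ x : ZMod p, (quadraticChar (ZMod p) (α + β * x) : ℂ) * ψ x
        = ψ (-(β⁻¹ * α)) * ∑ y : ZMod p, (quadraticChar (ZMod p) y : ℂ) * ψ.mulShift β⁻¹ y := by
      rw [Finset.mul_sum]
      refine Fintype.sum_equiv ((Equiv.mulLeft₀ β hβ).trans (Equiv.addLeft α)) _ _ fun x => ?_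
      simp only [Equiv.trans_apply, Equiv.mulLeft₀_apply, Equiv.coe_addLeft,
        AddChar.mulShift_apply]
      rw [mul_left_comm, ← AddChar.map_add_eq_mul]
      congr 2
      field_simp
      ring
    rw [h1, norm_mul, AddChar.norm_apply, one_mul, norm_sum_quadraticChar_mul_le hp hψ']

theorem card_sq_eq_le_two (c : ZMod p) :
    (Finset.univ.filter fun x : ZMod p => x ^ 2 - c = 0).card ≤ 2 := by
  open Polynomial in
  have h := card_le_degree_of_subset_roots (p := (X : (ZMod p)[X]) ^ 2 - C c)
    (Z := Finset.univ.filter fun x : ZMod p => x ^ 2 - c = 0) (by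
      intro x hx
      have hx : x ^ 2 - c = 0 := by simpa using hx
      rw [mem_roots (X_pow_sub_C_ne_zero two_pos c)]
      simpa using hx)
  rwa [natDegree_X_pow_sub_C] at h

theorem norm_sum_quadratic_le (hp : p ≠ 2) {ψ : AddChar (ZMod p) ℂ} (hψ : ψ ≠ 0) (n : ℤ)
    {k : ℕ} (hk : k ≠ 0) :
    ‖∑ x : ZMod p, (quadraticChar (ZMod p) (x ^ 2 - 4 * n) : ℂ) ^ k * ψ x‖ ≤ 2 * Real.sqrt p := by
  have hp1 : 1 ≤ Real.sqrt p := by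
    rw [Real.one_le_sqrt]; exact_mod_cast (Fact.out : p.Prime).one_lt.le
  have hsq : ‖∑ x : ZMod p, (quadraticChar (ZMod p) (x ^ 2 - 4 * n) : ℂ) ^ 2 * ψ x‖
      ≤ 2 * Real.sqrt p := by
    refine (norm_sum_quadraticChar_sq_mul_le hψ (fun x => x ^ 2 - 4 * (n : ZMod p)) (N := 2)
      (card_sq_eq_le_two _)).trans ?_
    push_cast; linarith
  rcases Nat.even_or_odd k with hk' | hk'
  · simpa only [quadraticChar_pow_of_even _ hk' hk] using hsq
  -- For p ∣ n the polynomial degenerates to x², so χ equals its own square and the even case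
  -- applies; otherwise this is the Weil bound.
  · simp only [quadraticChar_pow_of_odd _ hk']
    by_cases hn : (n : ZMod p) = 0
    · have h2 : ∀ x : ZMod p, (quadraticChar (ZMod p) (x ^ 2 - 4 * n) : ℂ)
          = (quadraticChar (ZMod p) (x ^ 2 - 4 * n) : ℂ) ^ 2 := fun x => by
        rw [hn, mul_zero, sub_zero, map_pow]
        push_cast
        rw [← pow_mul, quadraticChar_pow_of_even x (by decide : Even (2 * 2)) (by norm_num)]
      rw [Finset.sum_congr rfl fun x _ => by rw [h2]]
      exact hsq
    · exact norm_sum_quadraticChar_mul_addChar_le hp hn hψ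

end Local

end

section

/-! ### The character sums attached to odd `l` and `f` -/

/-- The coefficient `(((a² - 4n)/f²)/l)`, extended by zero to those `a` with `f² ∤ a² - 4n`. -/
def oddCoeff (n : ℤ) (l f : ℕ) (a : ℤ) : ℂ :=
  if (f : ℤ) ^ 2 ∣ a ^ 2 - 4 * n then (kronecker ((a ^ 2 - 4 * n) / (f : ℤ) ^ 2) l : ℂ) else 0

theorem norm_kronecker_le (D : ℤ) (l : ℕ) : ‖(kronecker D l : ℂ)‖ ≤ 1 := by
  have h : ∀ L : List ℕ, |(L.map fun p => kroneckerPrime D p).prod| ≤ 1 := by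
    intro L
    induction L with
    | nil => simp
    | cons p L ih =>
      rw [List.map_cons, List.prod_cons, abs_mul]
      exact mul_le_one₀ (abs_kroneckerPrime_le D p) (abs_nonneg _) ih
  rw [Complex.norm_intCast]
  exact_mod_cast h l.primeFactorsList

theorem norm_oddCoeff_le (n : ℤ) (l f : ℕ) (a : ℤ) :
    ‖oddCoeff n l f a‖ ≤ if (f : ℤ) ^ 2 ∣ a ^ 2 - 4 * n then 1 else 0 := by
  unfold oddCoeff
  split_ifs
  · exact norm_kronecker_le _ _
  · simp

theorem sq_sub_modEq {a b M : ℤ} (h : a ≡ b [ZMOD M]) (c : ℤ) : M ∣ (a ^ 2 - c) - (b ^ 2 - c) := by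
  have := (h.pow 2).symm.dvd
  rwa [sub_sub_sub_cancel_right]

theorem dvd_iff_of_modEq {a b c d M : ℤ} (hd : d ∣ M) (h : a ≡ b [ZMOD M]) :
    d ∣ a ^ 2 - c ↔ d ∣ b ^ 2 - c :=
  (dvd_iff_dvd_of_dvd_sub (hd.trans (sq_sub_modEq h c)))

theorem div_modEq_div {a b c d m : ℤ} (hd0 : d ≠ 0) (h : a ≡ b [ZMOD m * d])
    (hda : d ∣ a ^ 2 - c) : (a ^ 2 - c) / d ≡ (b ^ 2 - c) / d [ZMOD m] := by
  have hdb := (dvd_iff_of_modEq (c := c) (dvd_mul_left d m) h).1 hda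
  obtain ⟨x, hx⟩ := hda
  obtain ⟨y, hy⟩ := hdb
  obtain ⟨z, hz⟩ := sq_sub_modEq h c
  rw [hx, hy, Int.mul_ediv_cancel_left _ hd0, Int.mul_ediv_cancel_left _ hd0]
  refine (Int.modEq_iff_dvd.2 ⟨z, ?_⟩).symm
  rw [hx, hy] at hz
  exact mul_left_cancel₀ hd0 (by linear_combination hz)

/-- At odd primes the symbol depends on its numerator only modulo the primes dividing l, not modulo
l. This short period is what collapses the exponential sums. -/
theorem oddCoeff_congr_of_primes {n : ℤ} {l f : ℕ} (hl : ∀ p : ℕ, p.Prime → p ∣ l → p ≠ 2)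
    (hf : f ≠ 0) {m : ℕ} (hm : ∀ p : ℕ, p.Prime → p ∣ l → p ∣ m) {a b : ℤ}
    (h : a ≡ b [ZMOD (m * f ^ 2 : ℕ)]) : oddCoeff n l f a = oddCoeff n l f b := by
  have hf2 : (f : ℤ) ^ 2 ≠ 0 := by positivity
  push_cast at h
  have h1 := dvd_iff_of_modEq (c := 4 * n) (dvd_mul_left ((f : ℤ) ^ 2) m) h
  unfold oddCoeff
  by_cases hd : (f : ℤ) ^ 2 ∣ a ^ 2 - 4 * n
  · rw [if_pos hd, if_pos (h1.1 hd)]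
    congr 1
    refine kronecker_congr fun p hp hpl => kroneckerPrime_odd_congr (hl p hp hpl) ?_
    exact (div_modEq_div hf2 h hd).of_dvd (by exact_mod_cast hm p hp hpl)
  · rw [if_neg hd, if_neg (fun hb => hd (h1.2 hb))]

theorem kronecker_mul_sq {D s : ℤ} {l : ℕ} (h : IsCoprime s l) :
    kronecker (D * s ^ 2) l = kronecker D l := by
  refine kronecker_congr fun p hp hpl => kroneckerPrime_mul_sq hp D s fun hps => ?_
  have h1 : IsUnit (p : ℤ) := h.isUnit_of_dvd' hps (by exact_mod_cast hpl)
  exact (Nat.prime_iff_prime_int.1 hp).not_isUnit h1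

theorem div_mul_sq_eq {X f₁ f₂ : ℤ} (hf₁ : f₁ ≠ 0) (hf₂ : f₂ ≠ 0) (h : (f₁ * f₂) ^ 2 ∣ X) :
    X / f₁ ^ 2 = X / (f₁ * f₂) ^ 2 * f₂ ^ 2 := by
  obtain ⟨y, rfl⟩ := h
  rw [Int.mul_ediv_cancel_left _ (by positivity), mul_pow, mul_assoc,
    Int.mul_ediv_cancel_left _ (by positivity), mul_comm]

/-- Dividing by f₁² instead of (f₁f₂)² changes the numerator by the square f₂², which is coprime to
l₁ and hence invisible to its symbol; symmetrically for l₂. -/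
theorem oddCoeff_mul (n : ℤ) {l₁ l₂ f₁ f₂ : ℕ} (hl₁ : l₁ ≠ 0) (hl₂ : l₂ ≠ 0) (hf₁ : f₁ ≠ 0)
    (hf₂ : f₂ ≠ 0) (h12 : (l₁ * f₁).Coprime (l₂ * f₂)) (a : ℤ) :
    oddCoeff n (l₁ * l₂) (f₁ * f₂) a = oddCoeff n l₁ f₁ a * oddCoeff n l₂ f₂ a := by
  have hff : IsCoprime (f₁ : ℤ) f₂ := Nat.isCoprime_iff_coprime.2
    (Nat.Coprime.coprime_dvd_left (dvd_mul_left _ _) (Nat.Coprime.coprime_dvd_right (dvd_mul_left _ _) h12))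
  have hl1f2 : IsCoprime (f₂ : ℤ) l₁ := (Nat.isCoprime_iff_coprime.2
    (Nat.Coprime.coprime_dvd_left (dvd_mul_right _ _)
      (Nat.Coprime.coprime_dvd_right (dvd_mul_left _ _) h12))).symm
  have hl2f1 : IsCoprime (f₁ : ℤ) l₂ := Nat.isCoprime_iff_coprime.2
    (Nat.Coprime.coprime_dvd_left (dvd_mul_left _ _)
      (Nat.Coprime.coprime_dvd_right (dvd_mul_right _ _) h12))
  have hiff : ((f₁ * f₂ : ℕ) : ℤ) ^ 2 ∣ a ^ 2 - 4 * n
      ↔ (f₁ : ℤ) ^ 2 ∣ a ^ 2 - 4 * n ∧ (f₂ : ℤ) ^ 2 ∣ a ^ 2 - 4 * n := by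
    push_cast
    rw [mul_pow]
    constructor
    · intro h
      exact ⟨(dvd_mul_right _ _).trans h, (dvd_mul_left _ _).trans h⟩
    · rintro ⟨h1, h2⟩
      exact (hff.pow (m := 2) (n := 2)).mul_dvd h1 h2
  have hf1' : (f₁ : ℤ) ≠ 0 := by exact_mod_cast hf₁
  have hf2' : (f₂ : ℤ) ≠ 0 := by exact_mod_cast hf₂
  unfold oddCoeff
  by_cases h : ((f₁ * f₂ : ℕ) : ℤ) ^ 2 ∣ a ^ 2 - 4 * n
  · rw [if_pos h, if_pos (hiff.1 h).1, if_pos (hiff.1 h).2]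
    push_cast at h ⊢
    rw [kronecker_mul _ hl₁ hl₂, div_mul_sq_eq hf1' hf2' h, kronecker_mul_sq hl1f2]
    rw [mul_comm (f₁ : ℤ)] at h ⊢
    rw [div_mul_sq_eq hf2' hf1' h, kronecker_mul_sq hl2f1]
    push_cast
    rfl
  · rw [if_neg h]
    by_cases h1 : (f₁ : ℤ) ^ 2 ∣ a ^ 2 - 4 * n
    · rw [if_neg (c := (f₂ : ℤ) ^ 2 ∣ _) (fun h2 => h (hiff.2 ⟨h1, h2⟩)), mul_zero]
    · rw [if_neg h1, zero_mul]

theorem norm_expSum_le (m : ℕ) (g : ℤ → ℂ) (ξ : ℤ) :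
    ‖expSum m g ξ‖ ≤ ∑ a ∈ Finset.range m, ‖g a‖ := by
  refine (norm_sum_le _ _).trans (Finset.sum_le_sum fun a _ => ?_)
  rw [norm_mul, norm_e, mul_one]

theorem sum_norm_oddCoeff_le (n : ℤ) (l f r : ℕ) :
    ∑ a ∈ Finset.range (r * (f * f)), ‖oddCoeff n l f a‖
      ≤ r * ((Finset.range (f * f)).filter fun a : ℕ => (f : ℤ) ^ 2 ∣ (a : ℤ) ^ 2 - 4 * n).card := by
  rw [sum_range_mul_eq]
  have h : ∀ i ∈ Finset.range r, ∑ b ∈ Finset.range (f * f), ‖oddCoeff n l f (f * f * i + b : ℕ)‖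
      ≤ ((Finset.range (f * f)).filter fun a : ℕ => (f : ℤ) ^ 2 ∣ (a : ℤ) ^ 2 - 4 * n).card := by
    intro i _
    rw [Finset.card_filter]
    push_cast
    refine Finset.sum_le_sum fun b _ => ?_
    refine (norm_oddCoeff_le _ _ _ _).trans (le_of_eq ?_)
    have hmod : ((f : ℤ) * f * i + b) ≡ b [ZMOD (f : ℤ) ^ 2] :=
      Int.modEq_iff_dvd.2 ⟨-i, by ring⟩
    simp only [dvd_iff_of_modEq (c := 4 * n) dvd_rfl hmod]
  refine (Finset.sum_le_card_nsmul _ _ _ h).trans ?_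
  simp

theorem stdAddChar_eq_e {p : ℕ} [NeZero p] (j : ℤ) :
    ZMod.stdAddChar (j : ZMod p) = e ((j : ℝ) / p) := by
  rw [ZMod.stdAddChar_coe, e]
  push_cast
  ring_nf

theorem kroneckerPrime_eq_quadraticChar {p : ℕ} [Fact p.Prime] (hp : p ≠ 2) (D : ℤ) :
    kroneckerPrime D p = quadraticChar (ZMod p) D := by
  rw [kroneckerPrime, if_neg hp, ← jacobiSym.legendreSym.to_jacobiSym, legendreSym]

/-- For j = 0 this is a complete sum of a quadratic polynomial modulo p. For j > 0, write a = b +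
p^{2j} i with b² ≡ 4n modulo p^{2j}: the quotient is affine in i modulo p, so each of the at most
p^j values of b contributes at most √p. -/
theorem expSum_oddCoeff_pow_le {p : ℕ} (hp : p.Prime) (hp2 : p ≠ 2) (n : ℤ) {k : ℕ} (hk : k ≠ 0)
    (j : ℕ) {ξ : ℤ} (hξ : ¬ (p : ℤ) ∣ ξ) :
    ‖expSum (p * (p ^ j * p ^ j)) (oddCoeff n (p ^ k) (p ^ j)) ξ‖ ≤ 2 * p ^ j * Real.sqrt p := by
  have : Fact p.Prime := ⟨hp⟩
  have hp0 : (p : ℝ) ≠ 0 := by have := hp.ne_zero; exact_mod_cast this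
  set ψ : AddChar (ZMod p) ℂ := (ZMod.stdAddChar (N := p)).mulShift (ξ : ZMod p) with hψdef
  have hψ : ψ ≠ 0 := ZMod.isPrimitive_stdAddChar p fun h => hξ ((ZMod.intCast_zmod_eq_zero_iff_dvd ξ p).1 h)
  have hψe : ∀ i : ℕ, ψ (i : ZMod p) = e ((i : ℝ) * ξ / p) := by
    intro i
    rw [hψdef, AddChar.mulShift_apply]
    have := stdAddChar_eq_e (p := p) (ξ * i)
    push_cast at this
    rw [this]; congr 1; ring
  rcases Nat.eq_zero_or_pos j with rfl | hj
  · have h1 : expSum (p * (p ^ 0 * p ^ 0)) (oddCoeff n (p ^ k) (p ^ 0)) ξ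
        = ∑ x : ZMod p, (quadraticChar (ZMod p) (x ^ 2 - 4 * n) : ℂ) ^ k * ψ x := by
      rw [← sum_range_eq_sum_zmod, expSum]
      simp only [pow_zero, mul_one]
      refine Finset.sum_congr rfl fun a _ => ?_
      rw [hψe, oddCoeff]
      simp only [Nat.cast_one, one_pow, one_dvd, if_true, Int.ediv_one]
      rw [kronecker_prime_pow _ hp, kroneckerPrime_eq_quadraticChar hp2]
      push_cast
      rfl
    rw [h1]
    simpa using norm_sum_quadratic_le hp2 hψ n hk
  · set A := (Finset.range (p ^ j * p ^ j)).filter fun a : ℕ =>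
      ((p ^ j : ℕ) : ℤ) ^ 2 ∣ (a : ℤ) ^ 2 - 4 * n with hA
    have hpj : (((p ^ j : ℕ) : ℤ) ^ 2) ≠ 0 := by have := hp.ne_zero; positivity
    have h1 : expSum (p * (p ^ j * p ^ j)) (oddCoeff n (p ^ k) (p ^ j)) ξ
        = ∑ b ∈ A, e ((b : ℝ) * ξ / (p * (p ^ j * p ^ j) : ℕ)) *
          ∑ x : ZMod p, (quadraticChar (ZMod p) ((((b : ℤ) ^ 2 - 4 * n) / ((p ^ j : ℕ) : ℤ) ^ 2 : ℤ)
            + 2 * b * x) : ℂ) ^ k * ψ x := by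
      rw [expSum, sum_range_mul_eq, Finset.sum_comm, hA, Finset.sum_filter]
      refine Finset.sum_congr rfl fun b _ => ?_
      have hmod : ∀ i : ℕ, (((p ^ j * p ^ j * i + b : ℕ)) : ℤ) ≡ b [ZMOD ((p ^ j : ℕ) : ℤ) ^ 2] := by
        intro i
        refine Int.modEq_iff_dvd.2 ⟨-i, ?_⟩
        push_cast; ring
      split_ifs with hb
      · rw [← sum_range_eq_sum_zmod, Finset.mul_sum]
        refine Finset.sum_congr rfl fun i _ => ?_
        rw [hψe, oddCoeff, if_pos ((dvd_iff_of_modEq dvd_rfl (hmod i)).2 hb), kronecker_prime_pow _ hp,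
          kroneckerPrime_eq_quadraticChar hp2]
        -- The quadratic term in i keeps a factor p^{2j}, which vanishes modulo p because j > 0.
        have h2 : (((((p ^ j * p ^ j * i + b : ℕ) : ℤ) ^ 2 - 4 * n) / ((p ^ j : ℕ) : ℤ) ^ 2 : ℤ) : ZMod p)
            = (((b : ℤ) ^ 2 - 4 * n) / ((p ^ j : ℕ) : ℤ) ^ 2 : ℤ) + 2 * b * i := by
          obtain ⟨D, hD⟩ := hb
          have h3 : ((p ^ j * p ^ j * i + b : ℕ) : ℤ) ^ 2 - 4 * n
              = ((p ^ j : ℕ) : ℤ) ^ 2 * (D + 2 * b * i + ((p ^ j : ℕ) : ℤ) ^ 2 * i ^ 2) := by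
            push_cast at hD ⊢
            linear_combination hD
          rw [h3, hD, Int.mul_ediv_cancel_left _ hpj, Int.mul_ediv_cancel_left _ hpj]
          push_cast
          simp [hj.ne']
        rw [h2]
        have h4 : (((p ^ j * p ^ j * i + b : ℕ) : ℤ) : ℝ) * ξ / (p * (p ^ j * p ^ j) : ℕ)
            = (b : ℝ) * ξ / (p * (p ^ j * p ^ j) : ℕ) + (i : ℝ) * ξ / p := by
          push_cast; field_simp; ring
        have h5 : ((p ^ j * p ^ j * i + b : ℕ) : ℝ) = (((p ^ j * p ^ j * i + b : ℕ) : ℤ) : ℝ) := by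
          push_cast; rfl
        rw [h5, h4, e_add]
        push_cast
        ring
      · refine Finset.sum_eq_zero fun i _ => ?_
        rw [oddCoeff, if_neg fun h => hb ((dvd_iff_of_modEq dvd_rfl (hmod i)).1 h), zero_mul]
    rw [h1]
    have h2 : ∀ b ∈ A, ‖e ((b : ℝ) * ξ / (p * (p ^ j * p ^ j) : ℕ)) *
          ∑ x : ZMod p, (quadraticChar (ZMod p) ((((b : ℤ) ^ 2 - 4 * n) / ((p ^ j : ℕ) : ℤ) ^ 2 : ℤ)
            + 2 * b * x) : ℂ) ^ k * ψ x‖ ≤ Real.sqrt p := by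
      intro b _
      rw [norm_mul, norm_e, one_mul]
      exact norm_sum_affine_le hp2 hψ _ _ hk
    refine (norm_sum_le_of_le _ h2).trans ?_
    rw [Finset.sum_const, nsmul_eq_mul]
    have h3 : (A.card : ℝ) ≤ p ^ j := by exact_mod_cast card_sqrt_le hp hp2 (4 * n) j
    have h4 : (0 : ℝ) ≤ p ^ j * Real.sqrt p := by positivity
    nlinarith [Real.sqrt_nonneg (p : ℝ)]

theorem int_gcd_mul_of_isCoprime {l : ℕ} {u ξ : ℤ} {m : ℕ} (h : IsCoprime u m) (hlm : l ∣ m) :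
    Int.gcd l (u * ξ) = Int.gcd l ξ := by
  rw [Int.gcd_eq_natAbs, Int.gcd_eq_natAbs, Int.natAbs_mul]
  refine Nat.Coprime.gcd_mul_left_cancel_right _ ?_
  have h1 : IsCoprime u (l : ℤ) := h.of_isCoprime_of_dvd_right (by exact_mod_cast hlm)
  exact Int.isCoprime_iff_gcd_eq_one.1 h1

/-- For k ≥ 1 the period p^{2j+1} leaves only ξ = p^{k-1} d. If p ∣ d, the gcd is p^k and the
trivial bound suffices; if not, it is p^{k-1} and the previous cancellation supplies the missing √p.
-/
theorem norm_expSum_oddCoeff_prime_pow_le {p : ℕ} (hp : p.Prime) (hp2 : p ≠ 2) (n : ℤ) (k j : ℕ)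
    (ξ : ℤ) :
    ‖expSum (p ^ k * (p ^ j * p ^ j)) (oddCoeff n (p ^ k) (p ^ j)) ξ‖
      ≤ (p ^ k).divisors.card * (p ^ j : ℕ) * Real.sqrt (p ^ k : ℕ)
        * Real.sqrt (Int.gcd (p ^ k : ℕ) ξ) := by
  have hcount : ∀ r : ℕ, ∑ a ∈ Finset.range (r * (p ^ j * p ^ j)), ‖oddCoeff n (p ^ k) (p ^ j) a‖
      ≤ r * (p : ℝ) ^ j := by
    intro r
    refine (sum_norm_oddCoeff_le _ _ _ _).trans ?_
    refine mul_le_mul_of_nonneg_left ?_ (Nat.cast_nonneg _)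
    exact_mod_cast card_sqrt_le hp hp2 (4 * n) j
  cases k with
  | zero =>
    refine ((norm_expSum_le _ _ _).trans (hcount _)).trans ?_
    simp
  | succ k =>
    have hpk : 0 < p ^ k := pow_pos hp.pos k
    have hP : 0 < p * (p ^ j * p ^ j) := by have := hp.pos; positivity
    -- The number of divisors of p^{k+1} absorbs the constant 2 of the Weil bound.
    have hcard : (2 : ℝ) ≤ (p ^ (k + 1)).divisors.card := by
      rw [Nat.divisors_prime_pow hp, Finset.card_map, Finset.card_range]
      push_cast; linarith [(Nat.cast_nonneg k : (0 : ℝ) ≤ k)]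
    rw [show p ^ (k + 1) * (p ^ j * p ^ j) = p ^ k * (p * (p ^ j * p ^ j)) by ring,
      expSum_mul_of_periodic hpk hP (g := oddCoeff n (p ^ (k + 1)) (p ^ j))]
    · split_ifs with h
      · obtain ⟨d, rfl⟩ := h
        rw [Int.mul_ediv_cancel_left _ (by exact_mod_cast hpk.ne'), norm_mul, Complex.norm_natCast]
        by_cases hd : (p : ℤ) ∣ d
        · have hgcd : Int.gcd (p ^ (k + 1) : ℕ) ((p ^ k : ℕ) * d) = p ^ (k + 1) := by
            obtain ⟨t, rfl⟩ := hd
            rw [← mul_assoc, show ((p ^ k : ℕ) : ℤ) * p = (p ^ (k + 1) : ℕ) by push_cast; ring]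
            rw [Int.gcd_eq_natAbs, Int.natAbs_mul, Int.natAbs_natCast,
              Nat.gcd_eq_left (Nat.dvd_mul_right _ _)]
          rw [hgcd, mul_assoc, Real.mul_self_sqrt (Nat.cast_nonneg _)]
          have h1 := (norm_expSum_le (p * (p ^ j * p ^ j)) (oddCoeff n (p ^ (k + 1)) (p ^ j)) d).trans
            (hcount p)
          have h2 : (0 : ℝ) ≤ p ^ k * p * p ^ j := by positivity
          push_cast
          calc (p : ℝ) ^ k * ‖expSum (p * (p ^ j * p ^ j)) (oddCoeff n (p ^ (k + 1)) (p ^ j)) d‖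
              ≤ p ^ k * (p * p ^ j) := by gcongr
            _ = 1 * (p ^ k * p * p ^ j) := by ring
            _ ≤ (p ^ (k + 1)).divisors.card * (p ^ k * p * p ^ j) := by gcongr; linarith
            _ = _ := by ring
        · have hgcd : Int.gcd (p ^ (k + 1) : ℕ) ((p ^ k : ℕ) * d) = p ^ k := by
            rw [pow_succ, Nat.cast_mul, Int.gcd_mul_left]
            have : Int.gcd p d = 1 := by
              rw [← Int.isCoprime_iff_gcd_eq_one]
              exact (Prime.coprime_iff_not_dvd (Nat.prime_iff_prime_int.1 hp)).2 hd
            rw [this]; simp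
          rw [hgcd]
          have h1 := expSum_oddCoeff_pow_le hp hp2 n (Nat.succ_ne_zero k) j hd
          have h2 : Real.sqrt (p ^ (k + 1) : ℕ) * Real.sqrt (p ^ k : ℕ) = p ^ k * Real.sqrt p := by
            push_cast
            rw [pow_succ, Real.sqrt_mul (by positivity), mul_right_comm,
              Real.mul_self_sqrt (by positivity)]
          rw [mul_assoc, h2]
          push_cast
          calc (p : ℝ) ^ k * ‖expSum (p * (p ^ j * p ^ j)) (oddCoeff n (p ^ (k + 1)) (p ^ j)) d‖
              ≤ p ^ k * (2 * p ^ j * Real.sqrt p) := by gcongr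
            _ = 2 * (p ^ j * (p ^ k * Real.sqrt p)) := by ring
            _ ≤ (p ^ (k + 1)).divisors.card * (p ^ j * (p ^ k * Real.sqrt p)) := by gcongr
            _ = _ := by ring
      · rw [norm_zero]; positivity
    · intro a b hab
      refine oddCoeff_congr_of_primes (m := p) (fun q hq hqp => ?_) (pow_pos hp.pos j).ne' (fun q hq hqp => ?_)
        (by rwa [show p * (p ^ j) ^ 2 = p * (p ^ j * p ^ j) by ring])
      · rwa [(Nat.prime_dvd_prime_iff_eq hq hp).1 (hq.dvd_of_dvd_pow hqp)]
      · exact hq.dvd_of_dvd_pow hqp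

/-- Induction on l f, splitting off the full power of its least prime; every factor of the bound is
multiplicative. -/
theorem norm_expSum_oddCoeff_le (n : ℤ) (N : ℕ) : ∀ l f : ℕ, l * f = N → Odd N → ∀ ξ : ℤ,
    ‖expSum (l * (f * f)) (oddCoeff n l f) ξ‖
      ≤ l.divisors.card * f * Real.sqrt l * Real.sqrt (Int.gcd l ξ) := by
  induction N using Nat.strong_induction_on with
  | _ N ih =>
    intro l f hN hodd ξ
    rcases eq_or_ne N 1 with rfl | hN1
    · obtain ⟨rfl, rfl⟩ := mul_eq_one.1 hN
      refine (norm_expSum_le _ _ _).trans ?_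
      simpa using norm_oddCoeff_le n 1 1 0
    have hN0 : N ≠ 0 := hodd.pos.ne'
    have hl0 : l ≠ 0 := by rintro rfl; simp at hN; omega
    have hf0 : f ≠ 0 := by rintro rfl; simp at hN; omega
    set p := N.minFac with hpdef
    have hp : p.Prime := Nat.minFac_prime hN1
    have hpN : p ∣ N := Nat.minFac_dvd N
    have hp2 : p ≠ 2 := by
      intro h
      rw [h] at hpN
      exact (Nat.not_even_iff_odd.2 hodd) (even_iff_two_dvd.2 hpN)
    obtain ⟨k, l', hl', rfl⟩ := Nat.exists_eq_pow_mul_and_not_dvd hl0 p hp.ne_one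
    obtain ⟨j, f', hf', rfl⟩ := Nat.exists_eq_pow_mul_and_not_dvd hf0 p hp.ne_one
    have hl'0 : l' ≠ 0 := by rintro rfl; simp at hl'
    have hf'0 : f' ≠ 0 := by rintro rfl; simp at hf'
    have hNeq : p ^ (k + j) * (l' * f') = N := by rw [← hN]; ring
    have hkj : k + j ≠ 0 := by
      intro h0
      rw [h0, pow_zero, one_mul] at hNeq
      rw [← hNeq] at hpN
      rcases hp.dvd_mul.1 hpN with h | h
      · exact hl' h
      · exact hf' h
    have hlt : l' * f' < N := by
      rw [← hNeq]
      exact lt_mul_of_one_lt_left (Nat.pos_of_ne_zero (mul_ne_zero hl'0 hf'0))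
        (Nat.one_lt_pow hkj hp.one_lt)
    have hodd' : Odd (l' * f') := by
      rw [← hNeq] at hodd
      exact (Nat.odd_mul.1 hodd).2
    have hcpl : ∀ i : ℕ, (p ^ i).Coprime l' := fun i => Nat.Coprime.pow_left _ (hp.coprime_iff_not_dvd.2 hl')
    have hcpf : ∀ i : ℕ, (p ^ i).Coprime f' := fun i => Nat.Coprime.pow_left _ (hp.coprime_iff_not_dvd.2 hf')
    have hm1 : 0 < p ^ k * (p ^ j * p ^ j) := by have := hp.pos; positivity
    have hm2 : 0 < l' * (f' * f') := by positivity
    have hcop : (p ^ k * (p ^ j * p ^ j)).Coprime (l' * (f' * f')) := by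
      rw [← pow_add, ← pow_add]
      exact (hcpl _).mul_right ((hcpf _).mul_right (hcpf _))
    have hper : ∀ {l f : ℕ}, Odd l → f ≠ 0 → ∀ a b : ℤ, a ≡ b [ZMOD (l * (f * f) : ℕ)] →
        oddCoeff n l f a = oddCoeff n l f b := by
      intro l f hl hf a b hab
      refine oddCoeff_congr_of_primes (m := l) (fun q hq hql h2 => ?_) hf (fun q _ hql => hql)
        (by rwa [show l * f ^ 2 = l * (f * f) by ring])
      rw [h2] at hql
      exact (Nat.not_even_iff_odd.2 hl) (even_iff_two_dvd.2 hql)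
    have hpodd : Odd (p ^ k) := (hp.odd_of_ne_two hp2).pow
    obtain ⟨u₁, u₂, hu₁, hu₂, hsum⟩ := expSum_mul_of_coprime hm1 hm2 hcop
      (hper hpodd (pow_pos hp.pos j).ne') (hper (Nat.odd_mul.1 hodd').1 hf'0) ξ
    have hfun : oddCoeff n (p ^ k * l') (p ^ j * f')
        = fun a => oddCoeff n (p ^ k) (p ^ j) a * oddCoeff n l' f' a := by
      funext a
      refine oddCoeff_mul n (pow_pos hp.pos k).ne' hl'0 (pow_pos hp.pos j).ne' hf'0 ?_ a
      rw [← pow_add]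
      exact (hcpl _).mul_right (hcpf _)
    rw [show p ^ k * l' * (p ^ j * f' * (p ^ j * f'))
      = (p ^ k * (p ^ j * p ^ j)) * (l' * (f' * f')) by ring, hfun, hsum, norm_mul]
    have h1 := norm_expSum_oddCoeff_prime_pow_le hp hp2 n k j (u₂ * ξ)
    have h2 := ih (l' * f') hlt l' f' rfl hodd' (u₁ * ξ)
    rw [int_gcd_mul_of_isCoprime hu₂ (dvd_mul_right _ _)] at h1
    rw [int_gcd_mul_of_isCoprime hu₁ (dvd_mul_right _ _)] at h2
    refine (mul_le_mul h1 h2 (norm_nonneg _) (by positivity)).trans (le_of_eq ?_)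
    have hgcd : Int.gcd (p ^ k * l' : ℕ) ξ = Int.gcd (p ^ k : ℕ) ξ * Int.gcd l' ξ := by
      simp only [Int.gcd_eq_natAbs, Int.natAbs_natCast]
      rw [Nat.gcd_comm, Nat.Coprime.gcd_mul _ (hcpl k), Nat.gcd_comm, Nat.gcd_comm l']
    rw [hgcd, Nat.Coprime.card_divisors_mul (hcpl k)]
    push_cast
    rw [Real.sqrt_mul (by positivity), Real.sqrt_mul (by positivity)]
    ring

end

section

/-! ### The bound for `Kl` -/

/-- The `2`-part of the coefficient of `Kl`. -/
def evenCoeff (n : ℤ) (k j : ℕ) (a : ℤ) : ℂ :=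
  if ((2 ^ j : ℕ) : ℤ) ^ 2 ∣ a ^ 2 - 4 * n ∧
      ((a ^ 2 - 4 * n) / ((2 ^ j : ℕ) : ℤ) ^ 2 ≡ 0 [ZMOD 4] ∨
        (a ^ 2 - 4 * n) / ((2 ^ j : ℕ) : ℤ) ^ 2 ≡ 1 [ZMOD 4])
  then (kroneckerPrime ((a ^ 2 - 4 * n) / ((2 ^ j : ℕ) : ℤ) ^ 2) 2 ^ k : ℂ) else 0

theorem norm_evenCoeff_le (n : ℤ) (k j : ℕ) (a : ℤ) :
    ‖evenCoeff n k j a‖ ≤ if ((2 ^ j : ℕ) : ℤ) ^ 2 ∣ a ^ 2 - 4 * n then 1 else 0 := by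
  unfold evenCoeff
  by_cases h : ((2 ^ j : ℕ) : ℤ) ^ 2 ∣ a ^ 2 - 4 * n
  · rw [if_pos h]
    split_ifs
    · rw [norm_pow, Complex.norm_intCast]
      exact pow_le_one₀ (abs_nonneg _) (by exact_mod_cast abs_kroneckerPrime_le _ 2)
    · simp
  · rw [if_neg h, if_neg fun h' => h h'.1, norm_zero]

theorem sum_norm_evenCoeff_le (n : ℤ) (k j r : ℕ) :
    ∑ a ∈ Finset.range (r * (2 ^ j * 2 ^ j)), ‖evenCoeff n k j a‖ ≤ r * (2 * 2 ^ j) := by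
  rw [sum_range_mul_eq]
  have h : ∀ i ∈ Finset.range r,
      ∑ b ∈ Finset.range (2 ^ j * 2 ^ j), ‖evenCoeff n k j (2 ^ j * 2 ^ j * i + b : ℕ)‖
        ≤ 2 * 2 ^ j := by
    intro i _
    have h1 : ((((Finset.range (2 ^ j * 2 ^ j)).filter fun a : ℕ =>
        ((2 ^ j : ℕ) : ℤ) ^ 2 ∣ (a : ℤ) ^ 2 - 4 * n).card : ℕ) : ℝ) ≤ 2 * 2 ^ j := by
      exact_mod_cast card_sqrt_le_two_mul Nat.prime_two (4 * n) j
    refine le_trans ?_ h1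
    rw [Finset.card_filter, Nat.cast_sum]
    refine Finset.sum_le_sum fun b _ => ?_
    refine (norm_evenCoeff_le _ _ _ _).trans (le_of_eq ?_)
    have hmod : ((2 ^ j * 2 ^ j * i + b : ℕ) : ℤ) ≡ b [ZMOD ((2 ^ j : ℕ) : ℤ) ^ 2] :=
      Int.modEq_iff_dvd.2 ⟨-i, by push_cast; ring⟩
    simp only [dvd_iff_of_modEq (c := 4 * n) dvd_rfl hmod]
    split_ifs <;> simp
  refine (Finset.sum_le_card_nsmul _ _ _ h).trans ?_
  simp

theorem mod_four_congr {D D' : ℤ} (h : D ≡ D' [ZMOD 4]) :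
    (D ≡ 0 [ZMOD 4] ∨ D ≡ 1 [ZMOD 4]) ↔ (D' ≡ 0 [ZMOD 4] ∨ D' ≡ 1 [ZMOD 4]) := by
  unfold Int.ModEq at *
  omega

theorem evenCoeff_congr_eight {n : ℤ} {k j : ℕ} {a b : ℤ}
    (h : a ≡ b [ZMOD (8 * (2 ^ j * 2 ^ j) : ℕ)]) : evenCoeff n k j a = evenCoeff n k j b := by
  have h0 : ((2 ^ j : ℕ) : ℤ) ^ 2 ≠ 0 := by positivity
  have h : a ≡ b [ZMOD 8 * ((2 ^ j : ℕ) : ℤ) ^ 2] := by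
    push_cast at h ⊢; rwa [sq]
  have h1 := dvd_iff_of_modEq (c := 4 * n) (dvd_mul_left _ _) h
  unfold evenCoeff
  by_cases hd : ((2 ^ j : ℕ) : ℤ) ^ 2 ∣ a ^ 2 - 4 * n
  · have h2 := div_modEq_div h0 h hd
    have h4 := mod_four_congr (h2.of_dvd (by norm_num : (4 : ℤ) ∣ 8))
    simp only [hd, h1.1 hd, true_and, h4, kroneckerPrime_two_congr h2]
  · rw [if_neg fun h' => hd h'.1, if_neg fun h' => hd (h1.2 h'.1)]

/-- With k = 0 the symbol at 2 disappears and only the condition modulo 4 remains. The period 4 is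
needed here, because for odd l the modulus 4lf² leaves no room for 8. -/
theorem evenCoeff_zero_congr {n : ℤ} {j : ℕ} {a b : ℤ}
    (h : a ≡ b [ZMOD (4 * (2 ^ j * 2 ^ j) : ℕ)]) : evenCoeff n 0 j a = evenCoeff n 0 j b := by
  have h0 : ((2 ^ j : ℕ) : ℤ) ^ 2 ≠ 0 := by positivity
  have h : a ≡ b [ZMOD 4 * ((2 ^ j : ℕ) : ℤ) ^ 2] := by
    push_cast at h ⊢; rwa [sq]
  have h1 := dvd_iff_of_modEq (c := 4 * n) (dvd_mul_left _ _) h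
  unfold evenCoeff
  by_cases hd : ((2 ^ j : ℕ) : ℤ) ^ 2 ∣ a ^ 2 - 4 * n
  · have h4 := mod_four_congr (div_modEq_div h0 h hd)
    simp only [hd, h1.1 hd, true_and, h4, pow_zero]
  · rw [if_neg fun h' => hd h'.1, if_neg fun h' => hd (h1.2 h'.1)]

theorem evenCoeff_congr {n : ℤ} {k j : ℕ} {a b : ℤ}
    (h : a ≡ b [ZMOD (4 * 2 ^ k * (2 ^ j * 2 ^ j) : ℕ)]) :
    evenCoeff n k j a = evenCoeff n k j b := by
  cases k with
  | zero => exact evenCoeff_zero_congr (by simpa using h)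
  | succ k =>
    refine evenCoeff_congr_eight (h.of_dvd ?_)
    exact ⟨2 ^ k, by push_cast; ring⟩

/-- No cancellation is needed at 2. There are at most 8 · 2 · 2^j nonzero coefficients in a period,
and for k ≥ 1 the collapse requires 2^{k-1} ∣ ξ, so √(2^k) √gcd pays for the number 2^{k-1} of
periods. -/
theorem norm_expSum_evenCoeff_le (n : ℤ) (k j : ℕ) (ξ : ℤ) :
    ‖expSum (4 * 2 ^ k * (2 ^ j * 2 ^ j)) (evenCoeff n k j) ξ‖
      ≤ 16 * (2 ^ j : ℕ) * Real.sqrt (2 ^ k : ℕ) * Real.sqrt (Int.gcd (2 ^ k : ℕ) ξ) := by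
  cases k with
  | zero =>
    refine ((norm_expSum_le _ _ _).trans (sum_norm_evenCoeff_le _ _ _ _)).trans ?_
    have : (0 : ℝ) < 2 ^ j := by positivity
    simp only [pow_zero, Nat.cast_one, Int.one_gcd, Real.sqrt_one]
    push_cast
    linarith
  | succ k =>
    have h2k : 0 < 2 ^ k := by positivity
    rw [show 4 * 2 ^ (k + 1) * (2 ^ j * 2 ^ j) = 2 ^ k * (8 * (2 ^ j * 2 ^ j)) by ring,
      expSum_mul_of_periodic h2k (by positivity) (fun a b => evenCoeff_congr_eight)]
    split_ifs with h
    · rw [norm_mul, Complex.norm_natCast]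
      have h1 := (norm_expSum_le (8 * (2 ^ j * 2 ^ j)) (evenCoeff n (k + 1) j)
        (ξ / (2 ^ k : ℕ))).trans (sum_norm_evenCoeff_le _ _ _ _)
      have h2 : (2 : ℝ) ^ k ≤ Real.sqrt (2 ^ (k + 1) : ℕ) * Real.sqrt (Int.gcd (2 ^ (k + 1) : ℕ) ξ) := by
        rw [← Real.sqrt_mul (Nat.cast_nonneg _)]
        apply Real.le_sqrt_of_sq_le
        have h3 : 2 ^ k ≤ Int.gcd (2 ^ (k + 1) : ℕ) ξ := by
          refine Nat.le_of_dvd (Int.gcd_pos_of_ne_zero_left _ (by positivity)) ?_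
          exact Int.dvd_gcd (by push_cast; exact pow_dvd_pow _ (by omega)) h
        have h4 : (2 : ℝ) ^ k ≤ (Int.gcd (2 ^ (k + 1) : ℕ) ξ : ℕ) := by exact_mod_cast h3
        have h5 : (2 : ℝ) ^ k ≤ (2 ^ (k + 1) : ℕ) := by
          push_cast
          exact pow_le_pow_right₀ (by norm_num) (by omega)
        rw [sq]
        exact mul_le_mul h5 h4 (by positivity) (by positivity)
      have h3 : (0 : ℝ) < 2 ^ j := by positivity
      rw [mul_assoc (16 * ((2 ^ j : ℕ) : ℝ))]
      push_cast at h1 h2 ⊢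
      calc (2 : ℝ) ^ k * ‖expSum (8 * (2 ^ j * 2 ^ j)) (evenCoeff n (k + 1) j) (ξ / 2 ^ k)‖
          ≤ 2 ^ k * (8 * (2 * 2 ^ j)) := by gcongr
        _ = 16 * 2 ^ j * 2 ^ k := by ring
        _ ≤ _ := by gcongr
    · rw [norm_zero]; positivity

/-- The condition modulo 4 and the symbol at 2 see the odd part of f only through its square, which
is 1 modulo 8; the odd part of l sees the 2-part of f only through a coprime square. -/
theorem Kl_eq_expSum {l f k j : ℕ} (hl : Odd l) (hf : Odd f) (ξ : ℤ) (n : ℕ) :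
    Kl (2 ^ k * l) (2 ^ j * f) ξ n
      = expSum ((4 * 2 ^ k * (2 ^ j * 2 ^ j)) * (l * (f * f)))
          (fun a => evenCoeff n k j a * oddCoeff n l f a) ξ := by
  have hf0 : (f : ℤ) ≠ 0 := by exact_mod_cast hf.pos.ne'
  have h20 : ((2 ^ j : ℕ) : ℤ) ≠ 0 := by positivity
  have hf8 : (f : ℤ) ^ 2 ≡ 1 [ZMOD 8] := by
    have h1 : (f : ℤ) % 2 = 1 := by exact_mod_cast Nat.odd_iff.1 hf
    have h2 : (f : ℤ) % 8 = 1 ∨ (f : ℤ) % 8 = 3 ∨ (f : ℤ) % 8 = 5 ∨ (f : ℤ) % 8 = 7 := by omega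
    have h3 := (Int.mod_modEq (f : ℤ) 8).symm.pow 2
    rcases h2 with h | h | h | h <;> rw [h] at h3 <;> exact h3
  have hcop : IsCoprime ((2 ^ j : ℕ) : ℤ) f :=
    Nat.isCoprime_iff_coprime.2 (Nat.Coprime.pow_left _ (Nat.coprime_two_left.2 hf))
  have hcopl : IsCoprime ((2 ^ j : ℕ) : ℤ) l :=
    Nat.isCoprime_iff_coprime.2 (Nat.Coprime.pow_left _ (Nat.coprime_two_left.2 hl))
  rw [Kl, expSum, Finset.sum_filter]
  rw [show 4 * (2 ^ k * l) * (2 ^ j * f) ^ 2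
    = (4 * 2 ^ k * (2 ^ j * 2 ^ j)) * (l * (f * f)) by ring]
  refine Finset.sum_congr rfl fun a _ => ?_
  have he : (a : ℝ) * ξ / (4 * (((2 ^ k * l : ℕ) : ℝ) * ((2 ^ j * f : ℕ) : ℝ) ^ 2))
      = (a : ℝ) * ξ / (4 * 2 ^ k * (2 ^ j * 2 ^ j) * (l * (f * f)) : ℕ) := by
    congr 1; push_cast; ring
  rw [he]
  unfold evenCoeff oddCoeff
  by_cases h2 : ((2 ^ j : ℕ) : ℤ) ^ 2 ∣ (a : ℤ) ^ 2 - 4 * n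
  · by_cases h1 : (f : ℤ) ^ 2 ∣ (a : ℤ) ^ 2 - 4 * n
    · have h : (((2 ^ j : ℕ) : ℤ) * f) ^ 2 ∣ (a : ℤ) ^ 2 - 4 * n := by
        rw [mul_pow]; exact (hcop.pow (m := 2) (n := 2)).mul_dvd h2 h1
      have e1 := div_mul_sq_eq h20 hf0 h
      have e2 : ((a : ℤ) ^ 2 - 4 * n) / (f : ℤ) ^ 2
          = ((a : ℤ) ^ 2 - 4 * n) / (((2 ^ j : ℕ) : ℤ) * f) ^ 2 * ((2 ^ j : ℕ) : ℤ) ^ 2 := by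
        rw [mul_comm (((2 ^ j : ℕ) : ℤ)) (f : ℤ)] at h ⊢
        exact div_mul_sq_eq hf0 h20 h
      set D := ((a : ℤ) ^ 2 - 4 * n) / (((2 ^ j : ℕ) : ℤ) * f) ^ 2 with hD
      have hmod : D * (f : ℤ) ^ 2 ≡ D [ZMOD 8] := by
        simpa using (Int.ModEq.refl D).mul hf8
      have hcast : (((2 ^ j * f : ℕ) : ℤ)) = ((2 ^ j : ℕ) : ℤ) * f := by push_cast; ring
      have h4 := mod_four_congr (hmod.of_dvd (by norm_num : (4 : ℤ) ∣ 8))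
      rw [hcast, ← hD, e1, e2]
      simp only [h, h2, h1, true_and, h4, if_true]
      split_ifs
      · rw [kronecker_mul _ (by positivity) hl.pos.ne', kronecker_prime_pow _ Nat.prime_two,
          kroneckerPrime_two_congr hmod, kronecker_mul_sq hcopl]
        push_cast
        ring
      · simp
    · have h : ¬ (((2 ^ j * f : ℕ) : ℤ)) ^ 2 ∣ (a : ℤ) ^ 2 - 4 * n := by
        intro h
        refine h1 (dvd_trans ?_ h)
        push_cast; rw [mul_pow]; exact dvd_mul_left _ _
      rw [if_neg fun h' => h h'.1, if_neg h1]; simp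
  · have h : ¬ (((2 ^ j * f : ℕ) : ℤ)) ^ 2 ∣ (a : ℤ) ^ 2 - 4 * n := by
      intro h
      refine h2 (dvd_trans ?_ h)
      push_cast; rw [mul_pow]; exact dvd_mul_right _ _
    rw [if_neg fun h' => h h'.1, if_neg fun h' => h2 h'.1]; simp

theorem norm_Kl_le {l f : ℕ} (hl : l ≠ 0) (hf : f ≠ 0) (ξ : ℤ) (n : ℕ) :
    ‖Kl l f ξ n‖ ≤ 16 * l.divisors.card * f * Real.sqrt l * Real.sqrt (Int.gcd l ξ) := by
  obtain ⟨k, l', hl', rfl⟩ := Nat.exists_eq_pow_mul_and_not_dvd hl 2 (by norm_num)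
  obtain ⟨j, f', hf', rfl⟩ := Nat.exists_eq_pow_mul_and_not_dvd hf 2 (by norm_num)
  have hlo : Odd l' := by rwa [← Nat.not_even_iff_odd, even_iff_two_dvd]
  have hfo : Odd f' := by rwa [← Nat.not_even_iff_odd, even_iff_two_dvd]
  have hcpl : ∀ i : ℕ, (2 ^ i).Coprime l' := fun i =>
    Nat.Coprime.pow_left _ (Nat.coprime_two_left.2 hlo)
  have hcpf : ∀ i : ℕ, (2 ^ i).Coprime f' := fun i =>
    Nat.Coprime.pow_left _ (Nat.coprime_two_left.2 hfo)
  have hm2 : 0 < l' * (f' * f') := by have := hlo.pos; have := hfo.pos; positivity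
  have hcop : (4 * 2 ^ k * (2 ^ j * 2 ^ j)).Coprime (l' * (f' * f')) := by
    rw [show 4 * 2 ^ k * (2 ^ j * 2 ^ j) = 2 ^ (2 + k + (j + j)) by ring]
    exact (hcpl _).mul_right ((hcpf _).mul_right (hcpf _))
  have hper : ∀ a b : ℤ, a ≡ b [ZMOD (l' * (f' * f') : ℕ)] →
      oddCoeff n l' f' a = oddCoeff n l' f' b := by
    intro a b hab
    refine oddCoeff_congr_of_primes (m := l') (fun q hq hql h2 => ?_) hfo.pos.ne'
      (fun q _ hql => hql) (by rwa [show l' * f' ^ 2 = l' * (f' * f') by ring])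
    rw [h2] at hql
    exact hl' hql
  obtain ⟨u₁, u₂, hu₁, hu₂, hsum⟩ := expSum_mul_of_coprime (by positivity) hm2 hcop
    (fun a b => evenCoeff_congr (n := n) (k := k) (j := j)) hper ξ
  rw [Kl_eq_expSum hlo hfo, hsum, norm_mul]
  have h1 := norm_expSum_evenCoeff_le n k j (u₂ * ξ)
  have h2 := norm_expSum_oddCoeff_le n (l' * f') l' f' rfl (hlo.mul hfo) (u₁ * ξ)
  rw [int_gcd_mul_of_isCoprime hu₂ ⟨4 * (2 ^ j * 2 ^ j), by ring⟩] at h1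
  rw [int_gcd_mul_of_isCoprime hu₁ (dvd_mul_right _ _)] at h2
  refine (mul_le_mul h1 h2 (norm_nonneg _) (by positivity)).trans ?_
  have hgcd : Int.gcd (2 ^ k * l' : ℕ) ξ = Int.gcd (2 ^ k : ℕ) ξ * Int.gcd l' ξ := by
    simp only [Int.gcd_eq_natAbs, Int.natAbs_natCast]
    rw [Nat.gcd_comm, Nat.Coprime.gcd_mul _ (hcpl k), Nat.gcd_comm, Nat.gcd_comm l']
  have hd : (1 : ℝ) ≤ (2 ^ k).divisors.card := by
    have : 0 < (2 ^ k).divisors.card := Finset.card_pos.2 ⟨1, by simp⟩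
    exact_mod_cast this
  rw [hgcd, Nat.Coprime.card_divisors_mul (hcpl k)]
  push_cast
  rw [Real.sqrt_mul (by positivity), Real.sqrt_mul (by positivity)]
  have hX : (0 : ℝ) ≤ 16 * l'.divisors.card * (2 ^ j * f') * (Real.sqrt (2 ^ k) * Real.sqrt l')
      * (Real.sqrt (Int.gcd (2 ^ k) ξ) * Real.sqrt (Int.gcd l' ξ)) := by positivity
  nlinarith [mul_le_mul_of_nonneg_right hd hX]

end

section

/-! ### Oscillatory integrals on `[-1, 1]` with algebraic endpoint singularities -/

open MeasureTheory intervalIntegral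

theorem hasDerivAt_exp_neg_I (w x : ℝ) :
    HasDerivAt (fun x : ℝ => Complex.exp (-(Complex.I * w * x)))
      (-(Complex.I * w) * Complex.exp (-(Complex.I * w * x))) x := by
  have h1 : HasDerivAt (fun x : ℝ => -(Complex.I * w * (x : ℂ))) (-(Complex.I * w)) x := by
    have h := (Complex.ofRealCLM.hasDerivAt (x := x)).const_mul (-(Complex.I * (w : ℂ)))
    simpa [neg_mul] using h
  simpa [mul_comm] using h1.cexp

theorem norm_exp_neg_I (w x : ℝ) : ‖Complex.exp (-(Complex.I * w * x))‖ = 1 := by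
  rw [Complex.norm_exp]; simp

theorem continuous_exp_neg_I (w : ℝ) :
    Continuous fun x : ℝ => Complex.exp (-(Complex.I * w * x)) := by fun_prop

/-- Integration by parts against `e^{-iwx}`. -/
theorem norm_integral_mul_exp_le {P P' : ℝ → ℂ} {a b w : ℝ} (hab : a ≤ b) (hw : 0 < w)
    (hP : ∀ x ∈ Set.Icc a b, HasDerivAt P (P' x) x) (hP' : ContinuousOn P' (Set.Icc a b)) :
    ‖∫ x in a..b, P x * Complex.exp (-(Complex.I * w * x))‖
      ≤ (‖P a‖ + ‖P b‖ + ‖∫ x in a..b, P' x * Complex.exp (-(Complex.I * w * x))‖) / w := by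
  have hIw : -(Complex.I * (w : ℂ)) ≠ 0 := by
    simp [hw.ne']
  have hparts := integral_mul_deriv_eq_deriv_mul (a := a) (b := b) (u := P) (u' := P')
    (v := fun x : ℝ => Complex.exp (-(Complex.I * w * x)))
    (v' := fun x : ℝ => -(Complex.I * w) * Complex.exp (-(Complex.I * w * x)))
    (fun x hx => hP x (by rwa [Set.uIcc_of_le hab] at hx))
    (fun x _ => hasDerivAt_exp_neg_I w x)
    (ContinuousOn.intervalIntegrable (by rwa [Set.uIcc_of_le hab]))
    (Continuous.intervalIntegrable (by fun_prop) _ _)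
  have h1 : ∫ x in a..b, P x * (-(Complex.I * w) * Complex.exp (-(Complex.I * w * x)))
      = -(Complex.I * w) * ∫ x in a..b, P x * Complex.exp (-(Complex.I * w * x)) := by
    rw [← intervalIntegral.integral_const_mul]
    congr 1; ext x; ring
  rw [h1] at hparts
  have h2 := congrArg norm hparts
  rw [norm_mul, norm_neg, norm_mul, Complex.norm_I, one_mul, Complex.norm_real, Real.norm_of_nonneg hw.le]
    at h2
  rw [le_div_iff₀ hw, mul_comm, h2]
  refine (norm_sub_le _ _).trans (add_le_add ((norm_sub_le _ _).trans ?_) le_rfl)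
  rw [norm_mul, norm_mul, norm_exp_neg_I, norm_exp_neg_I]
  linarith

theorem one_sub_sq_pos {x : ℝ} (hx : x ∈ Set.Ioo (-1 : ℝ) 1) : 0 < 1 - x ^ 2 := by
  nlinarith [hx.1, hx.2]

theorem hasDerivAt_sqrt_one_sub_sq {x : ℝ} (hx : x ∈ Set.Ioo (-1 : ℝ) 1) :
    HasDerivAt (fun x : ℝ => Real.sqrt (1 - x ^ 2)) (-x / Real.sqrt (1 - x ^ 2)) x := by
  have h := one_sub_sq_pos hx
  have h1 : HasDerivAt (fun x : ℝ => 1 - x ^ 2) (-(2 * x)) x := by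
    simpa using (hasDerivAt_pow 2 x).const_sub 1
  convert h1.sqrt h.ne' using 1
  field_simp

/-- The integrand has antiderivative x / √(1 - x²). -/
theorem integral_one_sub_sq_rpow {b : ℝ} (hb0 : 0 ≤ b) (hb : b < 1) :
    ∫ x in -b..b, 1 / Real.sqrt (1 - x ^ 2) ^ 3 = 2 * b / Real.sqrt (1 - b ^ 2) := by
  have hmem : ∀ x ∈ Set.uIcc (-b) b, x ∈ Set.Ioo (-1 : ℝ) 1 := by
    intro x hx
    rw [Set.uIcc_of_le (by linarith)] at hx
    exact ⟨by linarith [hx.1], by linarith [hx.2]⟩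
  rw [integral_eq_sub_of_hasDerivAt (f := fun x => x / Real.sqrt (1 - x ^ 2))]
  · rw [neg_sq]; ring
  · intro x hx
    have hx := hmem x hx
    have h := one_sub_sq_pos hx
    have hs := Real.sqrt_pos.2 h
    have h2 : Real.sqrt (1 - x ^ 2) ^ 2 = 1 - x ^ 2 := Real.sq_sqrt h.le
    refine ((hasDerivAt_id' x).fun_div (hasDerivAt_sqrt_one_sub_sq hx) hs.ne').congr_deriv ?_
    field_simp
    rw [h2]; ring
  · refine ContinuousOn.intervalIntegrable ?_
    refine ContinuousOn.div continuousOn_const (by fun_prop) fun x hx => ?_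
    exact pow_ne_zero _ (Real.sqrt_pos.2 (one_sub_sq_pos (hmem x hx))).ne'

/-- Cut at distance 1/w from each endpoint. On the end pieces the amplitude is ≪ A w^{-1/2} on
length 1/w; in the middle, two integrations by parts leave boundary terms and an integral of |P''|,
all of the order A w^{-3/2}. -/
theorem norm_oscillatory_integral_le {P P' P'' : ℝ → ℂ} {A w : ℝ} (hw : 0 < w)
    (hP : ∀ x ∈ Set.Ioo (-1 : ℝ) 1, HasDerivAt P (P' x) x)
    (hP' : ∀ x ∈ Set.Ioo (-1 : ℝ) 1, HasDerivAt P' (P'' x) x)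
    (hP'' : ContinuousOn P'' (Set.Ioo (-1) 1))
    (hA : ∀ x ∈ Set.Ioo (-1 : ℝ) 1, ‖P x‖ ≤ A * Real.sqrt (1 - x ^ 2))
    (hA' : ∀ x ∈ Set.Ioo (-1 : ℝ) 1, ‖P' x‖ ≤ A / Real.sqrt (1 - x ^ 2))
    (hA'' : ∀ x ∈ Set.Ioo (-1 : ℝ) 1, ‖P'' x‖ ≤ A / Real.sqrt (1 - x ^ 2) ^ 3) :
    ‖∫ x in (-1 : ℝ)..1, P x * Complex.exp (-(Complex.I * w * x))‖ ≤ 10 * A * w ^ (-(3 / 2) : ℝ) := by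
  have hA0 : 0 ≤ A := by
    have := (norm_nonneg _).trans (hA 0 ⟨by norm_num, by norm_num⟩)
    simpa using this
  set f : ℝ → ℂ := fun x => P x * Complex.exp (-(Complex.I * w * x)) with hf
  have hfn : ∀ x, ‖f x‖ = ‖P x‖ := fun x => by rw [hf]; simp only [norm_mul, norm_exp_neg_I, mul_one]
  have hfA : ∀ x ∈ Set.Ioo (-1 : ℝ) 1, ‖f x‖ ≤ A := by
    intro x hx
    rw [hfn]
    refine (hA x hx).trans (mul_le_of_le_one_right hA0 ?_)
    rw [Real.sqrt_le_one]
    nlinarith [sq_nonneg x]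
  have hint : IntervalIntegrable f volume (-1) 1 := by
    rw [intervalIntegrable_iff_integrableOn_Ioo_of_le (by norm_num)]
    refine IntegrableOn.of_bound (C := A) (by simp) ?_ ?_
    · refine ContinuousOn.aestronglyMeasurable ?_ measurableSet_Ioo
      exact ContinuousOn.mul (fun x hx => (hP x hx).continuousAt.continuousWithinAt)
        (continuous_exp_neg_I w).continuousOn
    · exact (ae_restrict_mem measurableSet_Ioo).mono hfA
  have hnormle : ∀ {a b M : ℝ}, a ≤ b → -1 ≤ a → b ≤ 1 → (∀ x ∈ Set.Ioo a b, ‖f x‖ ≤ M) →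
      ‖∫ x in a..b, f x‖ ≤ M * (b - a) := by
    intro a b M hab _ _ hM
    rw [intervalIntegral.integral_of_le hab, integral_Ioc_eq_integral_Ioo]
    refine (norm_setIntegral_le_of_norm_le_const (by simp) hM).trans ?_
    simp [hab, Measure.real]
  have hw32 : w ^ (-(3 / 2) : ℝ) = 1 / (w * Real.sqrt w) := by
    rw [Real.rpow_neg hw.le, one_div, show (3 / 2 : ℝ) = 1 + 1 / 2 by norm_num, Real.rpow_add hw,
      Real.rpow_one, Real.sqrt_eq_rpow]
  -- For w < 2 there is no room to cut, and the trivial bound 2A is already of the right size.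
  rcases lt_or_ge w 2 with hw2 | hw2
  · have h1 := hnormle (by norm_num) le_rfl le_rfl hfA
    refine h1.trans ?_
    have h2 : w * Real.sqrt w ≤ 4 := by
      have : Real.sqrt w ≤ 2 := by
        rw [Real.sqrt_le_left (by norm_num)]; linarith
      nlinarith [Real.sqrt_nonneg w]
    have h3 : 1 / 4 ≤ w ^ (-(3 / 2) : ℝ) := by
      rw [hw32]
      exact one_div_le_one_div_of_le (mul_pos hw (Real.sqrt_pos.2 hw)) h2
    nlinarith
  set η := 1 / w with hη
  have hη0 : 0 < η := by positivity
  have hη2 : η ≤ 1 / 2 := one_div_le_one_div_of_le (by norm_num) hw2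
  set b := 1 - η with hb
  have hsw : Real.sqrt w * Real.sqrt w = w := Real.mul_self_sqrt hw.le
  have hsw0 : 0 < Real.sqrt w := Real.sqrt_pos.2 hw
  have hsη : Real.sqrt η = 1 / Real.sqrt w := by rw [hη, Real.sqrt_div zero_le_one, Real.sqrt_one]
  have hbsq : 1 - b ^ 2 = η * (2 - η) := by rw [hb]; ring
  have hs_le : ∀ x, 1 - x ^ 2 ≤ 2 * η → Real.sqrt (1 - x ^ 2) ≤ 3 / 2 / Real.sqrt w := by
    intro x hx
    have : 3 / 2 / Real.sqrt w = 3 / 2 * Real.sqrt η := by rw [hsη]; ring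
    rw [this]
    refine Real.sqrt_le_iff.2 ⟨by positivity, ?_⟩
    rw [mul_pow, Real.sq_sqrt hη0.le]
    linarith
  have hs_ge : 1 / Real.sqrt w ≤ Real.sqrt (1 - b ^ 2) := by
    rw [← hsη]
    refine Real.sqrt_le_sqrt ?_
    rw [hbsq]; nlinarith
  have hbmem : ∀ x ∈ Set.Icc (-b) b, x ∈ Set.Ioo (-1 : ℝ) 1 := fun x hx =>
    ⟨by linarith [hx.1], by linarith [hx.2]⟩
  have hb0 : 0 ≤ b := by linarith
  have hbI : b ∈ Set.Icc (-b) b := ⟨by linarith, le_rfl⟩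
  have hbI' : -b ∈ Set.Icc (-b) b := ⟨le_rfl, by linarith⟩
  set W := 1 / (w * Real.sqrt w) with hW
  have hη_eq : A * (3 / 2 / Real.sqrt w) * η = 3 / 2 * (A * W) := by
    rw [hη, hW]; field_simp
  -- the endpoints
  have hright : ‖∫ x in b..1, f x‖ ≤ 3 / 2 * (A * W) := by
    rw [← hη_eq]
    have h := hnormle (a := b) (b := 1) (M := A * (3 / 2 / Real.sqrt w)) (by linarith) (by linarith)
      le_rfl (fun x hx => by
        rw [hfn]
        refine (hA x ⟨by linarith [hx.1], hx.2⟩).trans (mul_le_mul_of_nonneg_left ?_ hA0)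
        exact hs_le x (by nlinarith [hx.1, hx.2]))
    rwa [show 1 - b = η by rw [hb]; ring] at h
  have hleft : ‖∫ x in (-1 : ℝ)..-b, f x‖ ≤ 3 / 2 * (A * W) := by
    rw [← hη_eq]
    have h := hnormle (a := -1) (b := -b) (M := A * (3 / 2 / Real.sqrt w)) (by linarith) le_rfl
      (by linarith) (fun x hx => by
        rw [hfn]
        refine (hA x ⟨hx.1, by linarith [hx.2]⟩).trans (mul_le_mul_of_nonneg_left ?_ hA0)
        exact hs_le x (by nlinarith [hx.1, hx.2]))
    rwa [show -b - -1 = η by rw [hb]; ring] at h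
  -- the middle
  have hsb := hs_le b (by rw [hbsq]; nlinarith)
  have hmid : ‖∫ x in -b..b, f x‖ ≤ 7 * (A * W) := by
    have h1 := norm_integral_mul_exp_le (by linarith : -b ≤ b) hw (fun x hx => hP x (hbmem x hx))
      (fun x hx => (hP' x (hbmem x hx)).continuousAt.continuousWithinAt)
    have h2 := norm_integral_mul_exp_le (by linarith : -b ≤ b) hw (fun x hx => hP' x (hbmem x hx))
      (hP''.mono hbmem)
    have h3 : ‖∫ x in -b..b, P'' x * Complex.exp (-(Complex.I * w * x))‖ ≤ A * (2 * Real.sqrt w) := by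
      have h4 : ‖∫ x in -b..b, P'' x * Complex.exp (-(Complex.I * w * x))‖
          ≤ ∫ x in -b..b, A * (1 / Real.sqrt (1 - x ^ 2) ^ 3) := by
        refine norm_integral_le_of_norm_le (by linarith) (Filter.Eventually.of_forall fun x hx => ?_) ?_
        · rw [norm_mul, norm_exp_neg_I, mul_one, mul_one_div]
          exact hA'' x (hbmem x ⟨hx.1.le, hx.2⟩)
        · refine ContinuousOn.intervalIntegrable ?_
          rw [Set.uIcc_of_le (by linarith)]
          refine continuousOn_const.mul (ContinuousOn.div continuousOn_const (by fun_prop) fun x hx => ?_)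
          exact pow_ne_zero _ (Real.sqrt_pos.2 (one_sub_sq_pos (hbmem x hx))).ne'
      refine h4.trans ?_
      rw [intervalIntegral.integral_const_mul, integral_one_sub_sq_rpow hb0 (by linarith)]
      refine mul_le_mul_of_nonneg_left ?_ hA0
      have h5 : 0 < Real.sqrt (1 - b ^ 2) := lt_of_lt_of_le (by positivity) hs_ge
      rw [div_le_iff₀ h5]
      have h6 : 1 ≤ Real.sqrt w * Real.sqrt (1 - b ^ 2) := by
        rwa [div_le_iff₀ hsw0, mul_comm] at hs_ge
      nlinarith
    have hPb : ∀ x ∈ Set.Icc (-b) b, x ^ 2 = b ^ 2 → ‖P x‖ ≤ A * (3 / 2 / Real.sqrt w) := by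
      intro x hx hxb
      refine (hA x (hbmem x hx)).trans (mul_le_mul_of_nonneg_left ?_ hA0)
      rw [hxb]; exact hsb
    have hPb' : ∀ x ∈ Set.Icc (-b) b, x ^ 2 = b ^ 2 → ‖P' x‖ ≤ A * Real.sqrt w := by
      intro x hx hxb
      refine (hA' x (hbmem x hx)).trans ?_
      rw [hxb, div_le_iff₀ (lt_of_lt_of_le (by positivity) hs_ge), mul_assoc]
      refine le_mul_of_one_le_right hA0 ?_
      rwa [div_le_iff₀ hsw0, mul_comm] at hs_ge
    have e1 := hPb b hbI rfl
    have e2 := hPb (-b) hbI' (neg_sq b)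
    have e3 := hPb' b hbI rfl
    have e4 := hPb' (-b) hbI' (neg_sq b)
    refine h1.trans ?_
    have h5 : ‖∫ x in -b..b, P' x * Complex.exp (-(Complex.I * w * x))‖ ≤ 4 * (A * (1 / Real.sqrt w)) := by
      refine h2.trans ?_
      rw [div_le_iff₀ hw]
      have : 4 * (A * (1 / Real.sqrt w)) * w = 4 * (A * Real.sqrt w) := by
        nth_rewrite 2 [← hsw]; field_simp
      rw [this]
      linarith
    rw [div_le_iff₀ hw]
    have : 7 * (A * W) * w = 7 * (A * (1 / Real.sqrt w)) := by rw [hW]; field_simp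
    rw [this]
    have e5 : A * (3 / 2 / Real.sqrt w) = 3 / 2 * (A * (1 / Real.sqrt w)) := by ring
    linarith
  have hsub : ∀ {c d : ℝ}, -1 ≤ c → c ≤ d → d ≤ 1 → IntervalIntegrable f volume c d := by
    intro c d hc hcd hd
    refine hint.mono_set ?_
    rw [Set.uIcc_of_le hcd, Set.uIcc_of_le (by norm_num)]
    exact Set.Icc_subset_Icc hc hd
  have hsplit : ∫ x in (-1 : ℝ)..1, f x
      = (∫ x in (-1 : ℝ)..-b, f x) + (∫ x in -b..b, f x) + ∫ x in b..1, f x := by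
    rw [integral_add_adjacent_intervals (hsub le_rfl (by linarith) (by linarith))
      (hsub (by linarith) (by linarith) (by linarith)),
      integral_add_adjacent_intervals (hsub le_rfl (by linarith) (by linarith))
      (hsub (by linarith) (by linarith) le_rfl)]
  rw [hsplit, hw32]
  refine (norm_add₃_le).trans ?_
  have : 10 * A * W = 10 * (A * W) := by ring
  rw [this]
  linarith

end

section

/-! ### The amplitude `θ_∞(x) g(√(1 - x²))` -/

open MeasureTheory

open Polynomial in
-- Chebyshev recursion: multiply A + isB by x + is and replace s² by 1 - x².
theorem exists_pow_add_I_mul_eq (m : ℕ) : ∃ A B : ℝ[X], ∀ x s : ℝ, s ^ 2 = 1 - x ^ 2 →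
    ((x : ℂ) + Complex.I * s) ^ m = (A.eval x : ℝ) + Complex.I * s * (B.eval x : ℝ) := by
  induction m with
  | zero => exact ⟨1, 0, fun x s _ => by simp⟩
  | succ m ih =>
    obtain ⟨A, B, h⟩ := ih
    refine ⟨X * A - (1 - X ^ 2) * B, A + X * B, fun x s hs => ?_⟩
    have hs' : (s : ℂ) ^ 2 = 1 - (x : ℂ) ^ 2 := by exact_mod_cast hs
    rw [pow_succ, h x s hs]
    simp only [eval_sub, eval_mul, eval_X, eval_one, eval_pow, eval_add]
    push_cast
    linear_combination (-((B.eval x : ℝ) : ℂ)) * hs' + (s : ℂ) ^ 2 * ((B.eval x : ℝ) : ℂ) * Complex.I_sq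

open Polynomial in
/-- `θ_∞` is `√(1 - x²)` times a polynomial. -/
theorem exists_thetaInf_eq (k : ℕ) : ∃ B : ℝ[X], ∀ x ∈ Set.Ioo (-1 : ℝ) 1,
    thetaInf k x = (B.eval x : ℝ) * (Real.sqrt (1 - x ^ 2) : ℝ) := by
  obtain ⟨A, B, h⟩ := exists_pow_add_I_mul_eq (k - 1)
  refine ⟨C (-(1 / Real.pi)) * B, fun x hx => ?_⟩
  have hs := Real.sq_sqrt (one_sub_sq_pos hx).le
  have h1 := h x _ hs
  -- The sign of s changes only the odd part, so the difference in `thetaInf` isolates s B(x).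
  have h2 := h x (-Real.sqrt (1 - x ^ 2)) (by rw [neg_sq, hs])
  have h3 : (x : ℂ) - Complex.I * (Real.sqrt (1 - x ^ 2) : ℂ)
      = x + Complex.I * ((-Real.sqrt (1 - x ^ 2) : ℝ) : ℂ) := by push_cast; ring
  have hπ : (Real.pi : ℂ) ≠ 0 := by exact_mod_cast Real.pi_ne_zero
  rw [thetaInf, if_pos (abs_lt.2 hx), h3, h1, h2]
  simp only [eval_mul, eval_C]
  push_cast
  field_simp
  linear_combination (2 * (Real.sqrt (1 - x ^ 2) : ℂ) * ((B.eval x : ℝ) : ℂ)) * Complex.I_sq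

open Polynomial in
theorem exists_polynomial_bound (B : ℝ[X]) : ∃ K : ℝ, 0 ≤ K ∧ ∀ x ∈ Set.Ioo (-1 : ℝ) 1,
    |B.eval x| ≤ K ∧ |B.derivative.eval x| ≤ K ∧ |B.derivative.derivative.eval x| ≤ K := by
  have key : ∀ B : ℝ[X], ∃ K : ℝ, ∀ x ∈ Set.Icc (-1 : ℝ) 1, |B.eval x| ≤ K := fun B =>
    (isCompact_Icc.exists_bound_of_continuousOn (f := fun x => B.eval x) B.continuous.continuousOn)
  obtain ⟨K₀, h₀⟩ := key B
  obtain ⟨K₁, h₁⟩ := key B.derivative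
  obtain ⟨K₂, h₂⟩ := key B.derivative.derivative
  have hp : 0 ≤ K₀ := (abs_nonneg _).trans (h₀ 0 ⟨by norm_num, by norm_num⟩)
  refine ⟨max K₀ (max K₁ K₂), hp.trans (le_max_left _ _), fun x hx => ?_⟩
  have hx' := Set.Ioo_subset_Icc_self hx
  exact ⟨(h₀ x hx').trans (le_max_left _ _),
    (h₁ x hx').trans ((le_max_left _ _).trans (le_max_right _ _)),
    (h₂ x hx').trans ((le_max_right _ _).trans (le_max_right _ _))⟩

open Polynomial in
/-- An oscillatory integral whose amplitude is a polynomial times a function of `√(1 - x²)` that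
vanishes to first order at `0`. -/
theorem norm_oscillatory_integral_sqrt_le {B : ℝ[X]} {K A w : ℝ} {g g' g'' : ℝ → ℂ} (hw : 0 < w)
    (hK : ∀ x ∈ Set.Ioo (-1 : ℝ) 1,
      |B.eval x| ≤ K ∧ |B.derivative.eval x| ≤ K ∧ |B.derivative.derivative.eval x| ≤ K)
    (hg : ∀ s, 0 < s → HasDerivAt g (g' s) s) (hg' : ∀ s, 0 < s → HasDerivAt g' (g'' s) s)
    (hg'' : ContinuousOn g'' (Set.Ioi 0))
    (h : ∀ s, 0 < s → s ≤ 1 → ‖g s‖ ≤ A * s) (h' : ∀ s, 0 < s → s ≤ 1 → ‖g' s‖ ≤ A)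
    (h'' : ∀ s, 0 < s → s ≤ 1 → ‖g'' s‖ ≤ A / s) :
    ‖∫ x in (-1 : ℝ)..1, ((B.eval x : ℝ) : ℂ) * g (Real.sqrt (1 - x ^ 2))
        * Complex.exp (-(Complex.I * w * x))‖ ≤ 50 * (K * A) * w ^ (-(3 / 2) : ℝ) := by
  have hA : 0 ≤ A := (norm_nonneg _).trans (h' 1 one_pos le_rfl)
  have hK0 : 0 ≤ K := (abs_nonneg _).trans (hK 0 ⟨by norm_num, by norm_num⟩).1
  have hB : ∀ (B : ℝ[X]) (x : ℝ),
      HasDerivAt (fun x : ℝ => ((B.eval x : ℝ) : ℂ)) ((B.derivative.eval x : ℝ) : ℂ) x :=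
    fun B x => (B.hasDerivAt x).ofReal_comp
  set σ : ℝ → ℝ := fun x => Real.sqrt (1 - x ^ 2) with hσ
  have hσ0 : ∀ x ∈ Set.Ioo (-1 : ℝ) 1, 0 < σ x := fun x hx => Real.sqrt_pos.2 (one_sub_sq_pos hx)
  have hσ1 : ∀ x, σ x ≤ 1 := fun x => by
    rw [hσ]; simp only; rw [Real.sqrt_le_one]; nlinarith [sq_nonneg x]
  have hσsq : ∀ x ∈ Set.Ioo (-1 : ℝ) 1, σ x ^ 2 = 1 - x ^ 2 := fun x hx =>
    Real.sq_sqrt (one_sub_sq_pos hx).le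
  have hσd : ∀ x ∈ Set.Ioo (-1 : ℝ) 1, HasDerivAt σ (-x / σ x) x := fun x hx =>
    hasDerivAt_sqrt_one_sub_sq hx
  have hσd2 : ∀ x ∈ Set.Ioo (-1 : ℝ) 1, HasDerivAt (fun x => -x / σ x) (-(1 / σ x ^ 3)) x := by
    intro x hx
    have hs := hσ0 x hx
    refine ((hasDerivAt_id' x).fun_neg.fun_div (hσd x hx) hs.ne').congr_deriv ?_
    field_simp
    rw [hσsq x hx]; ring
  have hσc : ContinuousOn σ (Set.Ioo (-1) 1) := fun x hx =>
    (hσd x hx).continuousAt.continuousWithinAt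
  have hg0c : ContinuousOn g (Set.Ioi 0) := fun s hs => (hg s hs).continuousAt.continuousWithinAt
  have hg1c : ContinuousOn g' (Set.Ioi 0) := fun s hs => (hg' s hs).continuousAt.continuousWithinAt
  have hBc : ∀ B : ℝ[X], ContinuousOn (fun x : ℝ => ((B.eval x : ℝ) : ℂ)) (Set.Ioo (-1) 1) :=
    fun B x _ => (hB B x).continuousAt.continuousWithinAt
  have hdc : ContinuousOn (fun x => ((-x / σ x : ℝ) : ℂ)) (Set.Ioo (-1) 1) := fun x hx =>
    ((hσd2 x hx).ofReal_comp).continuousAt.continuousWithinAt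
  have hd2c : ContinuousOn (fun x => ((-(1 / σ x ^ 3) : ℝ) : ℂ)) (Set.Ioo (-1) 1) :=
    Complex.continuous_ofReal.comp_continuousOn
      (continuousOn_const.div (hσc.pow 3) fun x hx => (pow_pos (hσ0 x hx) 3).ne').neg
  -- With σ' = -x/σ and σ'' = -1/σ³, the terms of P'' amount to at most five multiples of KA/σ³,
  -- since σ ≤ 1.
  refine (norm_oscillatory_integral_le (A := 5 * (K * A))
    (P := fun x => ((B.eval x : ℝ) : ℂ) * g (σ x))
    (P' := fun x => ((B.derivative.eval x : ℝ) : ℂ) * g (σ x)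
      + ((B.eval x : ℝ) : ℂ) * (((-x / σ x : ℝ) : ℂ) * g' (σ x)))
    (P'' := fun x => (((B.derivative.derivative.eval x : ℝ) : ℂ) * g (σ x)
      + ((B.derivative.eval x : ℝ) : ℂ) * (((-x / σ x : ℝ) : ℂ) * g' (σ x)))
      + (((B.derivative.eval x : ℝ) : ℂ) * (((-x / σ x : ℝ) : ℂ) * g' (σ x))
        + ((B.eval x : ℝ) : ℂ) * (((-(1 / σ x ^ 3) : ℝ) : ℂ) * g' (σ x)
          + ((-x / σ x : ℝ) : ℂ) * (((-x / σ x : ℝ) : ℂ) * g'' (σ x)))))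
    hw ?_ ?_ ?_ ?_ ?_ ?_).trans (le_of_eq (by ring))
  · intro x hx
    exact (hB B x).mul (by
      simpa [Function.comp_def] using (hg _ (hσ0 x hx)).scomp x (hσd x hx))
  · intro x hx
    have e0 : HasDerivAt (fun x => g (σ x)) (((-x / σ x : ℝ) : ℂ) * g' (σ x)) x := by
      simpa [Function.comp_def] using (hg _ (hσ0 x hx)).scomp x (hσd x hx)
    have e1 : HasDerivAt (fun x => g' (σ x)) (((-x / σ x : ℝ) : ℂ) * g'' (σ x)) x := by
      simpa [Function.comp_def] using (hg' _ (hσ0 x hx)).scomp x (hσd x hx)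
    exact ((hB _ x).mul e0).add ((hB _ x).mul ((hσd2 x hx).ofReal_comp.mul e1))
  · have m0 : Set.MapsTo σ (Set.Ioo (-1) 1) (Set.Ioi 0) := hσ0
    have c0 := hg0c.comp hσc m0
    have c1 := hg1c.comp hσc m0
    have c2 := hg''.comp hσc m0
    exact (((hBc _).mul c0).add ((hBc _).mul (hdc.mul c1))).add
      (((hBc _).mul (hdc.mul c1)).add ((hBc _).mul ((hd2c.mul c1).add (hdc.mul (hdc.mul c2)))))
  all_goals
    intro x hx
    have hs := hσ0 x hx
    have hs1 := hσ1 x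
    obtain ⟨b0, b1, b2⟩ := hK x hx
    have a0 := h _ hs hs1
    have a1 := h' _ hs hs1
    have a2 := h'' _ hs hs1
    have hx1 : |x| ≤ 1 := (abs_lt.2 hx).le
    have nd : ‖((-x / σ x : ℝ) : ℂ)‖ ≤ 1 / σ x := by
      rw [Complex.norm_real, Real.norm_eq_abs, abs_div, abs_neg, abs_of_pos hs]
      gcongr
    have nd2 : ‖((-(1 / σ x ^ 3) : ℝ) : ℂ)‖ ≤ 1 / σ x ^ 3 := by
      rw [Complex.norm_real, Real.norm_eq_abs, abs_neg, abs_of_pos (by positivity)]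
    have n0 : ‖((B.eval x : ℝ) : ℂ)‖ ≤ K := by rwa [Complex.norm_real]
    have n1 : ‖((B.derivative.eval x : ℝ) : ℂ)‖ ≤ K := by rwa [Complex.norm_real]
    have n2 : ‖((B.derivative.derivative.eval x : ℝ) : ℂ)‖ ≤ K := by rwa [Complex.norm_real]
    have hKA : 0 ≤ K * A := mul_nonneg hK0 hA
    have e : ∀ {u v : ℂ} {a b : ℝ}, 0 ≤ a → ‖u‖ ≤ a → ‖v‖ ≤ b → ‖u * v‖ ≤ a * b :=
      fun ha hu hv => by rw [norm_mul]; exact mul_le_mul hu hv (norm_nonneg _) ha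
    have i1 : 0 ≤ 1 / σ x := by positivity
    have i3 : 0 ≤ 1 / σ x ^ 3 := by positivity
    have j0 : σ x ≤ 1 / σ x := by rw [le_div_iff₀ hs]; nlinarith
    have j1 : 1 / σ x ≤ 1 / σ x ^ 3 :=
      one_div_le_one_div_of_le (by positivity) (pow_le_of_le_one hs.le hs1 (by norm_num))
  · refine (e hK0 n0 a0).trans ?_
    change _ ≤ 5 * (K * A) * σ x
    nlinarith [mul_nonneg hKA hs.le]
  · refine (norm_add_le _ _).trans ((add_le_add (e hK0 n1 a0) (e hK0 n0 (e i1 nd a1))).trans ?_)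
    change _ ≤ 5 * (K * A) / σ x
    have : 5 * (K * A) / σ x = 5 * ((K * A) * (1 / σ x)) := by ring
    rw [this]
    nlinarith [mul_le_mul_of_nonneg_left j0 hKA, mul_nonneg hKA i1]
  · have t1 := e hK0 n2 a0
    have t2 := e hK0 n1 (e i1 nd a1)
    have t3 := e hK0 n0 ((norm_add_le _ _).trans (add_le_add (e i3 nd2 a1) (e i1 nd (e i1 nd a2))))
    refine (norm_add_le _ _).trans ((add_le_add ((norm_add_le _ _).trans (add_le_add t1 t2))
      ((norm_add_le _ _).trans (add_le_add t2 t3))).trans ?_)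
    change _ ≤ 5 * (K * A) / σ x ^ 3
    have e1 : 5 * (K * A) / σ x ^ 3 = 5 * ((K * A) * (1 / σ x ^ 3)) := by ring
    have e2 : K * (1 / σ x ^ 3 * A + 1 / σ x * (1 / σ x * (A / σ x)))
        = 2 * ((K * A) * (1 / σ x ^ 3)) := by field_simp; ring
    rw [e1, e2]
    nlinarith [mul_le_mul_of_nonneg_left (j0.trans j1) hKA, mul_le_mul_of_nonneg_left j1 hKA]

end

section

/-! ### The cutoff function `F` -/

open MeasureTheory

/-- `exp (-y - 1/y)`. -/
def expNegAddInv (y : ℝ) : ℝ := Real.exp (-y - 1 / y)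

theorem expNegAddInv_pos (y : ℝ) : 0 < expNegAddInv y := Real.exp_pos _

theorem expNegAddInv_inv (y : ℝ) : expNegAddInv y⁻¹ = expNegAddInv y := by
  unfold expNegAddInv; congr 1; simp; ring

theorem expNegAddInv_le_exp {y : ℝ} (hy : 0 < y) : expNegAddInv y ≤ Real.exp (-y) :=
  Real.exp_le_exp.2 (by have : 0 < 1 / y := by positivity
                        linarith)

theorem expNegAddInv_le_one {y : ℝ} (hy : 0 < y) : expNegAddInv y ≤ 1 :=
  (expNegAddInv_le_exp hy).trans (Real.exp_le_one_iff.2 (by linarith))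

/-- Uses exp(-1/y) ≤ y: the essential singularity at 0 cancels the pole. -/
theorem expNegAddInv_div_le {y : ℝ} (hy : 0 < y) : expNegAddInv y / y ≤ Real.exp (-y) := by
  rw [div_le_iff₀ hy]
  have h1 : expNegAddInv y = Real.exp (-y) * Real.exp (-(1 / y)) := by
    rw [expNegAddInv, ← Real.exp_add]; congr 1
  rw [h1]
  refine mul_le_mul_of_nonneg_left ?_ (Real.exp_pos _).le
  rw [Real.exp_neg]
  have h2 : 1 / y ≤ Real.exp (1 / y) := by linarith [Real.add_one_le_exp (1 / y)]
  calc (Real.exp (1 / y))⁻¹ ≤ (1 / y)⁻¹ := inv_anti₀ (by positivity) h2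
    _ = y := by simp

theorem mul_expNegAddInv_le_one {y : ℝ} (hy : 0 < y) : y * expNegAddInv y ≤ 1 := by
  have h := expNegAddInv_div_le (inv_pos.2 hy)
  rw [expNegAddInv_inv, div_inv_eq_mul, mul_comm] at h
  exact h.trans (Real.exp_le_one_iff.2 (by have := inv_pos.2 hy; linarith))

theorem hasDerivAt_expNegAddInv {y : ℝ} (hy : 0 < y) :
    HasDerivAt expNegAddInv (expNegAddInv y * (-1 + 1 / y ^ 2)) y := by
  have h1 : HasDerivAt (fun y : ℝ => -y - 1 / y) (-1 + 1 / y ^ 2) y := by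
    simp only [one_div]
    refine ((hasDerivAt_id' y).fun_neg.fun_sub (hasDerivAt_inv hy.ne')).congr_deriv ?_
    ring
  exact h1.exp

theorem continuousOn_expNegAddInv : ContinuousOn expNegAddInv (Set.Ioi 0) := fun _ hy =>
  (hasDerivAt_expNegAddInv hy).continuousAt.continuousWithinAt

theorem integrableOn_expNegAddInv_div :
    IntegrableOn (fun y => expNegAddInv y / y) (Set.Ioi 0) := by
  refine Integrable.mono' (integrableOn_exp_neg_Ioi 0) ?_ ?_
  · exact (continuousOn_expNegAddInv.div continuousOn_id fun y hy => (Set.mem_Ioi.1 hy).ne').aestronglyMeasurable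
      measurableSet_Ioi
  · refine (ae_restrict_mem measurableSet_Ioi).mono fun y hy => ?_
    have hy : 0 < y := hy
    rw [Real.norm_of_nonneg (div_pos (expNegAddInv_pos y) hy).le]
    exact expNegAddInv_div_le hy

/-- The normalising constant of `F`. -/
def normF : ℝ := 1 / (2 * besselK0 2)

theorem F_eq (x : ℝ) : F x = normF * ∫ y in Set.Ioi x, expNegAddInv y / y := rfl

theorem abs_F_le {x : ℝ} (hx : 0 ≤ x) : |F x| ≤ |normF| * Real.exp (-x) := by
  rw [F_eq, abs_mul]
  refine mul_le_mul_of_nonneg_left ?_ (abs_nonneg _)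
  have hsub : Set.Ioi x ⊆ Set.Ioi 0 := Set.Ioi_subset_Ioi hx
  have hn : 0 ≤ ∫ y in Set.Ioi x, expNegAddInv y / y :=
    setIntegral_nonneg measurableSet_Ioi fun y hy =>
      (div_pos (expNegAddInv_pos y) (hsub hy)).le
  rw [abs_of_nonneg hn, ← integral_exp_neg_Ioi x]
  exact setIntegral_mono_on (integrableOn_expNegAddInv_div.mono_set hsub)
    (integrableOn_exp_neg_Ioi x) measurableSet_Ioi fun y hy => expNegAddInv_div_le (hsub hy)

theorem abs_F_le_normF {x : ℝ} (hx : 0 ≤ x) : |F x| ≤ |normF| :=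
  (abs_F_le hx).trans (mul_le_of_le_one_right (abs_nonneg _) (Real.exp_le_one_iff.2 (by linarith)))

theorem hasDerivAt_F {x : ℝ} (hx : 0 < x) :
    HasDerivAt F (-(normF * (expNegAddInv x / x))) x := by
  have hint := integrableOn_expNegAddInv_div
  have hc : ∀ y ∈ Set.Ioi (0 : ℝ), ContinuousAt (fun y => expNegAddInv y / y) y := fun y hy =>
    (hasDerivAt_expNegAddInv hy).continuousAt.div continuousAt_id (Set.mem_Ioi.1 hy).ne'
  have h1 : HasDerivAt (fun u => ∫ y in (0 : ℝ)..u, expNegAddInv y / y) (expNegAddInv x / x) x := by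
    refine intervalIntegral.integral_hasDerivAt_right ?_ ?_ (hc x hx)
    · rw [intervalIntegrable_iff_integrableOn_Ioc_of_le hx.le]
      exact hint.mono_set Set.Ioc_subset_Ioi_self
    · exact ContinuousOn.stronglyMeasurableAtFilter isOpen_Ioi
        (fun y hy => (hc y hy).continuousWithinAt) x hx
  have h2 := (h1.const_sub (∫ y in Set.Ioi (0 : ℝ), expNegAddInv y / y)).const_mul normF
  refine (h2.congr_of_eventuallyEq ?_).congr_deriv (by ring)
  filter_upwards [Ioi_mem_nhds hx] with u hu
  have hu : 0 < u := hu
  rw [F_eq, intervalIntegral.integral_of_le hu.le]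
  congr 1
  rw [eq_sub_iff_add_eq, add_comm, ← setIntegral_union Set.Ioc_disjoint_Ioi_same measurableSet_Ioi
    (hint.mono_set Set.Ioc_subset_Ioi_self) (hint.mono_set (Set.Ioi_subset_Ioi hu.le)),
    Set.Ioc_union_Ioi_eq_Ioi hu.le]

theorem continuousOn_F : ContinuousOn F (Set.Ioi 0) := fun _ hy =>
  (hasDerivAt_F hy).continuousAt.continuousWithinAt

open Polynomial in
-- The amplitude is s F(δ/s). With y = δ/s and E = `expNegAddInv`, its first two derivatives involve
-- only F(y), E(y), yE(y) and E(y)/y, all bounded; so the estimate is uniform in δ.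
theorem norm_oscillatory_integral_F_le {B : ℝ[X]} {K w δ : ℝ} (hw : 0 < w) (hδ : 0 < δ)
    (hK : ∀ x ∈ Set.Ioo (-1 : ℝ) 1,
      |B.eval x| ≤ K ∧ |B.derivative.eval x| ≤ K ∧ |B.derivative.derivative.eval x| ≤ K) :
    ‖∫ x in (-1 : ℝ)..1, ((B.eval x : ℝ) : ℂ)
        * ((Real.sqrt (1 - x ^ 2) * F (δ / Real.sqrt (1 - x ^ 2)) : ℝ) : ℂ)
        * Complex.exp (-(Complex.I * w * x))‖ ≤ 50 * (K * (3 * |normF|)) * w ^ (-(3 / 2) : ℝ) := by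
  have hdiv : ∀ s : ℝ, 0 < s → HasDerivAt (fun s => δ / s) (-(δ / s / s)) s := by
    intro s hs
    refine ((hasDerivAt_const s δ).fun_div (hasDerivAt_id' s) hs.ne').congr_deriv ?_
    field_simp; ring
  have hc : 0 ≤ |normF| := abs_nonneg _
  refine norm_oscillatory_integral_sqrt_le
    (g := fun s => ((s * F (δ / s) : ℝ) : ℂ))
    (g' := fun s => ((F (δ / s) + normF * expNegAddInv (δ / s) : ℝ) : ℂ))
    (g'' := fun s => ((normF * (expNegAddInv (δ / s) * (1 + δ / s - 1 / (δ / s)) / s) : ℝ) : ℂ))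
    hw hK ?_ ?_ ?_ ?_ ?_ ?_
  · intro s hs
    have hy : 0 < δ / s := div_pos hδ hs
    refine HasDerivAt.ofReal_comp ?_
    refine ((hasDerivAt_id' s).fun_mul ((hasDerivAt_F hy).comp s (hdiv s hs))).congr_deriv ?_
    simp only [Function.comp]
    field_simp
  · intro s hs
    have hy : 0 < δ / s := div_pos hδ hs
    refine HasDerivAt.ofReal_comp ?_
    refine (((hasDerivAt_F hy).comp s (hdiv s hs)).fun_add
      (((hasDerivAt_expNegAddInv hy).comp s (hdiv s hs)).const_mul normF)).congr_deriv ?_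
    field_simp
    ring
  · refine Complex.continuous_ofReal.comp_continuousOn ?_
    have h1 : ContinuousOn (fun s : ℝ => δ / s) (Set.Ioi 0) :=
      continuousOn_const.div continuousOn_id fun s hs => (Set.mem_Ioi.1 hs).ne'
    have h2 : ContinuousOn (fun s : ℝ => expNegAddInv (δ / s)) (Set.Ioi 0) :=
      continuousOn_expNegAddInv.comp h1 fun s hs => div_pos hδ hs
    refine continuousOn_const.mul (ContinuousOn.div (h2.mul ?_) continuousOn_id
      fun s hs => (Set.mem_Ioi.1 hs).ne')
    exact (continuousOn_const.add h1).sub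
      (continuousOn_const.div h1 fun s hs => (div_pos hδ hs).ne')
  all_goals
    intro s hs hs1
    have hy : 0 < δ / s := div_pos hδ hs
    have hF := abs_F_le_normF hy.le
    have hE := expNegAddInv_le_one hy
    have hE0 := expNegAddInv_pos (δ / s)
    rw [Complex.norm_real, Real.norm_eq_abs]
  · rw [abs_mul, abs_of_pos hs]
    nlinarith
  · refine (abs_add_le _ _).trans ?_
    rw [abs_mul, abs_of_pos hE0]
    nlinarith
  · rw [abs_mul, abs_div, abs_of_pos hs, mul_comm 3, mul_div_assoc]
    refine mul_le_mul_of_nonneg_left ?_ hc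
    gcongr
    have h1 := mul_expNegAddInv_le_one hy
    have h2 := (expNegAddInv_div_le hy).trans (Real.exp_le_one_iff.2 (by linarith))
    have h3 : expNegAddInv (δ / s) * (1 + δ / s - 1 / (δ / s))
      = expNegAddInv (δ / s) + (δ / s) * expNegAddInv (δ / s) - expNegAddInv (δ / s) / (δ / s) := by
      field_simp
    rw [h3, abs_le]
    have h4 : 0 < (δ / s) * expNegAddInv (δ / s) := by positivity
    have h5 : 0 < expNegAddInv (δ / s) / (δ / s) := by positivity
    constructor <;> linarith

theorem hasDerivAt_ofReal_cpow {s : ℝ} (hs : 0 < s) (c : ℂ) :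
    HasDerivAt (fun s : ℝ => (s : ℂ) ^ c) (c * (s : ℂ) ^ (c - 1)) s := by
  have h := ((hasDerivAt_id' (s : ℂ)).cpow_const (c := c) (Complex.ofReal_mem_slitPlane.2 hs))
  simpa using h.comp_ofReal

open Polynomial in
-- Two derivatives of s^{1+it} cost (1 + |t|)², to be absorbed by the decay of `kernelH`.
theorem norm_oscillatory_integral_cpow_le {B : ℝ[X]} {K w : ℝ} (t : ℝ) (hw : 0 < w)
    (hK : ∀ x ∈ Set.Ioo (-1 : ℝ) 1,
      |B.eval x| ≤ K ∧ |B.derivative.eval x| ≤ K ∧ |B.derivative.derivative.eval x| ≤ K) :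
    ‖∫ x in (-1 : ℝ)..1, ((B.eval x : ℝ) : ℂ)
        * ((Real.sqrt (1 - x ^ 2) : ℝ) : ℂ) ^ (1 + t * Complex.I)
        * Complex.exp (-(Complex.I * w * x))‖ ≤ 50 * (K * (1 + |t|) ^ 2) * w ^ (-(3 / 2) : ℝ) := by
  set c : ℂ := 1 + t * Complex.I with hc
  have hre : c.re = 1 := by simp [hc]
  have n1 : ‖c‖ ≤ 1 + |t| := by
    refine (norm_add_le _ _).trans ?_
    simp
  have n2 : ‖c - 1‖ ≤ 1 + |t| := by
    simp [hc]
  have ht : 0 ≤ |t| := abs_nonneg t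
  refine norm_oscillatory_integral_sqrt_le
    (g := fun s => (s : ℂ) ^ c)
    (g' := fun s => c * (s : ℂ) ^ (c - 1))
    (g'' := fun s => c * ((c - 1) * (s : ℂ) ^ (c - 1 - 1)))
    hw hK ?_ ?_ ?_ ?_ ?_ ?_
  · exact fun s hs => hasDerivAt_ofReal_cpow hs c
  · exact fun s hs => (hasDerivAt_ofReal_cpow hs (c - 1)).const_mul c
  · exact continuousOn_const.mul (continuousOn_const.mul fun s hs =>
      (hasDerivAt_ofReal_cpow hs (c - 1 - 1)).continuousAt.continuousWithinAt)
  all_goals intro s hs hs1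
  · rw [Complex.norm_cpow_eq_rpow_re_of_pos hs, hre, Real.rpow_one]
    exact le_mul_of_one_le_left hs.le (one_le_pow₀ (by linarith))
  · rw [norm_mul, Complex.norm_cpow_eq_rpow_re_of_pos hs, Complex.sub_re, hre, Complex.one_re, sub_self,
      Real.rpow_zero, mul_one]
    nlinarith
  · rw [norm_mul, norm_mul, Complex.norm_cpow_eq_rpow_re_of_pos hs, Complex.sub_re, Complex.sub_re, hre,
      Complex.one_re, sub_self, zero_sub, Real.rpow_neg_one, ← mul_assoc, ← div_eq_mul_inv]
    gcongr
    nlinarith [mul_le_mul n1 n2 (norm_nonneg _) (by linarith : (0:ℝ) ≤ 1 + |t|)]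

end

section

/-! ### The Mellin transform of `F` -/

open MeasureTheory Filter Topology

theorem tendsto_rpow_mul_expNegAddInv_atTop (σ : ℝ) :
    Tendsto (fun y => y ^ σ * expNegAddInv y) atTop (𝓝 0) := by
  have h := tendsto_rpow_mul_exp_neg_mul_atTop_nhds_zero σ 1 one_pos
  refine tendsto_of_tendsto_of_tendsto_of_le_of_le' tendsto_const_nhds h ?_ ?_
  · filter_upwards [eventually_gt_atTop 0] with y hy
    exact mul_nonneg (Real.rpow_nonneg hy.le _) (expNegAddInv_pos y).le
  · filter_upwards [eventually_gt_atTop 0] with y hy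
    rw [neg_one_mul]
    exact mul_le_mul_of_nonneg_left (expNegAddInv_le_exp hy) (Real.rpow_nonneg hy.le _)

theorem tendsto_rpow_mul_expNegAddInv_zero (σ : ℝ) :
    Tendsto (fun y => y ^ σ * expNegAddInv y) (𝓝[>] 0) (𝓝 0) := by
  refine ((tendsto_rpow_mul_expNegAddInv_atTop (-σ)).comp tendsto_inv_nhdsGT_zero).congr' ?_
  filter_upwards [self_mem_nhdsWithin] with y hy
  have hy : 0 < y := hy
  simp only [Function.comp, expNegAddInv_inv]
  rw [Real.inv_rpow hy.le, Real.rpow_neg hy.le, inv_inv]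

theorem locallyIntegrableOn_expNegAddInv :
    LocallyIntegrableOn (fun y => (expNegAddInv y : ℂ)) (Set.Ioi 0) :=
  (Complex.continuous_ofReal.comp_continuousOn continuousOn_expNegAddInv).locallyIntegrableOn
    measurableSet_Ioi

theorem isBigO_expNegAddInv_atTop :
    (fun y => (expNegAddInv y : ℂ)) =O[atTop] fun t => Real.exp (-1 * t) := by
  refine Asymptotics.IsBigO.of_bound 1 ?_
  filter_upwards [eventually_gt_atTop 0] with y hy
  rw [Complex.norm_real, Real.norm_of_nonneg (expNegAddInv_pos y).le,
    Real.norm_of_nonneg (Real.exp_pos _).le, one_mul, neg_one_mul]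
  exact expNegAddInv_le_exp hy

/-- Every real exponent is allowed because y ↦ 1/y exchanges 0 with infinity; this makes the Mellin
transform entire. -/
theorem isBigO_expNegAddInv_zero (b : ℝ) :
    (fun y => (expNegAddInv y : ℂ)) =O[𝓝[>] 0] fun y : ℝ => y ^ (-b) := by
  refine Asymptotics.IsBigO.of_bound 1 ?_
  filter_upwards [self_mem_nhdsWithin,
    (tendsto_rpow_mul_expNegAddInv_zero b).eventually (eventually_le_nhds one_pos)] with y hy h
  have hy : 0 < y := hy
  have hp := Real.rpow_pos_of_pos hy b
  rw [Complex.norm_real, Real.norm_of_nonneg (expNegAddInv_pos y).le,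
    Real.norm_of_nonneg (Real.rpow_nonneg hy.le _), Real.rpow_neg hy.le, one_mul]
  rw [mul_comm, ← le_div_iff₀ hp, one_div] at h
  exact h

/-- The Mellin transform of `exp (-y - 1/y)`. -/
def mellinExp (u : ℂ) : ℂ := mellin (fun y => (expNegAddInv y : ℂ)) u

theorem mellinConvergent_expNegAddInv (u : ℂ) :
    MellinConvergent (fun y => (expNegAddInv y : ℂ)) u :=
  mellinConvergent_of_isBigO_rpow_exp one_pos locallyIntegrableOn_expNegAddInv
    isBigO_expNegAddInv_atTop (isBigO_expNegAddInv_zero (u.re - 1)) (by linarith)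

theorem differentiable_mellinExp : Differentiable ℂ mellinExp := fun u =>
  mellin_differentiableAt_of_isBigO_rpow_exp one_pos locallyIntegrableOn_expNegAddInv
    isBigO_expNegAddInv_atTop (isBigO_expNegAddInv_zero (u.re - 1)) (by linarith)

theorem tendsto_expNegAddInv_mul_cpow {l : Filter ℝ} (hl : ∀ᶠ y in l, 0 < y) (u : ℂ)
    (h : Tendsto (fun y => y ^ u.re * expNegAddInv y) l (𝓝 0)) :
    Tendsto (fun y : ℝ => (expNegAddInv y : ℂ) * (y : ℂ) ^ u) l (𝓝 0) := by
  rw [tendsto_zero_iff_norm_tendsto_zero]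
  refine h.congr' ?_
  filter_upwards [hl] with y hy
  rw [norm_mul, Complex.norm_real, Real.norm_of_nonneg (expNegAddInv_pos y).le,
    Complex.norm_cpow_eq_rpow_re_of_pos hy, mul_comm]

/-- Integration by parts, using E' = E (-1 + 1/y²). The functional equation trades a factor u for
shifts of u by ±1, and iterating it yields the decay on vertical lines. -/
theorem mul_mellinExp (u : ℂ) : u * mellinExp u = mellinExp (u + 1) - mellinExp (u - 1) := by
  have c := fun v => mellinConvergent_expNegAddInv v
  simp only [MellinConvergent, smul_eq_mul] at c
  have c1 := c (u + 1)
  have c2 := c (u - 1)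
  have hE : Set.EqOn (fun y : ℝ => ((expNegAddInv y * (-1 + 1 / y ^ 2) : ℝ) : ℂ) * (y : ℂ) ^ u)
      (fun y : ℝ => (y : ℂ) ^ (u - 1 - 1) * (expNegAddInv y : ℂ)
        - (y : ℂ) ^ (u + 1 - 1) * (expNegAddInv y : ℂ)) (Set.Ioi 0) := by
    intro y hy
    have hy0 : (y : ℂ) ≠ 0 := Complex.ofReal_ne_zero.2 (Set.mem_Ioi.1 hy).ne'
    simp only
    rw [sub_sub, Complex.cpow_sub _ _ hy0, add_sub_cancel_right,
      show (1 + 1 : ℂ) = ((2 : ℕ) : ℂ) by norm_num, Complex.cpow_natCast]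
    push_cast
    field_simp
    ring
  have key := integral_Ioi_mul_deriv_eq_deriv_mul (a := 0) (a' := (0 : ℂ)) (b' := 0)
    (u := fun y => (expNegAddInv y : ℂ))
    (u' := fun y => ((expNegAddInv y * (-1 + 1 / y ^ 2) : ℝ) : ℂ))
    (v := fun y : ℝ => (y : ℂ) ^ u) (v' := fun y : ℝ => u * (y : ℂ) ^ (u - 1))
    (fun y hy => (hasDerivAt_expNegAddInv hy).ofReal_comp)
    (fun y hy => hasDerivAt_ofReal_cpow hy u) ?_ ?_ ?_ ?_
  · rw [setIntegral_congr_fun measurableSet_Ioi hE, integral_sub c2 c1] at key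
    have h1 : ∫ y in Set.Ioi (0 : ℝ), (expNegAddInv y : ℂ) * (u * (y : ℂ) ^ (u - 1)) = u * mellinExp u := by
      rw [mellinExp, mellin, ← integral_const_mul]
      congr 1; ext y; rw [smul_eq_mul]; ring
    rw [h1] at key
    rw [key, mellinExp, mellinExp, mellin, mellin]
    simp only [smul_eq_mul]
    ring
  · refine ((c u).const_mul u).congr ?_
    refine Eventually.of_forall fun y => ?_
    simp only [Pi.mul_apply]; ring
  · refine IntegrableOn.congr_fun (c2.sub c1) (fun y hy => ?_) measurableSet_Ioi
    exact (hE hy).symm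
  · exact tendsto_expNegAddInv_mul_cpow self_mem_nhdsWithin u (tendsto_rpow_mul_expNegAddInv_zero _)
  · exact tendsto_expNegAddInv_mul_cpow (eventually_gt_atTop 0) u
      (tendsto_rpow_mul_expNegAddInv_atTop _)

/-- The Mellin transform of `exp (-y - 1/y)` decays rapidly on vertical lines. -/
theorem exists_mellinExp_decay (k : ℕ) (σ : ℝ) :
    ∃ C : ℝ, ∀ t : ℝ, ‖mellinExp (σ + t * Complex.I)‖ * |t| ^ k ≤ C := by
  induction k generalizing σ with
  | zero =>
    refine ⟨∫ y in Set.Ioi (0 : ℝ), y ^ (σ - 1) * expNegAddInv y, fun t => ?_⟩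
    rw [pow_zero, mul_one, mellinExp, mellin]
    refine (norm_integral_le_integral_norm _).trans (le_of_eq ?_)
    refine setIntegral_congr_fun measurableSet_Ioi fun y hy => ?_
    simp only [smul_eq_mul]
    rw [norm_mul, Complex.norm_real, Real.norm_of_nonneg (expNegAddInv_pos y).le,
      Complex.norm_cpow_eq_rpow_re_of_pos hy]
    simp
  | succ k ih =>
    obtain ⟨C₁, h₁⟩ := ih (σ + 1)
    obtain ⟨C₂, h₂⟩ := ih (σ - 1)
    refine ⟨C₁ + C₂, fun t => ?_⟩
    set u : ℂ := σ + t * Complex.I with hu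
    have ht : |t| ≤ ‖u‖ := by
      have := Complex.abs_im_le_norm u
      simpa [hu] using this
    have e1 : u + 1 = ((σ + 1 : ℝ) : ℂ) + t * Complex.I := by rw [hu]; push_cast; ring
    have e2 : u - 1 = ((σ - 1 : ℝ) : ℂ) + t * Complex.I := by rw [hu]; push_cast; ring
    have h := mul_mellinExp u
    have hn : ‖mellinExp u‖ * |t| ≤ ‖mellinExp (u + 1)‖ + ‖mellinExp (u - 1)‖ := by
      calc ‖mellinExp u‖ * |t| ≤ ‖mellinExp u‖ * ‖u‖ := by gcongr
        _ = ‖u * mellinExp u‖ := by rw [norm_mul, mul_comm]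
        _ ≤ _ := by rw [h]; exact norm_sub_le _ _
    calc ‖mellinExp u‖ * |t| ^ (k + 1) = ‖mellinExp u‖ * |t| * |t| ^ k := by ring
      _ ≤ (‖mellinExp (u + 1)‖ + ‖mellinExp (u - 1)‖) * |t| ^ k := by gcongr
      _ ≤ C₁ + C₂ := by rw [add_mul, e1, e2]; exact add_le_add (h₁ t) (h₂ t)

theorem norm_F_mul_cpow_le {u : ℂ} {y : ℝ} (hy : 0 < y) :
    ‖(F y : ℂ) * (y : ℂ) ^ u‖ ≤ |normF| * (Real.exp (-y) * y ^ u.re) := by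
  rw [norm_mul, Complex.norm_real, Complex.norm_cpow_eq_rpow_re_of_pos hy, ← mul_assoc]
  exact mul_le_mul_of_nonneg_right (abs_F_le hy.le) (Real.rpow_nonneg hy.le _)

/-- Integration by parts again, now with F' = -`normF` E/y; it transfers the decay to the Mellin
transform of F. -/
theorem mul_mellin_F {u : ℂ} (hu : 0 < u.re) :
    u * mellin (fun x => (F x : ℂ)) u = normF * mellinExp u := by
  have c := mellinConvergent_expNegAddInv u
  simp only [MellinConvergent, smul_eq_mul] at c
  have hE : Set.EqOn (fun y : ℝ => ((-(normF * (expNegAddInv y / y)) : ℝ) : ℂ) * (y : ℂ) ^ u)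
      (fun y : ℝ => -(normF : ℂ) * ((y : ℂ) ^ (u - 1) * (expNegAddInv y : ℂ))) (Set.Ioi 0) := by
    intro y hy
    have hy0 : (y : ℂ) ≠ 0 := Complex.ofReal_ne_zero.2 (Set.mem_Ioi.1 hy).ne'
    simp only
    rw [Complex.cpow_sub _ _ hy0, Complex.cpow_one]
    push_cast
    field_simp
  have key := integral_Ioi_mul_deriv_eq_deriv_mul (a := 0) (a' := (0 : ℂ)) (b' := 0)
    (u := fun y => (F y : ℂ))
    (u' := fun y => ((-(normF * (expNegAddInv y / y)) : ℝ) : ℂ))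
    (v := fun y : ℝ => (y : ℂ) ^ u) (v' := fun y : ℝ => u * (y : ℂ) ^ (u - 1))
    (fun y hy => (hasDerivAt_F hy).ofReal_comp)
    (fun y hy => hasDerivAt_ofReal_cpow hy u) ?_ ?_ ?_ ?_
  · rw [setIntegral_congr_fun measurableSet_Ioi hE, integral_const_mul] at key
    have h1 : ∫ y in Set.Ioi (0 : ℝ), (F y : ℂ) * (u * (y : ℂ) ^ (u - 1))
        = u * mellin (fun x => (F x : ℂ)) u := by
      rw [mellin, ← integral_const_mul]
      congr 1; ext y; rw [smul_eq_mul]; ring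
    rw [h1] at key
    rw [key, mellinExp, mellin]
    simp only [smul_eq_mul]
    ring
  · have hint : IntegrableOn (fun y : ℝ => |normF| * (Real.exp (-y) * y ^ (u.re - 1))) (Set.Ioi 0) :=
      (Real.GammaIntegral_convergent hu).const_mul _
    have hF : IntegrableOn (fun y : ℝ => (F y : ℂ) * (y : ℂ) ^ (u - 1)) (Set.Ioi 0) := by
      refine Integrable.mono' hint ?_ ?_
      · refine ContinuousOn.aestronglyMeasurable ?_ measurableSet_Ioi
        exact (Complex.continuous_ofReal.comp_continuousOn continuousOn_F).mul fun y hy =>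
          (hasDerivAt_ofReal_cpow hy _).continuousAt.continuousWithinAt
      · refine (ae_restrict_mem measurableSet_Ioi).mono fun y hy => ?_
        simpa using norm_F_mul_cpow_le (u := u - 1) hy
    refine (hF.const_mul u).congr ?_
    refine Eventually.of_forall fun y => ?_
    simp only [Pi.mul_apply]; ring
  · refine IntegrableOn.congr_fun (c.const_mul (-(normF : ℂ))) (fun y hy => ?_) measurableSet_Ioi
    exact (hE hy).symm
  · refine squeeze_zero_norm' (a := fun y : ℝ => |normF| * y ^ u.re) ?_ ?_
    · filter_upwards [self_mem_nhdsWithin] with y hy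
      have hy : 0 < y := hy
      refine (norm_F_mul_cpow_le hy).trans (mul_le_mul_of_nonneg_left ?_ (abs_nonneg _))
      exact mul_le_of_le_one_left (Real.rpow_nonneg hy.le _) (Real.exp_le_one_iff.2 (by linarith))
    · have h := (Real.continuousAt_rpow_const 0 u.re (Or.inr hu.le)).tendsto
      rw [Real.zero_rpow hu.ne'] at h
      simpa using (h.mono_left nhdsWithin_le_nhds).const_mul |normF|
  · refine squeeze_zero_norm' (a := fun y : ℝ => |normF| * (y ^ u.re * Real.exp (-1 * y))) ?_ ?_
    · filter_upwards [eventually_gt_atTop 0] with y hy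
      refine (norm_F_mul_cpow_le hy).trans (le_of_eq ?_)
      rw [neg_one_mul]; ring
    · simpa using (tendsto_rpow_mul_exp_neg_mul_atTop_nhds_zero u.re 1 one_pos).const_mul |normF|

/-! ### The quotient of Gamma factors -/

theorem exists_norm_betaIntegral_half_le :
    ∃ C : ℝ, ∀ τ : ℝ, ‖Complex.betaIntegral (1 + τ * Complex.I) (1 / 2)‖ ≤ C := by
  refine ⟨∫ x in (0 : ℝ)..1, ‖(1 - (x : ℂ)) ^ ((1 / 2 : ℂ) - 1)‖, fun τ => ?_⟩
  rw [Complex.betaIntegral]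
  refine (intervalIntegral.norm_integral_le_integral_norm zero_le_one).trans (le_of_eq ?_)
  refine intervalIntegral.integral_congr_ae (Eventually.of_forall fun x hx => ?_)
  rw [Set.uIoc_of_le zero_le_one] at hx
  rw [norm_mul, Complex.norm_cpow_eq_rpow_re_of_pos hx.1]
  simp

/-- A Beta function takes the place of Stirling. With τ = t/2, the quotient has absolute value |B(1
+ iτ, 1/2)| |1/2 + iτ| / Γ(1/2), and the Beta integral is bounded uniformly in τ. -/
theorem exists_norm_Gamma_div_Gamma_le :
    ∃ C : ℝ, 0 ≤ C ∧ ∀ t : ℝ, ‖Complex.Gamma ((1 + (1 + t * Complex.I)) / 2)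
      / Complex.Gamma ((2 - (1 + t * Complex.I)) / 2)‖ ≤ C * (1 + |t|) := by
  obtain ⟨C, hC⟩ := exists_norm_betaIntegral_half_le
  have hC0 : 0 ≤ C := (norm_nonneg _).trans (hC 0)
  have hg : 0 < ‖Complex.Gamma (1 / 2)‖ :=
    norm_pos_iff.2 (Complex.Gamma_ne_zero_of_re_pos (by norm_num))
  refine ⟨C / ‖Complex.Gamma (1 / 2)‖, div_nonneg hC0 hg.le, fun t => ?_⟩
  set τ : ℝ := t / 2 with hτ
  have e1 : (1 + (1 + t * Complex.I)) / 2 = 1 + τ * Complex.I := by rw [hτ]; push_cast; ring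
  have e2 : (2 - (1 + t * Complex.I)) / 2 = (starRingEnd ℂ) (1 / 2 + τ * Complex.I) := by
    rw [hτ]; simp only [map_add, map_mul, Complex.conj_I, Complex.conj_ofReal, map_div₀, map_one, map_ofNat]
    push_cast; ring
  rw [e1, e2, Complex.Gamma_conj, norm_div, Complex.norm_conj]
  have h0 : (1 / 2 + τ * Complex.I : ℂ) ≠ 0 := by
    intro h
    have := congrArg Complex.re h
    simp at this
  have hG : 0 < ‖Complex.Gamma (1 / 2 + τ * Complex.I)‖ :=
    norm_pos_iff.2 (Complex.Gamma_ne_zero_of_re_pos (by simp))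
  have hb := Complex.Gamma_mul_Gamma_eq_betaIntegral (s := 1 + τ * Complex.I) (t := 1 / 2)
    (by simp) (by norm_num)
  rw [show (1 + τ * Complex.I + 1 / 2 : ℂ) = (1 / 2 + τ * Complex.I) + 1 by ring,
    Complex.Gamma_add_one _ h0] at hb
  have hb' := congrArg norm hb
  rw [norm_mul, norm_mul, norm_mul] at hb'
  have hn : ‖(1 / 2 + τ * Complex.I : ℂ)‖ ≤ 1 + |t| := by
    refine (norm_add_le _ _).trans ?_
    rw [norm_mul, Complex.norm_I, Complex.norm_real, Real.norm_eq_abs, hτ, abs_div]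
    norm_num
    linarith [abs_nonneg t]
  rw [div_le_iff₀ hG, div_mul_eq_mul_div, div_mul_eq_mul_div, le_div_iff₀ hg, hb']
  have := mul_le_mul hn (hC τ) (norm_nonneg _) (by positivity)
  nlinarith

/-! ### The integrand of `H` on the line `Re u = 1` -/

/-- The integrand of the Mellin inversion integral defining `H`, on the line `Re u = 1`. -/
def kernelH (t : ℝ) : ℂ :=
  Complex.Gamma ((1 + (1 + t * Complex.I)) / 2) / Complex.Gamma ((2 - (1 + t * Complex.I)) / 2)
    * mellin (fun x : ℝ => (F x : ℂ)) (1 + t * Complex.I)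

theorem kernelH_eq (t : ℝ) : kernelH t =
    Complex.Gamma ((1 + (1 + t * Complex.I)) / 2) / Complex.Gamma ((2 - (1 + t * Complex.I)) / 2)
      * (normF * mellinExp (1 + t * Complex.I) / (1 + t * Complex.I)) := by
  have hre : 0 < (1 + t * Complex.I : ℂ).re := by simp
  have h0 : (1 + t * Complex.I : ℂ) ≠ 0 := by
    intro h
    rw [h] at hre
    simp at hre
  rw [kernelH, ← mul_mellin_F hre, mul_div_cancel_left₀ _ h0]

theorem continuous_kernelH : Continuous kernelH := by
  have hG : ∀ {φ : ℝ → ℂ}, Continuous φ → (∀ t, 0 < (φ t).re) →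
      Continuous fun t => Complex.Gamma (φ t) := by
    intro φ hφ h
    refine continuous_iff_continuousAt.2 fun t => ?_
    refine ContinuousAt.comp (g := Complex.Gamma) ?_ hφ.continuousAt
    refine (Complex.differentiableAt_Gamma _ fun m hm => ?_).continuousAt
    have := h t
    rw [hm] at this
    simp at this
    linarith [(Nat.cast_nonneg m : (0 : ℝ) ≤ m)]
  have hre1 : ∀ t : ℝ, 0 < ((2 - (1 + t * Complex.I)) / 2 : ℂ).re := fun t => by
    rw [show (2 - (1 + t * Complex.I)) / 2 = ((1 / 2 : ℝ) : ℂ) + ((-t / 2 : ℝ) : ℂ) * Complex.I by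
      push_cast; ring]
    simp
  have hre2 : ∀ t : ℝ, 0 < ((1 + (1 + t * Complex.I)) / 2 : ℂ).re := fun t => by
    rw [show (1 + (1 + t * Complex.I)) / 2 = ((1 : ℝ) : ℂ) + ((t / 2 : ℝ) : ℂ) * Complex.I by
      push_cast; ring]
    simp
  have hc : Continuous fun t : ℝ => mellinExp (1 + t * Complex.I) :=
    differentiable_mellinExp.continuous.comp (by fun_prop)
  rw [funext kernelH_eq]
  refine ((hG (by fun_prop) hre2).div (hG (by fun_prop) hre1) fun t =>
    Complex.Gamma_ne_zero_of_re_pos (hre1 t)).mul ((continuous_const.mul hc).div (by fun_prop) ?_)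
  intro t h
  have := congrArg Complex.re h
  simp at this

/-- The factor 1/u cancels the linear growth of the Gamma quotient, and four powers of decay of
`mellinExp` cover both (1 + |t|)² and an integrable majorant. -/
theorem exists_kernelH_bound :
    ∃ C : ℝ, ∀ t : ℝ, ‖kernelH t‖ * (1 + |t|) ^ 2 ≤ C * (1 + t ^ 2)⁻¹ := by
  obtain ⟨C, hC0, hC⟩ := exists_norm_Gamma_div_Gamma_le
  obtain ⟨D₀, h₀⟩ := exists_mellinExp_decay 0 1
  obtain ⟨D₄, h₄⟩ := exists_mellinExp_decay 4 1
  refine ⟨8 * C * |normF| * (D₀ + D₄), fun t => ?_⟩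
  set N := ‖mellinExp (1 + t * Complex.I)‖ with hN
  have hN0 : 0 ≤ N := norm_nonneg _
  have e0 : N ≤ D₀ := by simpa using h₀ t
  have e4 : N * t ^ 4 ≤ D₄ := by
    have := h₄ t
    rw [Complex.ofReal_one] at this
    have h : |t| ^ 4 = t ^ 4 := by rw [Even.pow_abs (by decide)]
    rwa [h] at this
  have hb : 0 < ‖(1 + t * Complex.I : ℂ)‖ := by
    rw [norm_pos_iff]
    intro h
    have := congrArg Complex.re h
    simp at this
  have hb2 : 1 + |t| ≤ 2 * ‖(1 + t * Complex.I : ℂ)‖ := by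
    have h1 := Complex.abs_re_le_norm (1 + t * Complex.I : ℂ)
    have h2 := Complex.abs_im_le_norm (1 + t * Complex.I : ℂ)
    simp at h1 h2
    linarith
  have hk : ‖kernelH t‖ ≤ 2 * C * |normF| * N := by
    rw [kernelH_eq, norm_mul, norm_div (normF * mellinExp _), norm_mul, Complex.norm_real, Real.norm_eq_abs]
    have h1 : |normF| * N / ‖(1 + t * Complex.I : ℂ)‖ * (1 + |t|) ≤ 2 * (|normF| * N) := by
      rw [div_mul_eq_mul_div, div_le_iff₀ hb]
      have := mul_le_mul_of_nonneg_left hb2 (mul_nonneg (abs_nonneg normF) hN0)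
      linarith
    calc _ ≤ C * (1 + |t|) * (|normF| * N / ‖(1 + t * Complex.I : ℂ)‖) :=
          mul_le_mul_of_nonneg_right (hC t) (by positivity)
      _ = C * (|normF| * N / ‖(1 + t * Complex.I : ℂ)‖ * (1 + |t|)) := by ring
      _ ≤ C * (2 * (|normF| * N)) := mul_le_mul_of_nonneg_left h1 hC0
      _ = _ := by ring
  have h1 : (1 + |t|) ^ 2 ≤ 2 * (1 + t ^ 2) := by
    nlinarith [sq_abs t, sq_nonneg (1 - |t|)]
  have h2 : N * (1 + t ^ 2) ^ 2 ≤ 2 * (D₀ + D₄) := by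
    nlinarith [mul_nonneg hN0 (sq_nonneg (1 - t ^ 2))]
  rw [← div_eq_mul_inv, le_div_iff₀ (by positivity)]
  have hp : 0 ≤ C * |normF| := mul_nonneg hC0 (abs_nonneg _)
  calc ‖kernelH t‖ * (1 + |t|) ^ 2 * (1 + t ^ 2)
      ≤ (2 * C * |normF| * N) * (2 * (1 + t ^ 2)) * (1 + t ^ 2) := by gcongr
    _ = 4 * (C * |normF|) * (N * (1 + t ^ 2) ^ 2) := by ring
    _ ≤ 4 * (C * |normF|) * (2 * (D₀ + D₄)) := by gcongr
    _ = _ := by ring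

theorem integrable_kernelH_mul :
    Integrable fun t : ℝ => ‖kernelH t‖ * (1 + |t|) ^ 2 := by
  obtain ⟨C, hC⟩ := exists_kernelH_bound
  refine Integrable.mono' (integrable_inv_one_add_sq.const_mul C) ?_ ?_
  · exact (continuous_kernelH.norm.mul (by fun_prop)).aestronglyMeasurable
  · exact Eventually.of_forall fun t => by
      rw [Real.norm_of_nonneg (by positivity)]
      exact hC t

theorem integrable_kernelH : Integrable kernelH := by
  refine Integrable.mono' integrable_kernelH_mul continuous_kernelH.aestronglyMeasurable
    (Eventually.of_forall fun t => ?_)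
  exact le_mul_of_one_le_right (norm_nonneg _) (one_le_pow₀ (by linarith [abs_nonneg t]))

end

section

/-! ### The Fourier transform `I_{l,f}(ξ,n)` -/

open MeasureTheory

/-- The coefficients of `s · y · H(y)`, `y = δ / s`, as a superposition of powers of `s`. -/
def coeffH (δ t : ℝ) : ℂ :=
  (Real.sqrt Real.pi : ℂ) * ((1 / (2 * Real.pi) : ℝ) : ℂ) * δ
    * ((Real.pi * δ : ℝ) : ℂ) ^ (-(1 + t * Complex.I)) * kernelH t

/-- The factor s supplied by θ_∞ cancels the denominator of y, leaving δ H(δ/s); on Re u = 1 the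
factor (πδ/s)^{-u} contributes s^{1+it}. -/
theorem mul_H_eq {δ s : ℝ} (hδ : 0 < δ) (hs : 0 < s) :
    (s : ℂ) * (((δ / s : ℝ) : ℂ) * H (δ / s))
      = ∫ t : ℝ, coeffH δ t * (s : ℂ) ^ (1 + t * Complex.I) := by
  have hs0 : (s : ℂ) ≠ 0 := Complex.ofReal_ne_zero.2 hs.ne'
  have h1 : ∀ t : ℝ, ((Real.pi * (δ / s) : ℝ) : ℂ) ^ (-(1 + t * Complex.I))
      = ((Real.pi * δ : ℝ) : ℂ) ^ (-(1 + t * Complex.I)) * (s : ℂ) ^ (1 + t * Complex.I) := by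
    intro t
    have e1 : ((Real.pi * (δ / s) : ℝ) : ℂ) = ((Real.pi * δ : ℝ) : ℂ) * ((s⁻¹ : ℝ) : ℂ) := by
      rw [← Complex.ofReal_mul]; congr 1; rw [div_eq_mul_inv]; ring
    rw [e1, Complex.mul_cpow_ofReal_nonneg (by positivity) (by positivity), Complex.ofReal_inv,
      Complex.inv_cpow _ _ (by rw [Complex.arg_ofReal_of_nonneg hs.le]; exact Real.pi_pos.ne),
      Complex.cpow_neg (s : ℂ), inv_inv]
  have h2 : H (δ / s) = (Real.sqrt Real.pi : ℂ) * (((1 / (2 * Real.pi) : ℝ) : ℂ)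
      * ∫ t : ℝ, ((Real.pi * (δ / s) : ℝ) : ℂ) ^ (-(1 + t * Complex.I)) * kernelH t) := by
    rw [H, mellinInv, Complex.real_smul]
    simp only [Complex.ofReal_one, smul_eq_mul, kernelH]
  have h3 : (s : ℂ) * (((δ / s : ℝ) : ℂ) * H (δ / s)) = δ * H (δ / s) := by
    push_cast; field_simp
  rw [h3, h2, ← integral_const_mul, ← integral_const_mul, ← integral_const_mul]
  congr 1
  ext t
  rw [h1, coeffH]
  ring

/-- On Re u = 1 the prefactor δ cancels |(πδ)^{-u}| = 1/(πδ), whence uniformity in δ. -/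
theorem norm_coeffH_le {δ : ℝ} (hδ : 0 < δ) (t : ℝ) : ‖coeffH δ t‖ ≤ ‖kernelH t‖ := by
  have hπ := Real.pi_gt_three
  have hp : 0 < Real.pi * δ := by positivity
  have hre : (-(1 + t * Complex.I : ℂ)).re = -1 := by simp
  rw [coeffH, norm_mul]
  refine mul_le_of_le_one_left (norm_nonneg _) ?_
  rw [norm_mul, norm_mul, norm_mul, Complex.norm_cpow_eq_rpow_re_of_pos hp, hre, Real.rpow_neg_one,
    Complex.norm_real, Complex.norm_real, Complex.norm_real, Real.norm_of_nonneg hδ.le,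
    Real.norm_of_nonneg (Real.sqrt_nonneg _), Real.norm_of_nonneg (by positivity)]
  have h1 : Real.sqrt Real.pi ≤ Real.pi := by
    rw [Real.sqrt_le_left (by linarith)]; nlinarith
  calc Real.sqrt Real.pi * (1 / (2 * Real.pi)) * δ * (Real.pi * δ)⁻¹
      ≤ Real.pi * (1 / (2 * Real.pi)) * δ * (Real.pi * δ)⁻¹ := by gcongr
    _ = 1 / (2 * Real.pi) := by field_simp
    _ ≤ 1 := by rw [div_le_one (by positivity)]; linarith

theorem continuous_coeffH {δ : ℝ} (hδ : 0 < δ) : Continuous (coeffH δ) := by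
  have hp : ((Real.pi * δ : ℝ) : ℂ) ≠ 0 := by
    have : 0 < Real.pi * δ := by positivity
    exact Complex.ofReal_ne_zero.2 this.ne'
  refine (continuous_const.mul ?_).mul continuous_kernelH
  exact Continuous.const_cpow (by fun_prop) (Or.inl hp)

theorem integrable_coeffH {δ : ℝ} (hδ : 0 < δ) : Integrable (coeffH δ) :=
  Integrable.mono integrable_kernelH (continuous_coeffH hδ).aestronglyMeasurable
    (Filter.Eventually.of_forall (norm_coeffH_le hδ))

open Polynomial in
/-- Joint integrability of the double integral behind the `H`-part of `I_{l,f}(ξ,n)`. -/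
theorem integrable_prod_coeffH (B : ℝ[X]) (w : ℝ) {δ : ℝ} (hδ : 0 < δ) :
    Integrable (Function.uncurry fun x t : ℝ => ((B.eval x : ℝ) : ℂ)
        * (coeffH δ t * ((Real.sqrt (1 - x ^ 2) : ℝ) : ℂ) ^ (1 + t * Complex.I))
        * Complex.exp (-(Complex.I * w * x)))
      ((volume.restrict (Set.Ioo (-1 : ℝ) 1)).prod volume) := by
  have hB : Integrable (fun x => B.eval x) (volume.restrict (Set.Ioo (-1 : ℝ) 1)) :=
    (B.continuous.continuousOn.integrableOn_compact isCompact_Icc).mono_set Set.Ioo_subset_Icc_self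
  refine Integrable.mono (hB.mul_prod (integrable_coeffH hδ).norm) ?_ ?_
  · have m1 : Measurable fun x => B.eval x := B.continuous.measurable
    have m2 : Measurable (coeffH δ) := (continuous_coeffH hδ).measurable
    refine Measurable.aestronglyMeasurable ?_
    unfold Function.uncurry
    fun_prop
  · refine Filter.Eventually.of_forall fun p => ?_
    simp only [Function.uncurry]
    rw [norm_mul, norm_mul, norm_mul, norm_mul, norm_exp_neg_I, Complex.norm_real, mul_one, norm_norm]
    refine mul_le_mul_of_nonneg_left ?_ (norm_nonneg _)
    refine mul_le_of_le_one_right (norm_nonneg _) ?_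
    have hre : (1 + p.2 * Complex.I : ℂ).re = 1 := by simp
    have hne : (1 + p.2 * Complex.I : ℂ).re ≠ 0 := by rw [hre]; exact one_ne_zero
    rw [Complex.norm_cpow_eq_rpow_re_of_nonneg (Real.sqrt_nonneg _) hne, hre, Real.rpow_one,
      Real.sqrt_le_one]
    nlinarith [sq_nonneg p.1]

open Polynomial in
theorem norm_oscillatory_integral_H_le {B : ℝ[X]} {K w δ : ℝ} (hw : 0 < w) (hδ : 0 < δ)
    (hK : ∀ x ∈ Set.Ioo (-1 : ℝ) 1,
      |B.eval x| ≤ K ∧ |B.derivative.eval x| ≤ K ∧ |B.derivative.derivative.eval x| ≤ K) :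
    ‖∫ x in Set.Ioo (-1 : ℝ) 1, ∫ t : ℝ, ((B.eval x : ℝ) : ℂ)
        * (coeffH δ t * ((Real.sqrt (1 - x ^ 2) : ℝ) : ℂ) ^ (1 + t * Complex.I))
        * Complex.exp (-(Complex.I * w * x))‖
      ≤ 50 * (K * ∫ t : ℝ, ‖kernelH t‖ * (1 + |t|) ^ 2) * w ^ (-(3 / 2) : ℝ) := by
  have hK0 : 0 ≤ K := (abs_nonneg _).trans (hK 0 ⟨by norm_num, by norm_num⟩).1
  rw [integral_integral_swap (integrable_prod_coeffH B w hδ)]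
  have h1 : 50 * (K * ∫ t : ℝ, ‖kernelH t‖ * (1 + |t|) ^ 2) * w ^ (-(3 / 2) : ℝ)
      = ∫ t : ℝ, (50 * K * w ^ (-(3 / 2) : ℝ)) * (‖kernelH t‖ * (1 + |t|) ^ 2) := by
    rw [integral_const_mul]; ring
  rw [h1]
  refine norm_integral_le_of_norm_le (integrable_kernelH_mul.const_mul _)
    (Filter.Eventually.of_forall fun t => ?_)
  have h2 : ∫ x in Set.Ioo (-1 : ℝ) 1, ((B.eval x : ℝ) : ℂ)
        * (coeffH δ t * ((Real.sqrt (1 - x ^ 2) : ℝ) : ℂ) ^ (1 + t * Complex.I))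
        * Complex.exp (-(Complex.I * w * x))
      = coeffH δ t * ∫ x in (-1 : ℝ)..1, ((B.eval x : ℝ) : ℂ)
        * ((Real.sqrt (1 - x ^ 2) : ℝ) : ℂ) ^ (1 + t * Complex.I)
        * Complex.exp (-(Complex.I * w * x)) := by
    rw [intervalIntegral.integral_of_le (by norm_num), integral_Ioc_eq_integral_Ioo,
      ← integral_const_mul]
    congr 1; ext x; ring
  rw [h2, norm_mul]
  have h3 := norm_oscillatory_integral_cpow_le (B := B) t hw hK
  calc _ ≤ ‖kernelH t‖ * (50 * (K * (1 + |t|) ^ 2) * w ^ (-(3 / 2) : ℝ)) :=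
        mul_le_mul (norm_coeffH_le hδ t) h3 (norm_nonneg _) (norm_nonneg _)
    _ = _ := by ring

/-- The polynomial B and its bounds depend only on k, and l, f, ξ, n enter only through δ and the
frequency w. Both oscillatory estimates are uniform in δ, so w^{-3/2} is the whole dependence. -/
theorem exists_norm_fourierI_le (k : ℕ) : ∃ C : ℝ, 0 ≤ C ∧ ∀ (l f : ℕ) (ξ : ℤ) (n : ℕ),
    l ≠ 0 → f ≠ 0 → 0 < ξ → n ≠ 0 →
      ‖fourierI k l f ξ n‖
        ≤ C * (((l : ℝ) * (f : ℝ) ^ 2) / (ξ * Real.sqrt n)) ^ (3 / 2 : ℝ) := by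
  obtain ⟨B, hB⟩ := exists_thetaInf_eq k
  obtain ⟨K, hK0, hK⟩ := exists_polynomial_bound B
  set D := ∫ t : ℝ, ‖kernelH t‖ * (1 + |t|) ^ 2 with hD
  have hD0 : 0 ≤ D := integral_nonneg fun t => by positivity
  refine ⟨50 * (K * (3 * |normF|)) + 50 * (K * D), by positivity, ?_⟩
  intro l f ξ n hl hf hξ hn
  have hl0 : (0 : ℝ) < l := by exact_mod_cast Nat.pos_of_ne_zero hl
  have hf0 : (0 : ℝ) < f := by exact_mod_cast Nat.pos_of_ne_zero hf
  have hn0 : (0 : ℝ) < n := by exact_mod_cast Nat.pos_of_ne_zero hn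
  have hξ0 : (0 : ℝ) < ξ := by exact_mod_cast hξ
  have hsn : 0 < Real.sqrt n := Real.sqrt_pos.2 hn0
  set m : ℝ := (l : ℝ) * (f : ℝ) ^ 2 with hm
  have hm0 : 0 < m := by positivity
  set δ : ℝ := m / Real.sqrt (4 * (n : ℝ)) with hδ
  have hδ0 : 0 < δ := div_pos hm0 (Real.sqrt_pos.2 (by positivity))
  set w : ℝ := Real.pi * ξ * Real.sqrt n / m with hw
  have hw0 : 0 < w := by positivity
  have hexp : ∀ x : ℝ, e (-(x * (ξ : ℝ) * Real.sqrt (n : ℝ)) / (2 * m))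
      = Complex.exp (-(Complex.I * w * x)) := by
    intro x
    rw [e]
    congr 1
    have : (m : ℂ) ≠ 0 := Complex.ofReal_ne_zero.2 hm0.ne'
    rw [hw]
    push_cast
    field_simp
  set p₁ : ℝ → ℂ := fun x => ((B.eval x : ℝ) : ℂ)
        * ((Real.sqrt (1 - x ^ 2) * F (δ / Real.sqrt (1 - x ^ 2)) : ℝ) : ℂ)
        * Complex.exp (-(Complex.I * w * x)) with hp₁
  set p₂ : ℝ → ℂ := fun x => ∫ t : ℝ, ((B.eval x : ℝ) : ℂ)
        * (coeffH δ t * ((Real.sqrt (1 - x ^ 2) : ℝ) : ℂ) ^ (1 + t * Complex.I))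
        * Complex.exp (-(Complex.I * w * x)) with hp₂
  have hi₂ : IntegrableOn p₂ (Set.Ioo (-1) 1) :=
    (integrable_prod_coeffH B w hδ0).integral_prod_left
  have hi₁ : IntegrableOn p₁ (Set.Ioo (-1) 1) := by
    have hσ0 : ∀ x ∈ Set.Ioo (-1 : ℝ) 1, 0 < Real.sqrt (1 - x ^ 2) := fun x hx =>
      Real.sqrt_pos.2 (one_sub_sq_pos hx)
    have hσc : ContinuousOn (fun x : ℝ => Real.sqrt (1 - x ^ 2)) (Set.Ioo (-1) 1) := by fun_prop
    refine IntegrableOn.of_bound (C := K * |normF|) (by simp) ?_ ?_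
    · refine ContinuousOn.aestronglyMeasurable ?_ measurableSet_Ioo
      refine ContinuousOn.mul (ContinuousOn.mul ?_ ?_) (continuous_exp_neg_I w).continuousOn
      · exact (Complex.continuous_ofReal.comp B.continuous).continuousOn
      · refine Complex.continuous_ofReal.comp_continuousOn (hσc.mul ?_)
        exact continuousOn_F.comp (continuousOn_const.div hσc fun x hx => (hσ0 x hx).ne')
          fun x hx => div_pos hδ0 (hσ0 x hx)
    · refine (ae_restrict_mem measurableSet_Ioo).mono fun x hx => ?_
      rw [hp₁]
      simp only
      rw [norm_mul, norm_mul, norm_exp_neg_I, mul_one, Complex.norm_real, Complex.norm_real, norm_mul]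
      refine mul_le_mul (hK x hx).1 ?_ (by positivity) hK0
      have h1 : ‖Real.sqrt (1 - x ^ 2)‖ ≤ 1 := by
        rw [Real.norm_of_nonneg (Real.sqrt_nonneg _), Real.sqrt_le_one]
        nlinarith [sq_nonneg x]
      calc _ ≤ 1 * |normF| := mul_le_mul h1 (abs_F_le_normF (div_pos hδ0 (hσ0 x hx)).le)
              (abs_nonneg _) zero_le_one
        _ = _ := one_mul _
  have hI : fourierI k l f ξ n
      = (∫ x in Set.Ioo (-1 : ℝ) 1, p₁ x) + ∫ x in Set.Ioo (-1 : ℝ) 1, p₂ x := by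
    rw [← integral_add hi₁ hi₂, fourierI, intervalIntegral.integral_of_le (by norm_num),
      integral_Ioc_eq_integral_Ioo]
    refine setIntegral_congr_fun measurableSet_Ioo fun x hx => ?_
    have hs := Real.sqrt_pos.2 (one_sub_sq_pos hx)
    simp only [hp₁, hp₂]
    rw [← hm, ← hδ, hexp, hB x hx, integral_mul_const, integral_const_mul, ← mul_H_eq hδ0 hs]
    push_cast
    ring
  have b₁ : ‖∫ x in Set.Ioo (-1 : ℝ) 1, p₁ x‖
      ≤ 50 * (K * (3 * |normF|)) * w ^ (-(3 / 2) : ℝ) := by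
    have h := norm_oscillatory_integral_F_le (B := B) hw0 hδ0 hK
    rwa [intervalIntegral.integral_of_le (by norm_num), integral_Ioc_eq_integral_Ioo] at h
  have b₂ := norm_oscillatory_integral_H_le (B := B) hw0 hδ0 hK
  have hwle : w ^ (-(3 / 2) : ℝ) ≤ (m / (ξ * Real.sqrt n)) ^ (3 / 2 : ℝ) := by
    rw [Real.rpow_neg hw0.le, ← Real.inv_rpow hw0.le]
    refine Real.rpow_le_rpow (by positivity) ?_ (by norm_num)
    rw [hw, inv_div]
    refine div_le_div_of_nonneg_left hm0.le (by positivity) ?_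
    have := Real.pi_gt_three
    nlinarith [mul_pos hξ0 hsn]
  rw [hI]
  refine (norm_add_le _ _).trans ((add_le_add b₁ b₂).trans ?_)
  rw [← add_mul]
  exact mul_le_mul_of_nonneg_left hwle (by positivity)

end

section

/-! ### Averages of divisor functions -/

open Finset

theorem sum_one_div_le_one_add_log (M : ℕ) :
    ∑ j ∈ Icc 1 M, 1 / (j : ℝ) ≤ 1 + Real.log M := by
  have h := harmonic_le_one_add_log M
  rw [harmonic_eq_sum_Icc] at h
  simpa [one_div] using h

theorem sum_Icc_filter_dvd (M d : ℕ) (hd : d ≠ 0) (φ : ℕ → ℝ) :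
    ∑ l ∈ (Icc 1 M).filter (d ∣ ·), φ l = ∑ j ∈ Icc 1 (M / d), φ (d * j) := by
  have hd' := Nat.pos_of_ne_zero hd
  symm
  refine sum_bij (fun j _ => d * j) ?_ ?_ ?_ ?_
  · intro j hj
    rw [mem_Icc] at hj
    rw [mem_filter, mem_Icc]
    refine ⟨⟨Nat.mul_pos hd' hj.1, ?_⟩, dvd_mul_right _ _⟩
    rw [mul_comm]
    exact (Nat.le_div_iff_mul_le hd').1 hj.2
  · intro a _ b _ h
    exact Nat.eq_of_mul_eq_mul_left hd' h
  · intro l hl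
    rw [mem_filter, mem_Icc] at hl
    obtain ⟨⟨h1, h2⟩, j, rfl⟩ := hl
    refine ⟨j, ?_, rfl⟩
    rw [mem_Icc, Nat.le_div_iff_mul_le hd', mul_comm j]
    exact ⟨Nat.pos_of_ne_zero fun h => by simp [h] at h1, h2⟩
  · intro _ _; rfl

theorem sum_sum_divisors (M : ℕ) (φ : ℕ → ℕ → ℝ) :
    ∑ l ∈ Icc 1 M, ∑ d ∈ l.divisors, φ d l
      = ∑ d ∈ Icc 1 M, ∑ j ∈ Icc 1 (M / d), φ d (d * j) := by
  have h1 : ∑ d ∈ Icc 1 M, ∑ j ∈ Icc 1 (M / d), φ d (d * j)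
      = ∑ d ∈ Icc 1 M, ∑ l ∈ (Icc 1 M).filter (d ∣ ·), φ d l :=
    sum_congr rfl fun d hd =>
      (sum_Icc_filter_dvd M d (Nat.one_le_iff_ne_zero.1 (mem_Icc.1 hd).1) (φ d)).symm
  rw [h1]
  refine sum_comm' fun l d => ?_
  simp only [mem_Icc, Nat.mem_divisors, mem_filter]
  constructor
  · rintro ⟨⟨h1, h2⟩, h3, h4⟩
    exact ⟨⟨⟨h1, h2⟩, h3⟩, Nat.pos_of_dvd_of_pos h3 h1, (Nat.le_of_dvd h1 h3).trans h2⟩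
  · rintro ⟨⟨⟨h1, h2⟩, h3⟩, -, -⟩
    exact ⟨⟨h1, h2⟩, h3, by omega⟩

theorem cast_div_mul_log_le (M d : ℕ) :
    ((M / d : ℕ) : ℝ) * (1 + Real.log ((M / d : ℕ) : ℝ)) ≤ (M : ℝ) / d * (1 + Real.log M) := by
  rcases Nat.eq_zero_or_pos (M / d) with h | h
  · rw [h, Nat.cast_zero, zero_mul]
    exact mul_nonneg (by positivity) (add_nonneg zero_le_one (Real.log_natCast_nonneg _))
  · refine mul_le_mul Nat.cast_div_le ?_ (add_nonneg zero_le_one (Real.log_natCast_nonneg _))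
      (by positivity)
    have h1 : (0 : ℝ) < ((M / d : ℕ) : ℝ) := by exact_mod_cast h
    have h2 : ((M / d : ℕ) : ℝ) ≤ M := by exact_mod_cast Nat.div_le_self M d
    linarith [Real.log_le_log h1 h2]

theorem sum_card_divisors_le (M : ℕ) :
    ∑ l ∈ Icc 1 M, (l.divisors.card : ℝ) ≤ M * (1 + Real.log M) := by
  have h := sum_sum_divisors M fun _ _ => 1
  simp only [sum_const, nsmul_eq_mul, mul_one, Nat.card_Icc, Nat.add_sub_cancel] at h
  rw [h]
  calc ∑ d ∈ Icc 1 M, ((M / d : ℕ) : ℝ) ≤ ∑ d ∈ Icc 1 M, (M : ℝ) * (1 / d) :=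
        sum_le_sum fun d _ => by rw [mul_one_div]; exact Nat.cast_div_le
    _ ≤ _ := by
        rw [← mul_sum]
        exact mul_le_mul_of_nonneg_left (sum_one_div_le_one_add_log M) (Nat.cast_nonneg _)

theorem card_divisors_mul_le (m n : ℕ) :
    ((m * n).divisors.card : ℝ) ≤ m.divisors.card * n.divisors.card := by
  have h : (m * n).divisors.card ≤ m.divisors.card * n.divisors.card := by
    open scoped Pointwise in
    rw [Nat.divisors_mul]
    exact Finset.card_mul_le
  exact_mod_cast h

theorem exists_sum_rpow_le {p : ℝ} (hp : p < -1) :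
    ∃ C : ℝ, 0 ≤ C ∧ ∀ M : ℕ, ∑ j ∈ Icc 1 M, (j : ℝ) ^ p ≤ C :=
  ⟨∑' j : ℕ, (j : ℝ) ^ p, tsum_nonneg fun j => Real.rpow_nonneg (Nat.cast_nonneg j) _, fun _ =>
    (Real.summable_nat_rpow.2 hp).sum_le_tsum _ fun j _ => Real.rpow_nonneg (Nat.cast_nonneg j) _⟩

/-- The sum is dominated by ζ(-p)², as d = 1 ∗ 1. -/
theorem exists_sum_card_divisors_rpow_le {p : ℝ} (hp : p < -1) :
    ∃ C : ℝ, 0 ≤ C ∧ ∀ M : ℕ, ∑ d ∈ Icc 1 M, (d.divisors.card : ℝ) * (d : ℝ) ^ p ≤ C := by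
  obtain ⟨C, hC0, hC⟩ := exists_sum_rpow_le hp
  refine ⟨C * C, mul_nonneg hC0 hC0, fun M => ?_⟩
  have h := sum_sum_divisors M fun _ l => (l : ℝ) ^ p
  simp only [sum_const, nsmul_eq_mul] at h
  rw [h]
  calc ∑ d ∈ Icc 1 M, ∑ j ∈ Icc 1 (M / d), ((d * j : ℕ) : ℝ) ^ p
      = ∑ d ∈ Icc 1 M, (d : ℝ) ^ p * ∑ j ∈ Icc 1 (M / d), (j : ℝ) ^ p := by
        refine sum_congr rfl fun d _ => ?_
        rw [mul_sum]
        refine sum_congr rfl fun j _ => ?_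
        rw [Nat.cast_mul, Real.mul_rpow (Nat.cast_nonneg _) (Nat.cast_nonneg _)]
    _ ≤ ∑ d ∈ Icc 1 M, (d : ℝ) ^ p * C :=
        sum_le_sum fun d _ =>
          mul_le_mul_of_nonneg_left (hC _) (Real.rpow_nonneg (Nat.cast_nonneg _) _)
    _ ≤ C * C := by
        rw [← sum_mul]; exact mul_le_mul_of_nonneg_right (hC M) hC0

/-- Writing l = dj and using submultiplicativity of the divisor function, the weights in d form the
convergent series with terms d(d)/d², so only the logarithm from the mean of d(j) remains. -/
theorem exists_sum_card_divisors_mul_le :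
    ∃ C : ℝ, 0 ≤ C ∧ ∀ M : ℕ,
      ∑ l ∈ Icc 1 M, (l.divisors.card : ℝ) * ∑ d ∈ l.divisors, 1 / (d : ℝ)
        ≤ C * (M * (1 + Real.log M)) := by
  obtain ⟨C, hC0, hC⟩ := exists_sum_card_divisors_rpow_le (p := -2) (by norm_num)
  refine ⟨C, hC0, fun M => ?_⟩
  have h := sum_sum_divisors M fun d l => (l.divisors.card : ℝ) * (1 / (d : ℝ))
  simp only [← mul_sum] at h
  have hL : 0 ≤ 1 + Real.log M := add_nonneg zero_le_one (Real.log_natCast_nonneg _)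
  rw [h]
  calc ∑ d ∈ Icc 1 M, ∑ j ∈ Icc 1 (M / d), ((d * j).divisors.card : ℝ) * (1 / (d : ℝ))
      ≤ ∑ d ∈ Icc 1 M, ((d.divisors.card : ℝ) * (d : ℝ) ^ (-2 : ℝ)) * (M * (1 + Real.log M)) := by
        refine sum_le_sum fun d hd => ?_
        have hd0 : (0 : ℝ) < d := by exact_mod_cast (mem_Icc.1 hd).1
        calc ∑ j ∈ Icc 1 (M / d), ((d * j).divisors.card : ℝ) * (1 / (d : ℝ))
            ≤ ∑ j ∈ Icc 1 (M / d), (d.divisors.card * (j.divisors.card : ℝ)) * (1 / (d : ℝ)) :=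
              sum_le_sum fun j _ =>
                mul_le_mul_of_nonneg_right (card_divisors_mul_le d j) (by positivity)
          _ = d.divisors.card * (1 / (d : ℝ)) * ∑ j ∈ Icc 1 (M / d), (j.divisors.card : ℝ) := by
              rw [mul_sum]; exact sum_congr rfl fun j _ => by ring
          _ ≤ d.divisors.card * (1 / (d : ℝ)) * ((M : ℝ) / d * (1 + Real.log M)) :=
              mul_le_mul_of_nonneg_left ((sum_card_divisors_le _).trans (cast_div_mul_log_le M d))
                (by positivity)
          _ = _ := by
              rw [Real.rpow_neg hd0.le, Real.rpow_two]; field_simp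
    _ ≤ _ := by
        rw [← sum_mul]
        exact mul_le_mul_of_nonneg_right (hC M) (mul_nonneg (Nat.cast_nonneg _) hL)

theorem sqrt_gcd_le (l ξ : ℕ) (hl : l ≠ 0) :
    Real.sqrt (Nat.gcd l ξ) ≤ ∑ d ∈ l.divisors, if d ∣ ξ then Real.sqrt d else 0 := by
  have h := single_le_sum (f := fun d : ℕ => if d ∣ ξ then Real.sqrt d else 0) (s := l.divisors)
    (fun d _ => by split_ifs <;> positivity)
    (Nat.mem_divisors.2 ⟨Nat.gcd_dvd_left l ξ, hl⟩)
  simpa [Nat.gcd_dvd_right] using h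

/-- Replace √gcd by the sum of √d over common divisors d and put ξ = dj: then √d · d^{-3/2} = 1/d
and the j-sum converges. -/
theorem exists_sum_sqrt_gcd_le :
    ∃ C : ℝ, 0 ≤ C ∧ ∀ l Z : ℕ, l ≠ 0 →
      ∑ ξ ∈ Icc 1 Z, Real.sqrt (Nat.gcd l ξ) * (ξ : ℝ) ^ (-(3 / 2) : ℝ)
        ≤ C * ∑ d ∈ l.divisors, 1 / (d : ℝ) := by
  obtain ⟨C, hC0, hC⟩ := exists_sum_rpow_le (p := -(3 / 2)) (by norm_num)
  refine ⟨C, hC0, fun l Z hl => ?_⟩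
  calc ∑ ξ ∈ Icc 1 Z, Real.sqrt (Nat.gcd l ξ) * (ξ : ℝ) ^ (-(3 / 2) : ℝ)
      ≤ ∑ ξ ∈ Icc 1 Z, ∑ d ∈ l.divisors,
          if d ∣ ξ then Real.sqrt d * (ξ : ℝ) ^ (-(3 / 2) : ℝ) else 0 := by
        refine sum_le_sum fun ξ _ => ?_
        refine (mul_le_mul_of_nonneg_right (sqrt_gcd_le l ξ hl)
          (Real.rpow_nonneg (Nat.cast_nonneg _) _)).trans (le_of_eq ?_)
        rw [sum_mul]
        exact sum_congr rfl fun d _ => by split_ifs <;> simp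
    _ = ∑ d ∈ l.divisors, Real.sqrt d * ∑ j ∈ Icc 1 (Z / d), ((d * j : ℕ) : ℝ) ^ (-(3 / 2) : ℝ) := by
        rw [sum_comm]
        refine sum_congr rfl fun d hd => ?_
        rw [← sum_filter, ← mul_sum, sum_Icc_filter_dvd Z d (Nat.pos_of_mem_divisors hd).ne'
          fun ξ => (ξ : ℝ) ^ (-(3 / 2) : ℝ)]
    _ ≤ ∑ d ∈ l.divisors, C * (1 / (d : ℝ)) := by
        refine sum_le_sum fun d hd => ?_
        have hd0 : (0 : ℝ) < d := by exact_mod_cast Nat.pos_of_mem_divisors hd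
        have h1 : Real.sqrt d * (d : ℝ) ^ (-(3 / 2) : ℝ) = 1 / d := by
          rw [Real.sqrt_eq_rpow, ← Real.rpow_add hd0]
          norm_num [Real.rpow_neg_one]
        calc Real.sqrt d * ∑ j ∈ Icc 1 (Z / d), ((d * j : ℕ) : ℝ) ^ (-(3 / 2) : ℝ)
            = (Real.sqrt d * (d : ℝ) ^ (-(3 / 2) : ℝ)) * ∑ j ∈ Icc 1 (Z / d), (j : ℝ) ^ (-(3 / 2) : ℝ) := by
              rw [mul_assoc, mul_sum (Icc 1 (Z / d)) _ ((d : ℝ) ^ (-(3 / 2) : ℝ))]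
              congr 1
              refine sum_congr rfl fun j _ => ?_
              rw [Nat.cast_mul, Real.mul_rpow (Nat.cast_nonneg _) (Nat.cast_nonneg _)]
          _ ≤ (1 / d) * C := by
              rw [h1]; exact mul_le_mul_of_nonneg_left (hC _) (by positivity)
          _ = _ := mul_comm _ _
    _ = _ := by rw [mul_sum]

/-! ### Summation over the pairs (l, f) -/

theorem pairs_eq_empty {Y : ℝ} (hY : Y < 1) : pairs Y = ∅ := by
  refine eq_empty_of_forall_notMem fun q hq => ?_
  obtain ⟨h1, h2, h⟩ := (mem_pairs Y q.1 q.2).1 hq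
  have h1' : (1 : ℝ) ≤ q.1 := by exact_mod_cast h1
  have h2' : (1 : ℝ) ≤ q.2 := by exact_mod_cast h2
  nlinarith [one_le_pow₀ h2' (n := 2)]

theorem sum_pairs_le {Y : ℝ} {φ : ℕ → ℕ → ℝ} (hφ : ∀ l f, 0 ≤ φ l f) :
    ∑ q ∈ pairs Y, φ q.1 q.2 ≤ ∑ f ∈ Icc 1 ⌊Y⌋₊, ∑ l ∈ Icc 1 ⌊Y / (f : ℝ) ^ 2⌋₊, φ l f := by
  rw [sum_sigma']
  have h : ∑ q ∈ pairs Y, φ q.1 q.2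
      = ∑ p ∈ (pairs Y).image fun q => (⟨q.2, q.1⟩ : Σ _ : ℕ, ℕ), φ p.2 p.1 := by
    rw [sum_image]
    rintro ⟨a, b⟩ _ ⟨c, d⟩ _ h
    simp only [Sigma.mk.injEq, heq_eq_eq] at h
    rw [h.1, h.2]
  rw [h]
  refine sum_le_sum_of_subset_of_nonneg ?_ fun p _ _ => hφ _ _
  intro p hp
  obtain ⟨⟨l, f⟩, hq, rfl⟩ := mem_image.1 hp
  obtain ⟨h1, h2, h3⟩ := (mem_pairs Y l f).1 hq
  have hf : f ∈ Icc 1 ⌊Y⌋₊ := (mem_product.1 (mem_filter.1 hq).1).2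
  have hf0 : (0 : ℝ) < f := by exact_mod_cast h2
  refine mem_sigma.2 ⟨hf, mem_Icc.2 ⟨h1, Nat.le_floor ?_⟩⟩
  rw [le_div_iff₀ (by positivity)]
  exact h3

/-- For fixed f the l-sum has length Y/f² and carries the weight f, so it is ≪ (Y/f)(1 + log Y); the
harmonic sum over f gives the second logarithm. -/
theorem exists_sum_pairs_le :
    ∃ C : ℝ, 0 ≤ C ∧ ∀ Y : ℝ, 1 ≤ Y →
      ∑ q ∈ pairs Y, (q.1.divisors.card : ℝ) * q.2 * ∑ d ∈ q.1.divisors, 1 / (d : ℝ)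
        ≤ C * (Y * (1 + Real.log Y) ^ 2) := by
  obtain ⟨C, hC0, hC⟩ := exists_sum_card_divisors_mul_le
  refine ⟨C, hC0, fun Y hY => ?_⟩
  have hY0 : 0 < Y := by linarith
  have hL : 0 ≤ Real.log Y := Real.log_nonneg hY
  -- The floor may be 0, in which case `Real.log 0 = 0`.
  have hfl : ∀ y : ℝ, 0 ≤ y → y ≤ Y → 1 + Real.log ⌊y⌋₊ ≤ 1 + Real.log Y := by
    intro y hy hyY
    rcases Nat.eq_zero_or_pos ⌊y⌋₊ with h | h
    · rw [h]; simpa using hL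
    · have h1 : (0 : ℝ) < ⌊y⌋₊ := by exact_mod_cast h
      linarith [Real.log_le_log h1 ((Nat.floor_le hy).trans hyY)]
  refine (sum_pairs_le (φ := fun l f => (l.divisors.card : ℝ) * f * ∑ d ∈ l.divisors, 1 / (d : ℝ))
    fun l f => by positivity).trans ?_
  calc _ ≤ ∑ f ∈ Icc 1 ⌊Y⌋₊, C * Y * (1 + Real.log Y) * (1 / (f : ℝ)) := by
        refine sum_le_sum fun f hf => ?_
        have hf1 : (1 : ℝ) ≤ f := by exact_mod_cast (mem_Icc.1 hf).1
        have hf0 : (0 : ℝ) < f := by linarith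
        have hy0 : 0 ≤ Y / (f : ℝ) ^ 2 := by positivity
        have hyY : Y / (f : ℝ) ^ 2 ≤ Y := div_le_self hY0.le (one_le_pow₀ hf1)
        calc ∑ l ∈ Icc 1 ⌊Y / (f : ℝ) ^ 2⌋₊, (l.divisors.card : ℝ) * f * ∑ d ∈ l.divisors, 1 / (d : ℝ)
            = f * ∑ l ∈ Icc 1 ⌊Y / (f : ℝ) ^ 2⌋₊,
                (l.divisors.card : ℝ) * ∑ d ∈ l.divisors, 1 / (d : ℝ) := by
              rw [mul_sum]; exact sum_congr rfl fun l _ => by ring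
          _ ≤ f * (C * ((Y / (f : ℝ) ^ 2) * (1 + Real.log Y))) := by
              refine mul_le_mul_of_nonneg_left ((hC _).trans ?_) hf0.le
              refine mul_le_mul_of_nonneg_left ?_ hC0
              exact mul_le_mul (Nat.floor_le hy0) (hfl _ hy0 hyY)
                (add_nonneg zero_le_one (Real.log_natCast_nonneg _)) hy0
          _ = _ := by field_simp
    _ ≤ C * Y * (1 + Real.log Y) * (1 + Real.log Y) := by
        rw [← mul_sum]
        exact mul_le_mul_of_nonneg_left
          ((sum_one_div_le_one_add_log _).trans (hfl Y hY0.le le_rfl)) (by positivity)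
    _ = _ := by ring

end

section

/-! ### Bounds for `S₂` -/

open Finset

theorem sum_Ioc_int_eq (Z : ℤ) (ψ : ℤ → ℝ) :
    ∑ ξ ∈ Ioc (0 : ℤ) Z, ψ ξ = ∑ j ∈ Icc 1 Z.toNat, ψ j := by
  refine (sum_bij (fun (j : ℕ) _ => (j : ℤ)) ?_ ?_ ?_ ?_).symm
  · intro j hj
    rw [mem_Icc] at hj
    rw [mem_Ioc]
    omega
  · intro a _ b _ h
    exact_mod_cast h
  · intro ξ hξ
    rw [mem_Ioc] at hξ
    exact ⟨ξ.toNat, by rw [mem_Icc]; omega, by simp; omega⟩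
  · intro _ _; rfl

theorem exists_norm_S₂_term_le (k : ℕ) : ∃ C : ℝ, 0 ≤ C ∧ ∀ (l f n j : ℕ),
    l ≠ 0 → f ≠ 0 → n ≠ 0 → j ≠ 0 →
      ‖Kl l f j n / (Real.sqrt (l : ℝ) : ℂ)
        * (fourierI k l f j n / ((((l : ℝ) * (f : ℝ) ^ 2) ^ (3 / 2 : ℝ) : ℝ) : ℂ))‖
      ≤ C * (n : ℝ) ^ (-(3 / 4) : ℝ) * ((l.divisors.card : ℝ) * f
        * (Real.sqrt (Nat.gcd l j) * (j : ℝ) ^ (-(3 / 2) : ℝ))) := by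
  obtain ⟨C, hC0, hC⟩ := exists_norm_fourierI_le k
  refine ⟨16 * C, by positivity, fun l f n j hl hf hn hj => ?_⟩
  have hl0 : (0 : ℝ) < l := by exact_mod_cast Nat.pos_of_ne_zero hl
  have hf0 : (0 : ℝ) < f := by exact_mod_cast Nat.pos_of_ne_zero hf
  have hn0 : (0 : ℝ) < n := by exact_mod_cast Nat.pos_of_ne_zero hn
  have hj0 : (0 : ℝ) < j := by exact_mod_cast Nat.pos_of_ne_zero hj
  have hsl : 0 < Real.sqrt l := Real.sqrt_pos.2 hl0
  have hsn : 0 < Real.sqrt n := Real.sqrt_pos.2 hn0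
  have hm : 0 < (l : ℝ) * (f : ℝ) ^ 2 := by positivity
  have hK := norm_Kl_le hl hf j n
  rw [Int.gcd_natCast_natCast] at hK
  have hI := hC l f j n hl hf (by exact_mod_cast Nat.pos_of_ne_zero hj) hn
  rw [Int.cast_natCast, Real.div_rpow hm.le (by positivity)] at hI
  set M := ((l : ℝ) * (f : ℝ) ^ 2) ^ (3 / 2 : ℝ) with hM
  have hM0 : 0 < M := Real.rpow_pos_of_pos hm _
  have hj32 : ((j : ℝ) * Real.sqrt n) ^ (3 / 2 : ℝ)
      = ((j : ℝ) ^ (-(3 / 2) : ℝ) * (n : ℝ) ^ (-(3 / 4) : ℝ))⁻¹ := by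
    rw [Real.mul_rpow hj0.le hsn.le, Real.sqrt_eq_rpow, ← Real.rpow_mul hn0.le, mul_inv,
      ← Real.rpow_neg hj0.le, ← Real.rpow_neg hn0.le]
    norm_num
  rw [hj32, div_inv_eq_mul] at hI
  rw [norm_mul, norm_div, norm_div, Complex.norm_real, Complex.norm_real, Real.norm_of_nonneg hsl.le,
    Real.norm_of_nonneg hM0.le]
  have h1 : ‖Kl l f j n‖ / Real.sqrt l ≤ 16 * l.divisors.card * f * Real.sqrt (Nat.gcd l j) := by
    rw [div_le_iff₀ hsl]
    exact hK.trans (le_of_eq (by ring))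
  have h2 : ‖fourierI k l f j n‖ / M ≤ C * ((j : ℝ) ^ (-(3 / 2) : ℝ) * (n : ℝ) ^ (-(3 / 4) : ℝ)) := by
    rw [div_le_iff₀ hM0]
    exact hI.trans (le_of_eq (by ring))
  refine (mul_le_mul h1 h2 (by positivity) (by positivity)).trans (le_of_eq (by ring))

theorem S₂_eq_zero {k : ℕ} {c₁ c₂ κ α : ℝ} {n : ℕ} (h : c₁ * (n : ℝ) ^ (1 / 4 - κ) < 1) :
    S₂ k c₁ c₂ κ α n = 0 := by
  rw [S₂, pairs_eq_empty h, sum_empty]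

/-- Since the ξ-sum converges absolutely, extending it costs nothing and the result depends on Y
alone. -/
theorem exists_norm_S₂_le (k : ℕ) (c₁ c₂ κ α : ℝ) : ∃ C : ℝ, 0 ≤ C ∧ ∀ n : ℕ, n ≠ 0 →
    1 ≤ c₁ * (n : ℝ) ^ (1 / 4 - κ) →
      ‖S₂ k c₁ c₂ κ α n‖ ≤ C * (n : ℝ) ^ (-(3 / 4) : ℝ)
        * (c₁ * (n : ℝ) ^ (1 / 4 - κ) * (1 + Real.log (c₁ * (n : ℝ) ^ (1 / 4 - κ))) ^ 2) := by
  obtain ⟨C₁, h₁0, h₁⟩ := exists_norm_S₂_term_le k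
  obtain ⟨C₂, h₂0, h₂⟩ := exists_sum_sqrt_gcd_le
  obtain ⟨C₃, h₃0, h₃⟩ := exists_sum_pairs_le
  refine ⟨C₁ * C₂ * C₃, by positivity, fun n hn hY => ?_⟩
  set Y := c₁ * (n : ℝ) ^ (1 / 4 - κ) with hYdef
  set Z := ⌊c₂ * (n : ℝ) ^ (1 / 6 + κ + α)⌋ with hZ
  have hn0 : 0 ≤ C₁ * (n : ℝ) ^ (-(3 / 4) : ℝ) :=
    mul_nonneg h₁0 (Real.rpow_nonneg (Nat.cast_nonneg _) _)
  rw [S₂, ← hYdef, ← hZ]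
  calc _ ≤ ∑ q ∈ pairs Y, C₁ * (n : ℝ) ^ (-(3 / 4) : ℝ) * C₂
        * ((q.1.divisors.card : ℝ) * q.2 * ∑ d ∈ q.1.divisors, 1 / (d : ℝ)) := by
        refine (norm_sum_le _ _).trans (sum_le_sum fun q hq => ?_)
        obtain ⟨hl, hf, -⟩ := (mem_pairs Y q.1 q.2).1 hq
        rw [Nat.one_le_iff_ne_zero] at hl hf
        refine (norm_sum_le _ _).trans ?_
        rw [sum_Ioc_int_eq Z fun ξ => ‖Kl q.1 q.2 ξ n / (Real.sqrt (q.1 : ℝ) : ℂ)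
          * (fourierI k q.1 q.2 ξ n / ((((q.1 : ℝ) * (q.2 : ℝ) ^ 2) ^ (3 / 2 : ℝ) : ℝ) : ℂ))‖]
        calc _ ≤ ∑ j ∈ Icc 1 Z.toNat, C₁ * (n : ℝ) ^ (-(3 / 4) : ℝ) * ((q.1.divisors.card : ℝ) * q.2
              * (Real.sqrt (Nat.gcd q.1 j) * (j : ℝ) ^ (-(3 / 2) : ℝ))) :=
              sum_le_sum fun j hj =>
                h₁ q.1 q.2 n j hl hf hn (Nat.one_le_iff_ne_zero.1 (mem_Icc.1 hj).1)
          _ = C₁ * (n : ℝ) ^ (-(3 / 4) : ℝ) * ((q.1.divisors.card : ℝ) * q.2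
              * ∑ j ∈ Icc 1 Z.toNat, Real.sqrt (Nat.gcd q.1 j) * (j : ℝ) ^ (-(3 / 2) : ℝ)) := by
              rw [mul_sum, mul_sum]
          _ ≤ C₁ * (n : ℝ) ^ (-(3 / 4) : ℝ) * ((q.1.divisors.card : ℝ) * q.2
              * (C₂ * ∑ d ∈ q.1.divisors, 1 / (d : ℝ))) := by
              refine mul_le_mul_of_nonneg_left (mul_le_mul_of_nonneg_left ?_ (by positivity)) hn0
              exact h₂ q.1 Z.toNat hl
          _ = _ := by ring
    _ = C₁ * (n : ℝ) ^ (-(3 / 4) : ℝ) * C₂ * ∑ q ∈ pairs Y,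
          (q.1.divisors.card : ℝ) * q.2 * ∑ d ∈ q.1.divisors, 1 / (d : ℝ) := by rw [mul_sum]
    _ ≤ C₁ * (n : ℝ) ^ (-(3 / 4) : ℝ) * C₂ * (C₃ * (Y * (1 + Real.log Y) ^ 2)) :=
        mul_le_mul_of_nonneg_left (h₃ Y hY) (mul_nonneg hn0 h₂0)
    _ = _ := by ring

/-- The pointwise bound for `S₂`. -/
theorem exists_norm_S₂_le_log_sq (k : ℕ) {c₁ : ℝ} (hc₁ : 0 < c₁) (c₂ κ α : ℝ) :
    ∃ C : ℝ, 0 ≤ C ∧ ∀ n : ℕ, 2 ≤ n →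
      ‖S₂ k c₁ c₂ κ α n‖ ≤ C * (Real.log (n : ℝ) ^ 2 * (n : ℝ) ^ (-(1 / 2 : ℝ) - κ)) := by
  obtain ⟨C, hC0, hC⟩ := exists_norm_S₂_le k c₁ c₂ κ α
  have hl2 : 0 < Real.log 2 := Real.log_pos (by norm_num)
  -- Chosen so that 1 + log(c₁ n^{1/4-κ}) ≤ A log n: dividing by log 2 ≤ log n absorbs the
  -- constants.
  set A := (1 + |Real.log c₁|) / Real.log 2 + |1 / 4 - κ| with hA
  have hA0 : 0 ≤ A := by positivity
  refine ⟨C * c₁ * A ^ 2, by positivity, fun n hn => ?_⟩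
  have hn2 : (2 : ℝ) ≤ n := by exact_mod_cast hn
  have hn0 : (0 : ℝ) < n := by linarith
  have hln : Real.log 2 ≤ Real.log n := Real.log_le_log (by norm_num) hn2
  have hln0 : 0 < Real.log n := hl2.trans_le hln
  rcases lt_or_ge (c₁ * (n : ℝ) ^ (1 / 4 - κ)) 1 with hY | hY
  · rw [S₂_eq_zero hY, norm_zero]
    positivity
  · refine (hC n (by omega) hY).trans ?_
    have hlog : Real.log (c₁ * (n : ℝ) ^ (1 / 4 - κ)) = Real.log c₁ + (1 / 4 - κ) * Real.log n := by
      rw [Real.log_mul hc₁.ne' (Real.rpow_pos_of_pos hn0 _).ne', Real.log_rpow hn0]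
    have h0 : 0 ≤ 1 + Real.log (c₁ * (n : ℝ) ^ (1 / 4 - κ)) :=
      add_nonneg zero_le_one (Real.log_nonneg hY)
    have h1 : 1 + Real.log (c₁ * (n : ℝ) ^ (1 / 4 - κ)) ≤ A * Real.log n := by
      rw [hlog, hA, add_mul]
      have e1 : 1 + |Real.log c₁| ≤ (1 + |Real.log c₁|) / Real.log 2 * Real.log n := by
        rw [div_mul_eq_mul_div, le_div_iff₀ hl2]
        exact mul_le_mul_of_nonneg_left hln (by positivity)
      have e2 := mul_le_mul_of_nonneg_right (le_abs_self (1 / 4 - κ)) hln0.le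
      linarith [le_abs_self (Real.log c₁)]
    have h2 : (1 + Real.log (c₁ * (n : ℝ) ^ (1 / 4 - κ))) ^ 2 ≤ (A * Real.log n) ^ 2 :=
      pow_le_pow_left₀ h0 h1 2
    have h3 : (n : ℝ) ^ (-(3 / 4) : ℝ) * (n : ℝ) ^ (1 / 4 - κ) = (n : ℝ) ^ (-(1 / 2 : ℝ) - κ) := by
      rw [← Real.rpow_add hn0]; congr 1; ring
    calc _ ≤ C * (n : ℝ) ^ (-(3 / 4) : ℝ)
          * (c₁ * (n : ℝ) ^ (1 / 4 - κ) * (A * Real.log n) ^ 2) := by gcongr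
      _ = C * c₁ * A ^ 2 * (Real.log n ^ 2 * ((n : ℝ) ^ (-(3 / 4) : ℝ) * (n : ℝ) ^ (1 / 4 - κ))) := by
          ring
      _ = _ := by rw [h3]

/-- Beyond the exponent `1/4` the range of summation of `S₂` is eventually empty. -/
theorem exists_S₂_eq_zero (k : ℕ) (c₁ c₂ α : ℝ) {κ : ℝ} (hκ : 1 / 4 < κ) :
    ∃ N : ℕ, ∀ n : ℕ, N ≤ n → S₂ k c₁ c₂ κ α n = 0 := by
  have h := ((tendsto_rpow_neg_atTop (show 0 < κ - 1 / 4 by linarith)).comp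
    tendsto_natCast_atTop_atTop).const_mul c₁
  rw [mul_zero] at h
  obtain ⟨N, hN⟩ := Filter.eventually_atTop.1 (h.eventually (eventually_lt_nhds one_pos))
  refine ⟨N, fun n hn => S₂_eq_zero ?_⟩
  have := hN n hn
  simpa only [Function.comp, neg_sub] using this

/-- Telescoping: 1/√(N+1) ≤ 2(√(N+1) - √N). -/
theorem sum_one_div_sqrt_le (N : ℕ) : ∑ n ∈ Icc 1 N, 1 / Real.sqrt n ≤ 2 * Real.sqrt N := by
  induction N with
  | zero => simp
  | succ N ih =>
    rw [sum_Icc_succ_top (by omega)]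
    have h0 : (0 : ℝ) < ((N + 1 : ℕ) : ℝ) := by exact_mod_cast N.succ_pos
    have hs := Real.sqrt_pos.2 h0
    have h1 := Real.sq_sqrt h0.le
    have h2 := Real.sq_sqrt (Nat.cast_nonneg N : (0 : ℝ) ≤ N)
    have h3 : 1 / Real.sqrt ((N + 1 : ℕ) : ℝ)
        ≤ 2 * (Real.sqrt ((N + 1 : ℕ) : ℝ) - Real.sqrt N) := by
      rw [div_le_iff₀ hs]
      push_cast at h1 ⊢
      nlinarith [sq_nonneg (Real.sqrt ((N : ℝ) + 1) - Real.sqrt N)]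
    linarith

/-- The target is bounded below for κ ≤ 1, so bounded contributions can be absorbed into it. -/
theorem one_le_log_sq_mul_rpow {X κ : ℝ} (hX : 2 ≤ X) (hκ : κ ≤ 1) :
    1 ≤ (Real.log 2 ^ 2)⁻¹ * (Real.log X ^ 2 * X ^ (1 - κ)) := by
  have hl2 : 0 < Real.log 2 := Real.log_pos (by norm_num)
  have h1 : Real.log 2 ^ 2 ≤ Real.log X ^ 2 :=
    pow_le_pow_left₀ hl2.le (Real.log_le_log (by norm_num) hX) 2
  have h2 : 1 ≤ X ^ (1 - κ) := Real.one_le_rpow (by linarith) (by linarith)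
  rw [inv_mul_eq_div, le_div_iff₀ (by positivity), one_mul]
  exact h1.trans (le_mul_of_one_le_right (sq_nonneg _) h2)

theorem lt_of_mem_Ico_ceil {X : ℝ} {n : ℕ} (hn : n ∈ Ico 1 ⌈X⌉₊) : (n : ℝ) < X :=
  Nat.lt_ceil.1 (mem_Ico.1 hn).2

/-- The average of `S₂`. -/
theorem exists_norm_sum_S₂_le (k : ℕ) {c₁ : ℝ} (hc₁ : 0 < c₁) (c₂ α : ℝ) {κ : ℝ} (hκ : κ ≤ 1) :
    ∃ C : ℝ, ∀ X : ℝ, 2 ≤ X →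
      ‖∑ n ∈ Ico 1 ⌈X⌉₊, (Real.sqrt (n : ℝ) : ℂ) * S₂ k c₁ c₂ κ α n‖
        ≤ C * (Real.log X ^ 2 * X ^ (1 - κ)) := by
  rcases lt_or_ge (1 / 4) κ with hκ4 | hκ4
  · obtain ⟨N, hN⟩ := exists_S₂_eq_zero k c₁ c₂ α hκ4
    set D := ∑ n ∈ range N, ‖(Real.sqrt (n : ℝ) : ℂ) * S₂ k c₁ c₂ κ α n‖ with hD
    have hD0 : 0 ≤ D := sum_nonneg fun _ _ => norm_nonneg _
    refine ⟨D * (Real.log 2 ^ 2)⁻¹, fun X hX => ?_⟩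
    have h1 : ‖∑ n ∈ Ico 1 ⌈X⌉₊, (Real.sqrt (n : ℝ) : ℂ) * S₂ k c₁ c₂ κ α n‖ ≤ D := by
      refine (norm_sum_le _ _).trans ?_
      rw [← sum_filter_add_sum_filter_not _ (· < N)]
      have h2 : ∑ n ∈ (Ico 1 ⌈X⌉₊).filter (¬ · < N),
          ‖(Real.sqrt (n : ℝ) : ℂ) * S₂ k c₁ c₂ κ α n‖ = 0 :=
        sum_eq_zero fun n hn => by
          rw [hN n (not_lt.1 (mem_filter.1 hn).2), mul_zero, norm_zero]
      rw [h2, add_zero]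
      exact sum_le_sum_of_subset_of_nonneg (fun n hn => mem_range.2 (mem_filter.1 hn).2)
        fun _ _ _ => norm_nonneg _
    rw [mul_assoc]
    exact h1.trans (le_mul_of_one_le_right hD0 (one_le_log_sq_mul_rpow hX hκ))
  · obtain ⟨C, hC0, hC⟩ := exists_norm_S₂_le_log_sq k hc₁ c₂ κ α
    -- The term n = 1 is kept apart: there log n = 0 and the pointwise bound does not apply.
    set D := ‖S₂ k c₁ c₂ κ α 1‖ with hD
    have hD0 : 0 ≤ D := norm_nonneg _
    refine ⟨D * (Real.log 2 ^ 2)⁻¹ + 2 * C, fun X hX => ?_⟩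
    have hX0 : 0 < X := by linarith
    have hlX : 0 ≤ Real.log X := Real.log_nonneg (by linarith)
    set W := C * Real.log X ^ 2 * X ^ (1 / 2 - κ) with hW
    have hW0 : 0 ≤ W := by positivity
    have hterm : ∀ n ∈ Ico 1 ⌈X⌉₊, ‖(Real.sqrt (n : ℝ) : ℂ) * S₂ k c₁ c₂ κ α n‖
        ≤ (if n = 1 then D else 0) + W * (1 / Real.sqrt n) := by
      intro n hn
      have hnX := lt_of_mem_Ico_ceil hn
      have hn1 := (mem_Ico.1 hn).1
      have hn1' : (1 : ℝ) ≤ n := by exact_mod_cast hn1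
      have hn0 : (0 : ℝ) < n := by linarith
      rw [norm_mul, Complex.norm_real, Real.norm_of_nonneg (Real.sqrt_nonneg _)]
      rcases hn1.eq_or_lt with rfl | hn2
      · simp only [if_true, Nat.cast_one, Real.sqrt_one, one_mul]
        exact le_add_of_nonneg_right (by positivity)
      · rw [if_neg (by omega), zero_add]
        have h1 : Real.sqrt n * ((n : ℝ) ^ (-(1 / 2 : ℝ) - κ))
            = (n : ℝ) ^ (1 / 2 - κ) * (1 / Real.sqrt n) := by
          rw [Real.sqrt_eq_rpow, one_div ((n : ℝ) ^ (1 / 2 : ℝ)), ← Real.rpow_neg hn0.le,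
            ← Real.rpow_add hn0, ← Real.rpow_add hn0]
          congr 1; ring
        have h2 : Real.log n ^ 2 ≤ Real.log X ^ 2 :=
          pow_le_pow_left₀ (Real.log_nonneg hn1') (Real.log_le_log hn0 hnX.le) 2
        -- Monotonicity needs a nonnegative exponent, which κ ≤ 1/4 provides.
        have h3 : (n : ℝ) ^ (1 / 2 - κ) ≤ X ^ (1 / 2 - κ) :=
          Real.rpow_le_rpow hn0.le hnX.le (by linarith)
        calc Real.sqrt n * ‖S₂ k c₁ c₂ κ α n‖
            ≤ Real.sqrt n * (C * (Real.log (n : ℝ) ^ 2 * (n : ℝ) ^ (-(1 / 2 : ℝ) - κ))) :=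
              mul_le_mul_of_nonneg_left (hC n hn2) (Real.sqrt_nonneg _)
          _ = C * Real.log (n : ℝ) ^ 2 * (Real.sqrt n * (n : ℝ) ^ (-(1 / 2 : ℝ) - κ)) := by ring
          _ = C * Real.log (n : ℝ) ^ 2 * (n : ℝ) ^ (1 / 2 - κ) * (1 / Real.sqrt n) := by
              rw [h1]; ring
          _ ≤ W * (1 / Real.sqrt n) := by rw [hW]; gcongr
    have hsum : ∑ n ∈ Ico 1 ⌈X⌉₊, 1 / Real.sqrt n ≤ 2 * Real.sqrt X := by
      have hsub : Ico 1 ⌈X⌉₊ ⊆ Icc 1 ⌊X⌋₊ := fun n hn =>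
        mem_Icc.2 ⟨(mem_Ico.1 hn).1, Nat.le_floor (lt_of_mem_Ico_ceil hn).le⟩
      refine (sum_le_sum_of_subset_of_nonneg hsub fun _ _ _ => by positivity).trans
        ((sum_one_div_sqrt_le _).trans ?_)
      have := Real.sqrt_le_sqrt (Nat.floor_le hX0.le)
      linarith
    have hD1 : ∑ n ∈ Ico 1 ⌈X⌉₊, (if n = 1 then D else 0) ≤ D := by
      rw [sum_ite_eq']
      split_ifs
      · exact le_rfl
      · exact hD0
    have hXX : X ^ (1 / 2 - κ) * Real.sqrt X = X ^ (1 - κ) := by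
      rw [Real.sqrt_eq_rpow, ← Real.rpow_add hX0]; congr 1; ring
    calc _ ≤ ∑ n ∈ Ico 1 ⌈X⌉₊, ((if n = 1 then D else 0) + W * (1 / Real.sqrt n)) :=
          (norm_sum_le _ _).trans (sum_le_sum hterm)
      _ ≤ D + W * (2 * Real.sqrt X) := by
          rw [sum_add_distrib, ← mul_sum]
          exact add_le_add hD1 (mul_le_mul_of_nonneg_left hsum hW0)
      _ = D + 2 * C * (Real.log X ^ 2 * X ^ (1 - κ)) := by rw [hW, ← hXX]; ring
      _ ≤ D * ((Real.log 2 ^ 2)⁻¹ * (Real.log X ^ 2 * X ^ (1 - κ)))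
          + 2 * C * (Real.log X ^ 2 * X ^ (1 - κ)) := by
          gcongr
          exact le_mul_of_one_le_right hD0 (one_le_log_sq_mul_rpow hX hκ)
      _ = _ := by ring

end

end BeyondEndoscopy

end

theorem theorem4p7 (k : ℕ) (hk : 3 ≤ k) (κ α : ℝ) (hκ : 0 < κ) (hα : 0 < α)
    (hα' : α ≤ 1 / 12) (c₁ c₂ : ℝ) (hc₁ : 0 < c₁) (hc₂ : 0 < c₂) :
    (∃ C : ℝ, ∀ n : ℕ, 2 ≤ n →
      ‖BeyondEndoscopy.S₂ k c₁ c₂ κ α n‖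
        ≤ C * (Real.log (n : ℝ) ^ 2 * (n : ℝ) ^ (-(1 / 2 : ℝ) - κ))) ∧
    (κ ≤ 1 → ∃ C : ℝ, ∀ X : ℝ, 2 ≤ X →
      ‖∑ n ∈ Finset.Ico 1 ⌈X⌉₊,
          (Real.sqrt (n : ℝ) : ℂ) * BeyondEndoscopy.S₂ k c₁ c₂ κ α n‖
        ≤ C * (Real.log X ^ 2 * X ^ (1 - κ))) := by
  exact ⟨(BeyondEndoscopy.exists_norm_S₂_le_log_sq k hc₁ c₂ κ α).imp fun _ h => h.2,
    BeyondEndoscopy.exists_norm_sum_S₂_le k hc₁ c₂ α⟩
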